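/- Consider the restricted Min-Max allocation (makespan) problem: there are $m$ machines and $n\ge 1$ jobs $J_1,\dots,J_n$, a bipartite graph $H$ between machines and jobs, and processing times $p_1,\dots,p_n\in\mathbb{Q}_{>0}$; job $J_j$ takes $p_j$ units of time on each machine adjacent to it in $H$ and cannot be executed on other machines, and every job is adjacent to at least one machine. A feasible assignment assigns every job to a machine adjacent to it; its makespan is the maximum over the machines of the total processing time of the jobs assigned to the machine, and it is to be minimized. The instance is on an inclusion-free convex graph: the jobs are given in an order $J_1,\dots,J_n$ such that the neighbourhood $N(M)$ of every machine $M$ consists of consecutive jobs, and whenever $N(M)\subseteq N(M')$ for machines $M,M'$, the jobs of $N(M')\setminus N(M)$ are consecutive. For every integer $k\ge 4$ there are an integer $C\ge 0$ with $C\le k^{1.4}$ and $C\le\left\lceil \log k/\log(1+\tfrac1k)\right\rceil$, and an algorithm that, on every such instance, computes a feasible assignment whose makespan is at most $1+\frac4k+\frac3{k^2}$ times the optimal one, in time $O\big((m+n)\,m\,n^{2(C+1)}\big)$, where the constant depends only on $k$. Consequently the problem has a PTAS: for every $\varepsilon>0$ there is an algorithm that computes on every such instance, in time polynomial in $m+n$,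 a feasible assignment whose makespan is at most $1+\varepsilon$ times the optimal one. Here time is the number of steps of a random access machine that adds, subtracts, compares and scales by fixed constants stored rational numbers at unit cost, that adds, subtracts and compares stored natural numbers and uses them as addresses at unit cost, and that has no multiplication of two stored numbers. -/

import Mathlib

/-! ### A unit-cost random access machine with structured programs

The memory has finitely many named arrays in use: arrays of natural numbers (for indices and
control) and arrays of rational numbers (for processing times).  Stored numbers can be added,
subtracted, compared and scaled by constants written in the program; there is no multiplication
of two stored numbers, so a computation of `t` steps only increases bit lengths by `O(t)`
and the model is polynomially equivalent to Turing machines. -/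

namespace RAM

/-- A memory content: `idx a i` is cell `i` of the array `a` of natural numbers, `val a i` is
cell `i` of the array `a` of rational numbers. -/
structure State where
  idx : ℕ → ℕ → ℕ
  val : ℕ → ℕ → ℚ

/-- Index expressions; `get a e` is the content of the cell of the array `a` whose position is
the value of `e` (so nested `get`s are indirect addressing), `sub` is truncated subtraction. -/
inductive NExp where
  | const (c : ℕ)
  | get (a : ℕ) (e : NExp)
  | add (e f : NExp)
  | sub (e f : NExp)

/-- Rational expressions. -/
inductive QExp where
  | const (c : ℚ)
  | get (a : ℕ) (e : NExp)
  | add (e f : QExp)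
  | sub (e f : QExp)
  | scale (c : ℚ) (e : QExp)

/-- Tests. -/
inductive BExp where
  | leN (e f : NExp)
  | leQ (e f : QExp)

/-- Programs. -/
inductive Cmd where
  | skip
  | setN (a : ℕ) (e f : NExp)
  | setQ (a : ℕ) (e : NExp) (f : QExp)
  | seq (c d : Cmd)
  | cond (b : BExp) (c d : Cmd)
  | loop (b : BExp) (c : Cmd)

namespace NExp

/-- The value of an index expression. -/
def eval (s : State) : NExp → ℕ
  | const c => c
  | get a e => s.idx a (e.eval s)
  | add e f => e.eval s + f.eval s
  | sub e f => e.eval s - f.eval s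

/-- Evaluating an expression takes one step for each of its nodes. -/
def cost : NExp → ℕ
  | const _ => 1
  | get _ e => e.cost + 1
  | add e f => e.cost + f.cost + 1
  | sub e f => e.cost + f.cost + 1

end NExp

namespace QExp

/-- The value of a rational expression. -/
def eval (s : State) : QExp → ℚ
  | const c => c
  | get a e => s.val a (e.eval s)
  | add e f => e.eval s + f.eval s
  | sub e f => e.eval s - f.eval s
  | scale c e => c * e.eval s

/-- Evaluating an expression takes one step for each of its nodes. -/
def cost : QExp → ℕ
  | const _ => 1
  | get _ e => e.cost + 1
  | add e f => e.cost + f.cost + 1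
  | sub e f => e.cost + f.cost + 1
  | scale _ e => e.cost + 1

end QExp

namespace BExp

/-- The truth value of a test. -/
def Holds (s : State) : BExp → Prop
  | leN e f => e.eval s ≤ f.eval s
  | leQ e f => e.eval s ≤ f.eval s

/-- A test takes one step in addition to the evaluation of its two sides. -/
def cost : BExp → ℕ
  | leN e f => e.cost + f.cost + 1
  | leQ e f => e.cost + f.cost + 1

end BExp

namespace State

/-- Write `v` to cell `i` of the index array `a`. -/
def setN (s : State) (a i v : ℕ) : State where
  idx := Function.update s.idx a (Function.update (s.idx a) i v)
  val := s.val

/-- Write `v` to cell `i` of the rational array `a`. -/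
def setQ (s : State) (a i : ℕ) (v : ℚ) : State where
  idx := s.idx
  val := Function.update s.val a (Function.update (s.val a) i v)

end State

/-- `Exec c s t s'`: the program `c`, started in the memory `s`, halts after exactly `t` steps with
the memory `s'`. -/
inductive Exec : Cmd → State → ℕ → State → Prop where
  | skip (s : State) : Exec Cmd.skip s 1 s
  | setN (a : ℕ) (e f : NExp) (s : State) :
      Exec (Cmd.setN a e f) s (e.cost + f.cost + 1) (s.setN a (e.eval s) (f.eval s))
  | setQ (a : ℕ) (e : NExp) (f : QExp) (s : State) :
      Exec (Cmd.setQ a e f) s (e.cost + f.cost + 1) (s.setQ a (e.eval s) (f.eval s))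
  | seq {c d : Cmd} {s s' s'' : State} {t t' : ℕ} :
      Exec c s t s' → Exec d s' t' s'' → Exec (Cmd.seq c d) s (t + t') s''
  | condTrue {b : BExp} {c d : Cmd} {s s' : State} {t : ℕ} :
      b.Holds s → Exec c s t s' → Exec (Cmd.cond b c d) s (b.cost + t) s'
  | condFalse {b : BExp} {c d : Cmd} {s s' : State} {t : ℕ} :
      ¬ b.Holds s → Exec d s t s' → Exec (Cmd.cond b c d) s (b.cost + t) s'
  | loopTrue {b : BExp} {c : Cmd} {s s' s'' : State} {t t' : ℕ} :
      b.Holds s → Exec c s t s' → Exec (Cmd.loop b c) s' t' s'' →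
      Exec (Cmd.loop b c) s (b.cost + t + t') s''
  | loopFalse {b : BExp} {c : Cmd} {s : State} :
      ¬ b.Holds s → Exec (Cmd.loop b c) s b.cost s

end RAM

/-! ### The restricted min-max allocation problem

`m` machines, `n` jobs in a given order; `E i j = true` if machine `i` can execute job `j`; job `j`
has processing time `p j` on every machine that can execute it. -/

namespace MinMax

/-- The set of the jobs that machine `i` can execute. -/
def nbhd {m n : ℕ} (E : Fin m → Fin n → Bool) (i : Fin m) : Set (Fin n) :=
  {j | E i j = true}

/-- The neighbourhood of each machine consists of consecutive jobs. -/
def AdjacencyProperty {m n : ℕ} (E : Fin m → Fin n → Bool) : Prop :=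
  ∀ i, (nbhd E i).OrdConnected

/-- Whenever one neighbourhood contains another one, their difference consists of
consecutive jobs. -/
def EnclosureProperty {m n : ℕ} (E : Fin m → Fin n → Bool) : Prop :=
  ∀ i i', nbhd E i ⊆ nbhd E i' → (nbhd E i' \ nbhd E i).OrdConnected

/-- An instance on an inclusion-free convex graph: at least one job, positive processing
times, every job can be executed on some machine, and the order of the jobs has the adjacency and the
enclosure property. -/
structure IsInstance {m n : ℕ} (E : Fin m → Fin n → Bool) (p : Fin n → ℚ) : Prop where
  jobs_pos : 0 < n
  time_pos : ∀ j, 0 < p j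
  executable : ∀ j, ∃ i, E i j = true
  adjacency : AdjacencyProperty E
  enclosure : EnclosureProperty E

/-- A feasible assignment: every job is assigned to a machine that can execute it. -/
def IsFeasible {m n : ℕ} (E : Fin m → Fin n → Bool) (a : Fin n → Fin m) : Prop :=
  ∀ j, E (a j) j = true

/-- The makespan: the maximum load of a machine. -/
noncomputable def makespan {m n : ℕ} (p : Fin n → ℚ) (a : Fin n → Fin m) : ℝ :=
  ⨆ i : Fin m, ∑ j with a j = i, (p j : ℝ)

/-- The initial memory: cells 0 and 1 of index array 0 hold `m` and `n`, index array 1 holds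
the `m × n` adjacency matrix row by row, rational array 0 holds the processing times, and
all other cells hold 0. -/
def input {m n : ℕ} (E : Fin m → Fin n → Bool) (p : Fin n → ℚ) : RAM.State where
  idx a x :=
    if a = 0 then (if x = 0 then m else if x = 1 then n else 0)
    else if a = 1 then (if ∃ i : Fin m, ∃ j : Fin n, x = i * n + j ∧ E i j = true then 1 else 0)
    else 0
  val a x := if h : a = 0 ∧ x < n then p ⟨x, h.2⟩ else 0

/-- In the memory `s` index array 2 holds the assignment `a`: cell `j` is the machine of job `j`. -/
def IsOutput {m n : ℕ} (s : RAM.State) (a : Fin n → Fin m) : Prop :=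
  ∀ j : Fin n, s.idx 2 j = a j

/-- On every instance with `m` machines and `n` jobs the program `P` halts within `T m n` steps and
outputs a feasible assignment whose makespan is at most `ρ` times the optimal one. -/
def IsApproxAlgorithm (P : RAM.Cmd) (ρ : ℝ) (T : ℕ → ℕ → ℕ) : Prop :=
  ∀ (m n : ℕ) (E : Fin m → Fin n → Bool) (p : Fin n → ℚ), IsInstance E p →
    ∃ (t : ℕ) (s : RAM.State) (a : Fin n → Fin m),
      RAM.Exec P (input E p) t s ∧ t ≤ T m n ∧ IsOutput s a ∧ IsFeasible E a ∧
      ∀ b : Fin n → Fin m, IsFeasible E b → makespan p a ≤ ρ * makespan p b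

end MinMax

/-!
The optimum `T` is guessed up to the factor `1 + 1 / k`: the largest processing time is a lower
bound, `n` times it an upper bound, and the guess grows in steps of `1 / k` times it. Jobs of size
at most `T / k` form the class `0`, and the other jobs fall into classes `1, …, C` of sizes that
differ at most by the factor `1 + 2 / k`.

By the enclosure property, sorting the intervals of the machines by the sum of their ends sorts them
by both ends. Hence an assignment can be rearranged, within each class separately, so that the
machines in this order receive consecutive jobs of the class. The large jobs of a class keep their
number on each machine, so their load grows at most by the factor `1 + 2 / k`; the small jobs keep
their load on each machine up to one job, that is, up to `T / k`. So if the guess is at least the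
optimum, there is an assignment of this form with loads at most `(1 + 3 / k) T`.

An assignment of this form is a path through the vectors of positions, one position for each of the
`C + 1` classes, and a dynamic program over the `(n + 1) ^ (C + 1)` vectors finds it. Rounding is
needed only in this argument: the loads computed by the program are true loads.
-/

namespace RAM

/-- The program `c`, started in `s`, halts within `t` steps in a memory satisfying `Q`. -/
def Runs (c : Cmd) (s : State) (t : ℕ) (Q : State → Prop) : Prop :=
  ∃ t' s', Exec c s t' s' ∧ t' ≤ t ∧ Q s'

theorem Runs.mono {c : Cmd} {s : State} {t t' : ℕ} {Q Q' : State → Prop} (h : Runs c s t Q)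
    (ht : t ≤ t') (hQ : ∀ s', Q s' → Q' s') : Runs c s t' Q' := by
  obtain ⟨u, s', he, hu, hq⟩ := h
  exact ⟨u, s', he, hu.trans ht, hQ _ hq⟩

theorem Runs.le {c : Cmd} {s : State} {t t' : ℕ} {Q : State → Prop} (h : Runs c s t Q)
    (ht : t ≤ t') : Runs c s t' Q :=
  h.mono ht fun _ hq => hq

theorem Runs.skip {s : State} {Q : State → Prop} (h : Q s) : Runs Cmd.skip s 1 Q :=
  ⟨1, s, Exec.skip s, le_rfl, h⟩

theorem Runs.setN {a : ℕ} {e f : NExp} {s : State} {Q : State → Prop}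
    (h : Q (s.setN a (e.eval s) (f.eval s))) :
    Runs (Cmd.setN a e f) s (e.cost + f.cost + 1) Q :=
  ⟨_, _, Exec.setN a e f s, le_rfl, h⟩

theorem Runs.setQ {a : ℕ} {e : NExp} {f : QExp} {s : State} {Q : State → Prop}
    (h : Q (s.setQ a (e.eval s) (f.eval s))) :
    Runs (Cmd.setQ a e f) s (e.cost + f.cost + 1) Q :=
  ⟨_, _, Exec.setQ a e f s, le_rfl, h⟩

theorem Runs.seq {c d : Cmd} {s : State} {t t' : ℕ} {Q : State → Prop}
    (h : Runs c s t (fun s' => Runs d s' t' Q)) : Runs (Cmd.seq c d) s (t + t') Q := by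
  obtain ⟨u, s', he, hu, u', s'', he', hu', hq⟩ := h
  exact ⟨_, _, Exec.seq he he', by omega, hq⟩

theorem Runs.cond {b : BExp} {c d : Cmd} {s : State} {t t' : ℕ} {Q : State → Prop}
    (h₁ : b.Holds s → Runs c s t Q) (h₂ : ¬ b.Holds s → Runs d s t' Q) :
    Runs (Cmd.cond b c d) s (b.cost + max t t') Q := by
  by_cases hb : b.Holds s
  · obtain ⟨u, s', he, hu, hq⟩ := h₁ hb
    exact ⟨_, _, Exec.condTrue hb he, by omega, hq⟩
  · obtain ⟨u, s', he, hu, hq⟩ := h₂ hb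
    exact ⟨_, _, Exec.condFalse hb he, by omega, hq⟩

theorem Runs.loop {b : BExp} {c : Cmd} {t G : ℕ} {Q : State → Prop} (I : ℕ → State → Prop)
    (hG : ∀ g s, I g s → b.Holds s → g < G)
    (hstep : ∀ g s, I g s → b.Holds s → Runs c s t (I (g + 1)))
    (hQ : ∀ g s, I g s → ¬ b.Holds s → Q s) {s : State} (h0 : I 0 s) :
    Runs (Cmd.loop b c) s (G * (b.cost + t) + b.cost) Q := by
  have key : ∀ d g s, I g s → G - g ≤ d →
      Runs (Cmd.loop b c) s (d * (b.cost + t) + b.cost) Q := by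
    intro d
    induction d with
    | zero =>
      intro g s hI hd
      have hb : ¬ b.Holds s := fun hb => by have := hG g s hI hb; omega
      exact ⟨_, _, Exec.loopFalse hb, by omega, hQ g s hI hb⟩
    | succ d ih =>
      intro g s hI hd
      by_cases hb : b.Holds s
      · obtain ⟨u, s', he, hu, hq⟩ := hstep g s hI hb
        obtain ⟨u', s'', he', hu', hq'⟩ := ih (g + 1) s' hq (by omega)
        refine ⟨_, _, Exec.loopTrue hb he he', ?_, hq'⟩
        rw [Nat.succ_mul]; omega
      · exact ⟨_, _, Exec.loopFalse hb, by omega, hQ g s hI hb⟩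
  exact key G 0 s h0 (by omega)

/-- The memories `s` and `s'` agree on all arrays whose number satisfies `P`. -/
def Agree (P : ℕ → Prop) (s s' : State) : Prop :=
  ∀ a, P a → s'.idx a = s.idx a ∧ s'.val a = s.val a

namespace Agree

variable {P P' : ℕ → Prop} {s s' s'' : State}

theorem refl (P : ℕ → Prop) (s : State) : Agree P s s := fun _ _ => ⟨rfl, rfl⟩

theorem trans (h : Agree P s s') (h' : Agree P s' s'') : Agree P s s'' := fun a ha =>
  ⟨(h' a ha).1.trans (h a ha).1, (h' a ha).2.trans (h a ha).2⟩

theorem mono (h : Agree P s s') (hP : ∀ a, P' a → P a) : Agree P' s s' := fun a ha => h a (hP a ha)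

theorem idx (h : Agree P s s') {a : ℕ} (ha : P a) : s'.idx a = s.idx a := (h a ha).1

theorem val (h : Agree P s s') {a : ℕ} (ha : P a) : s'.val a = s.val a := (h a ha).2

theorem setN (h : Agree P s s') {a i v : ℕ} (ha : ¬ P a) : Agree P s (s'.setN a i v) := by
  intro b hb
  have : b ≠ a := fun e => ha (e ▸ hb)
  exact ⟨by simpa [State.setN, Function.update_of_ne this] using (h b hb).1, (h b hb).2⟩

theorem setQ (h : Agree P s s') {a i : ℕ} {v : ℚ} (ha : ¬ P a) : Agree P s (s'.setQ a i v) := by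
  intro b hb
  have : b ≠ a := fun e => ha (e ▸ hb)
  exact ⟨(h b hb).1, by simpa [State.setQ, Function.update_of_ne this] using (h b hb).2⟩

end Agree

namespace State

@[simp] theorem setN_idx (s : State) (a i v b j : ℕ) :
    (s.setN a i v).idx b j = if b = a ∧ j = i then v else s.idx b j := by
  by_cases h : b = a
  · subst h; simp [setN, Function.update_apply]
  · simp [setN, h]

@[simp] theorem setN_val (s : State) (a i v : ℕ) : (s.setN a i v).val = s.val := rfl

@[simp] theorem setQ_val (s : State) (a i : ℕ) (v : ℚ) (b j : ℕ) :
    (s.setQ a i v).val b j = if b = a ∧ j = i then v else s.val b j := by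
  by_cases h : b = a
  · subst h; simp [setQ, Function.update_apply]
  · simp [setQ, h]

@[simp] theorem setQ_idx (s : State) (a i : ℕ) (v : ℚ) : (s.setQ a i v).idx = s.idx := rfl

end State

/-- The scalar variable stored in cell 0 of the index array `a`. -/
abbrev NExp.var (a : ℕ) : NExp := NExp.get a (NExp.const 0)

/-- Run `c` with the variable `a` counting from 0 up to the value of `b` (exclusively). -/
def Cmd.forTo (a : ℕ) (b : NExp) (c : Cmd) : Cmd :=
  Cmd.seq (Cmd.setN a (NExp.const 0) (NExp.const 0))
    (Cmd.loop (BExp.leN (NExp.add (NExp.var a) (NExp.const 1)) b)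
      (Cmd.seq c (Cmd.setN a (NExp.const 0) (NExp.add (NExp.var a) (NExp.const 1)))))

theorem Runs.forTo {a : ℕ} {b : NExp} {c : Cmd} {s : State} {t N : ℕ} (P : ℕ → Prop)
    (J : ℕ → State → Prop) (ha : ¬ P a)
    (hJ : ∀ i s' x, J i s' → J i (s'.setN a 0 x))
    (hb : ∀ s', Agree P s s' → b.eval s' = N) (h0 : J 0 s)
    (hstep : ∀ i s', i < N → Agree P s s' → s'.idx a 0 = i → J i s' →
      Runs c s' t (fun s'' => Agree P s' s'' ∧ s''.idx a 0 = i ∧ J (i + 1) s'')) :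
    Runs (Cmd.forTo a b c) s ((N + 1) * (t + b.cost + 11))
      (fun s' => Agree P s s' ∧ J N s') := by
  refine Runs.le (Runs.seq (t' := N * ((b.cost + 5) + (t + 6)) + (b.cost + 5))
    (Runs.setN ?_)) ?_
  · refine Runs.le (Runs.loop (G := N) (t := t + 6)
      (fun g s' => g ≤ N ∧ Agree P s s' ∧ s'.idx a 0 = g ∧ J g s') ?_ ?_ ?_ ?_) ?_
    · rintro g s' ⟨-, hagree, hcounter, -⟩ hlt
      simp only [BExp.Holds, NExp.eval, hb _ hagree, hcounter] at hlt
      omega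
    · rintro g s' ⟨-, hagree, hcounter, hinv⟩ hlt
      simp only [BExp.Holds, NExp.eval, hb _ hagree, hcounter] at hlt
      refine Runs.seq (t' := 6) (Runs.mono (hstep g s' (by omega) hagree hcounter hinv) le_rfl ?_)
      rintro s'' ⟨hagree_step, hcounter_step, hinv_step⟩
      refine Runs.le (Runs.setN ?_) (by simp [NExp.cost])
      refine ⟨by omega, (hagree.trans hagree_step).setN ha, by simp [NExp.eval, hcounter_step],
        hJ _ _ _ hinv_step⟩
    · rintro g s' ⟨hle, hagree, hcounter, hinv⟩ hdone
      simp only [BExp.Holds, NExp.eval, hb _ hagree, hcounter] at hdone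
      obtain rfl : g = N := by omega
      exact ⟨hagree, hinv⟩
    · exact ⟨by omega, (Agree.refl P s).setN ha, by simp [NExp.eval], hJ _ _ _ h0⟩
    · simp only [BExp.cost, NExp.cost]
      apply le_of_eq; ring
  · simp only [NExp.cost]
    nlinarith

end RAM

namespace ConvexMakespan

/-- The digit of `v` at place `c` in base `b`. Vectors of positions are coded by numbers with
`b = n + 1`, so that advancing one position adds a power of `b`. -/
def digit (b c v : ℕ) : ℕ := v / b ^ c % b

section Digits

variable {b c c' v : ℕ}

theorem digit_lt (hb : 0 < b) : digit b c v < b := Nat.mod_lt _ hb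

theorem digit_zero : digit b c 0 = 0 := by simp [digit]

theorem digit_of_lt_pow (h : v < b ^ c) : digit b c v = 0 := by simp [digit, Nat.div_eq_of_lt h]

theorem add_pow_div_pow (hb : 0 < b) : (v + b ^ c) / b ^ c = v / b ^ c + 1 :=
  Nat.add_div_right _ (Nat.pow_pos hb)

theorem one_mod_add_lt (h : digit b c v + 1 < b) : v / b ^ c % b + 1 % b < b := by
  rwa [Nat.mod_eq_of_lt (show 1 < b by omega)]

theorem add_pow_div_pow_of_lt (h : digit b c v + 1 < b) (hc : c < c') :
    (v + b ^ c) / b ^ c' = v / b ^ c' := by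
  induction c', hc using Nat.le_induction with
  | base =>
    rw [pow_succ, ← Nat.div_div_eq_div_mul, ← Nat.div_div_eq_div_mul,
      add_pow_div_pow (by omega), Nat.add_div_eq_of_add_mod_lt (one_mod_add_lt h),
      Nat.div_eq_of_lt (show 1 < b by omega), add_zero]
  | succ c' _ ih => rw [pow_succ, ← Nat.div_div_eq_div_mul, ih, Nat.div_div_eq_div_mul]

theorem digit_add_pow_self (h : digit b c v + 1 < b) :
    digit b c (v + b ^ c) = digit b c v + 1 := by
  rw [digit, add_pow_div_pow (by omega), Nat.add_mod_of_add_mod_lt (one_mod_add_lt h),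
    Nat.mod_eq_of_lt (show 1 < b by omega), digit]

theorem digit_add_pow_of_add_one_eq (hb : 0 < b) (h : digit b c v + 1 = b) :
    digit b c (v + b ^ c) = 0 := by
  rw [digit, add_pow_div_pow hb, ← Nat.mod_add_mod, ← digit, h, Nat.mod_self]

theorem digit_add_pow_of_ne (h : digit b c v + 1 < b) (hc : c' ≠ c) :
    digit b c' (v + b ^ c) = digit b c' v := by
  rcases lt_or_gt_of_ne hc with hc | hc
  · obtain ⟨e, rfl⟩ := Nat.exists_eq_add_of_lt hc
    have hpow : b ^ (c' + e + 1) = b ^ c' * (b * b ^ e) := by ring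
    rw [digit, hpow, Nat.add_mul_div_left _ _ (Nat.pow_pos (by omega)),
      Nat.add_mul_mod_self_left, digit]
  · rw [digit, add_pow_div_pow_of_lt h hc, digit]

theorem add_pow_lt_pow (h : digit b c v + 1 < b) (hc : c < c') (hv : v < b ^ c') :
    v + b ^ c < b ^ c' := by
  have hdiv := add_pow_div_pow_of_lt h hc
  rw [Nat.div_eq_of_lt hv] at hdiv
  exact (Nat.div_eq_zero_iff_lt (Nat.pow_pos (by omega))).1 hdiv

theorem digit_add_mul_pow_self {e : ℕ} (h : digit b c v + e < b) :
    digit b c (v + e * b ^ c) = digit b c v + e := by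
  induction e with
  | zero => simp
  | succ e ih =>
    have hd := ih (by omega)
    rw [add_one_mul, ← add_assoc, digit_add_pow_self (by omega), hd, add_assoc]

theorem digit_add_mul_pow_of_ne {e : ℕ} (h : digit b c v + e < b) (hc : c' ≠ c) :
    digit b c' (v + e * b ^ c) = digit b c' v := by
  induction e with
  | zero => simp
  | succ e ih =>
    have hd := digit_add_mul_pow_self (e := e) (by omega : digit b c v + e < b)
    rw [add_one_mul, ← add_assoc, digit_add_pow_of_ne (by omega) hc, ih (by omega)]

theorem add_mul_pow_lt_pow {e : ℕ} (h : digit b c v + e < b) (hc : c < c') (hv : v < b ^ c') :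
    v + e * b ^ c < b ^ c' := by
  induction e with
  | zero => simpa
  | succ e ih =>
    have hd := digit_add_mul_pow_self (e := e) (by omega : digit b c v + e < b)
    rw [add_one_mul, ← add_assoc]
    exact add_pow_lt_pow (by omega) hc (ih (by omega))

theorem digit_pow_sub_one (hb : 0 < b) (h : c < c') : digit b c (b ^ c' - 1) = b - 1 := by
  have hpos : 0 < b ^ c := Nat.pow_pos hb
  have hlt : b ^ c' - 1 < b ^ c' := Nat.sub_lt (Nat.pow_pos hb) one_pos
  by_contra hne
  have hd := digit_lt (c := c) (v := b ^ c' - 1) hb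
  have := add_pow_lt_pow (by omega) h hlt
  omega

theorem eq_pow_sub_one_of_digit_eq (hb : 0 < b) (hv : v < b ^ c)
    (h : ∀ d < c, digit b d v = b - 1) : v = b ^ c - 1 := by
  suffices key : ∀ d ≤ c, v % b ^ d + 1 = b ^ d by
    have := key c le_rfl
    rw [Nat.mod_eq_of_lt hv] at this
    omega
  intro d hd
  induction d with
  | zero => simp [Nat.mod_one]
  | succ d ih =>
    obtain ⟨b, rfl⟩ : ∃ b', b = b' + 1 := ⟨b - 1, by omega⟩
    have hdigit : v / (b + 1) ^ d % (b + 1) = b := h d (by omega)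
    have := ih (by omega)
    rw [pow_succ, Nat.mod_mul, hdigit, mul_add_one]
    omega

end Digits

theorem fold_induction {α : Type*} {f : ℕ → α → α} {q : ℕ} {x : α} (I : ℕ → α → Prop)
    (zero : I 0 x) (succ : ∀ i < q, ∀ y, I i y → I (i + 1) (f i y)) :
    I q (Nat.fold q (fun i _ => f i) x) := by
  induction q with
  | zero => simpa
  | succ q ih =>
    rw [Nat.fold_succ]
    exact succ q q.lt_succ_self _ (ih fun i hi => succ i (by omega))

/-! ### The dynamic program -/

/-- A table of the dynamic program: for every code `v` of a vector of positions, the load of the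
current machine and a partial assignment `row v`. -/
@[ext]
structure Table where
  load : ℕ → ℚ
  row : ℕ → ℕ → ℕ

namespace Table

variable {t : Table} {w : ℕ} {x : ℚ} {a : ℕ → ℕ}

/-- Replace the entry at `w` if this lowers its load. -/
def improve (t : Table) (w : ℕ) (x : ℚ) (a : ℕ → ℕ) : Table :=
  if x < t.load w then ⟨Function.update t.load w x, Function.update t.row w a⟩ else t

theorem improve_load_le (u : ℕ) : (t.improve w x a).load u ≤ t.load u := by
  unfold improve
  split_ifs with h
  · rcases eq_or_ne u w with rfl | hu
    · simpa using h.le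
    · simp [hu]
  · exact le_rfl

theorem improve_load_self_le : (t.improve w x a).load w ≤ x := by
  unfold improve
  split_ifs with h
  · simp
  · exact not_lt.1 h

end Table

/-- An instance in which machine `i < m` can execute the jobs `j` with `L i ≤ j < R i` and the jobs
`j < n` are divided into the classes `0, …, C`, together with a bound `B` for the loads. A job
whose class exceeds `C` is never assigned by the dynamic program. -/
structure IntervalInstance where
  m : ℕ
  n : ℕ
  C : ℕ
  p : ℕ → ℚ
  cls : ℕ → ℕ
  B : ℚ
  L : ℕ → ℕ
  R : ℕ → ℕ

namespace IntervalInstance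

variable (d : IntervalInstance)

/-- The number of codes of vectors of positions `≤ n`, one for each class. -/
def numCodes : ℕ := (d.n + 1) ^ (d.C + 1)

/-- The position for class `c` in the vector coded by `v`: the jobs of class `c` before this
position are assigned, the others are not. -/
abbrev pos (c v : ℕ) : ℕ := digit (d.n + 1) c v

/-- The difference of codes corresponding to one step in the position for class `c`. -/
abbrev stride (c : ℕ) : ℕ := (d.n + 1) ^ c

/-- Move the position for class `c` past the next job, which is assigned to the machine `cur` with
the jobs `l ≤ j < r` if it has class `c`. -/
def relax (cur l r c v : ℕ) (t : Table) : Table :=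
  if t.load v ≤ d.B ∧ d.pos c v < d.n then
    if d.cls (d.pos c v) = c then
      if l ≤ d.pos c v ∧ d.pos c v < r ∧ t.load v + d.p (d.pos c v) ≤ d.B then
        t.improve (v + d.stride c) (t.load v + d.p (d.pos c v))
          (Function.update (t.row v) (d.pos c v) cur)
      else t
    else t.improve (v + d.stride c) (t.load v) (t.row v)
  else t

/-- All steps in class `c`. Codes increase in a step, so one pass in the order of the codes follows
whole chains of steps. -/
def phase (cur l r c : ℕ) (t : Table) : Table :=
  Nat.fold d.numCodes (fun v _ => d.relax cur l r c v) t

/-- Set the load at the code `v` to zero if the entry is valid. -/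
def resetAt (v : ℕ) (t : Table) : Table :=
  if t.load v ≤ d.B then ⟨Function.update t.load v 0, t.row⟩ else t

/-- Turn to a new current machine, which has load zero everywhere. -/
def reset (t : Table) : Table := Nat.fold d.numCodes (fun v _ => d.resetAt v) t

/-- Extend the partial assignments by jobs `l ≤ j < r` on the new current machine `cur`. -/
def process (cur l r : ℕ) (t : Table) : Table :=
  Nat.fold (d.C + 1) (fun c _ => d.phase cur l r c) (d.reset t)

/-- The machines are processed by increasing key. On inclusion-free instances this sorts their
intervals by both ends. -/
def key (i : ℕ) : ℕ := d.L i + d.R i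

/-- Process the machines with key `s`. -/
def sweepKey (s : ℕ) (t : Table) : Table :=
  Nat.fold d.m (fun i _ t => if d.key i = s then d.process i (d.L i) (d.R i) t else t) t

/-- Process all machines. -/
def sweep (t : Table) : Table := Nat.fold (2 * d.n + 1) (fun s _ => d.sweepKey s) t

/-- The initial table, where only the empty assignment is valid. -/
def start (a : ℕ → ℕ → ℕ) : Table := ⟨fun v => if v = 0 then 0 else d.B + 1, a⟩

/-- The whole dynamic program. A last dummy machine `m` with an empty interval moves all positions
past the jobs of other classes. -/
def solve (a : ℕ → ℕ → ℕ) : Table := d.process d.m 1 0 (d.sweep (d.start a))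

theorem numCodes_pos : 0 < d.numCodes := Nat.pow_pos d.n.succ_pos

/-- The job `j` is assigned at the code `v`. -/
def Done (v j : ℕ) : Prop := j < d.pos (d.cls j) v

instance (v j : ℕ) : Decidable (d.Done v j) := inferInstanceAs (Decidable (_ < _))

/-- The load of the machine `i` in the partial assignment `a` at the code `v`. -/
def load (a : ℕ → ℕ) (v i : ℕ) : ℚ := ∑ j ∈ Finset.range d.n with d.Done v j ∧ a j = i, d.p j

/-- The machine `i` can execute the job `j`. -/
def CanRun (i j : ℕ) : Prop := i < d.m ∧ d.L i ≤ j ∧ j < d.R i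

/-- `a` is a partial assignment for the code `v` that uses machines from `P` only and has load at
most `x` on the current machine `cur`. -/
structure IsPartial (P : ℕ → Prop) (cur v : ℕ) (x : ℚ) (a : ℕ → ℕ) : Prop where
  feasible : ∀ j < d.n, d.Done v j → d.CanRun (a j) j ∧ P (a j)
  load_le : ∀ i, d.load a v i ≤ d.B
  load_cur_le : d.load a v cur ≤ x

/-- Every valid entry of the table is witnessed by its partial assignment. -/
def Sound (P : ℕ → Prop) (cur : ℕ) (t : Table) : Prop :=
  ∀ v < d.numCodes, t.load v ≤ d.B → d.IsPartial P cur v (t.load v) (t.row v)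

/-- The machine `x` is processed before the machine `i` is considered in the round for key `s`. -/
def Before (s i x : ℕ) : Prop := x < d.m ∧ (d.key x < s ∨ d.key x = s ∧ x < i)

variable {d} {P P' : ℕ → Prop} {cur cur' l r c c' v w i : ℕ} {t : Table} {x : ℚ} {a : ℕ → ℕ}

theorem pos_add_stride_self (h : d.pos c v < d.n) : d.pos c (v + d.stride c) = d.pos c v + 1 :=
  digit_add_pow_self (Nat.succ_lt_succ h)

theorem pos_add_stride_of_ne (h : d.pos c v < d.n) (hc : c' ≠ c) :
    d.pos c' (v + d.stride c) = d.pos c' v :=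
  digit_add_pow_of_ne (Nat.succ_lt_succ h) hc

theorem add_stride_lt (h : d.pos c v < d.n) (hc : c ≤ d.C) (hv : v < d.numCodes) :
    v + d.stride c < d.numCodes :=
  add_pow_lt_pow (Nat.succ_lt_succ h) (Nat.lt_succ_of_le hc) hv

theorem done_add_stride (h : d.pos c v < d.n) (j : ℕ) :
    d.Done (v + d.stride c) j ↔ d.Done v j ∨ j = d.pos c v ∧ d.cls j = c := by
  unfold Done
  by_cases hj : d.cls j = c
  · rw [hj, pos_add_stride_self h]
    omega
  · rw [pos_add_stride_of_ne h hj]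
    tauto

theorem not_done_pos (hc : d.cls (d.pos c v) = c) : ¬ d.Done v (d.pos c v) := by
  simp [Done, hc]

theorem load_take (h : d.pos c v < d.n) (hc : d.cls (d.pos c v) = c) (i : ℕ) :
    d.load (Function.update a (d.pos c v) cur) (v + d.stride c) i =
      d.load a v i + if cur = i then d.p (d.pos c v) else 0 := by
  have hite : (if cur = i then d.p (d.pos c v) else 0) =
      ∑ j ∈ Finset.range d.n, if j = d.pos c v then (if cur = i then d.p j else 0) else 0 := by
    rw [Finset.sum_ite_eq', if_pos (Finset.mem_range.2 h)]
  rw [hite, load, load, Finset.sum_filter, Finset.sum_filter, ← Finset.sum_add_distrib]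
  refine Finset.sum_congr rfl fun j _ => ?_
  rcases eq_or_ne j (d.pos c v) with rfl | hj
  · simp [done_add_stride h, not_done_pos hc, hc]
  · simp [done_add_stride h, hj]

theorem IsPartial.take (ha : d.IsPartial P cur v x a) (h : d.pos c v < d.n)
    (hc : d.cls (d.pos c v) = c) (hrun : d.CanRun cur (d.pos c v)) (hcur : P cur)
    (hB : x + d.p (d.pos c v) ≤ d.B) :
    d.IsPartial P cur (v + d.stride c) (x + d.p (d.pos c v))
      (Function.update a (d.pos c v) cur) where
  feasible j hj hdone := by
    rcases eq_or_ne j (d.pos c v) with rfl | hne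
    · simpa using ⟨hrun, hcur⟩
    · have := (done_add_stride h j).1 hdone
      simpa [hne] using ha.feasible j hj (by tauto)
  load_le i := by
    rw [load_take h hc]
    split_ifs with hi
    · subst hi
      linarith [ha.load_cur_le]
    · simpa using ha.load_le i
  load_cur_le := by
    rw [load_take h hc, if_pos rfl]
    linarith [ha.load_cur_le]

theorem IsPartial.pass (ha : d.IsPartial P cur v x a) (h : d.pos c v < d.n)
    (hc : d.cls (d.pos c v) ≠ c) : d.IsPartial P cur (v + d.stride c) x a := by
  have hdone (j : ℕ) : d.Done (v + d.stride c) j ↔ d.Done v j := by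
    rw [done_add_stride h, or_iff_left]
    rintro ⟨rfl, hj⟩
    exact hc hj
  have hload (i : ℕ) : d.load a (v + d.stride c) i = d.load a v i := by simp only [load, hdone]
  exact ⟨by simpa only [hdone] using ha.feasible, by simpa only [hload] using ha.load_le,
    by simpa only [hload] using ha.load_cur_le⟩

theorem Sound.improve (h : d.Sound P cur t) (hw : d.IsPartial P cur w x a) :
    d.Sound P cur (t.improve w x a) := by
  intro v hv hB
  unfold Table.improve at hB ⊢
  split_ifs at hB ⊢
  · rcases eq_or_ne v w with rfl | hne
    · simpa using hw
    · simpa [hne] using h v hv (by simpa [hne] using hB)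
  · exact h v hv hB

theorem Sound.relax (h : d.Sound P cur t)
    (hrun : ∀ j, l ≤ j → j < r → d.CanRun cur j ∧ P cur) (hv : v < d.numCodes) :
    d.Sound P cur (d.relax cur l r c v t) := by
  unfold IntervalInstance.relax
  split_ifs with hvalid hc htake
  · have := hrun _ htake.1 htake.2.1
    exact h.improve ((h v hv hvalid.1).take hvalid.2 hc this.1 this.2 htake.2.2)
  · exact h
  · exact h.improve ((h v hv hvalid.1).pass hvalid.2 hc)
  · exact h

theorem fold_resetAt (q : ℕ) (t : Table) :
    Nat.fold q (fun v _ => d.resetAt v) t =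
      ⟨fun v => if v < q ∧ t.load v ≤ d.B then 0 else t.load v, t.row⟩ := by
  refine fold_induction (fun q (t' : Table) =>
    t' = ⟨fun v => if v < q ∧ t.load v ≤ d.B then 0 else t.load v, t.row⟩) (by simp) ?_
  rintro q - _ rfl
  unfold resetAt
  split_ifs with h <;> ext v <;> grind

theorem reset_row : (d.reset t).row = t.row := by rw [reset, fold_resetAt]

theorem reset_load (hv : v < d.numCodes) :
    (d.reset t).load v = if t.load v ≤ d.B then 0 else t.load v := by
  simp [reset, fold_resetAt, hv]

theorem Sound.mono (h : d.Sound P cur t) (hP : ∀ i, P i → P' i) : d.Sound P' cur t :=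
  fun v hv hB => { h v hv hB with
    feasible := fun j hj hdone => ((h v hv hB).feasible j hj hdone).imp_right (hP _) }

theorem Sound.reset (h : d.Sound P cur t) (hcur : ¬ P cur') : d.Sound P cur' (d.reset t) := by
  intro v hv hB
  rw [reset_load hv] at hB ⊢
  rw [reset_row]
  split_ifs at hB ⊢ with hvalid
  · obtain ⟨hfeasible, hload, -⟩ := h v hv hvalid
    refine ⟨hfeasible, hload, (Finset.sum_eq_zero fun j hj => ?_).le⟩
    simp only [Finset.mem_filter, Finset.mem_range] at hj
    obtain ⟨hj, hdone, rfl⟩ := hj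
    exact absurd (hfeasible j hj hdone).2 hcur
  · exact absurd hB hvalid

theorem Sound.process (h : d.Sound P cur t) (hcur : ¬ P cur') (hP : ∀ i, P i → P' i)
    (hrun : ∀ j, l ≤ j → j < r → d.CanRun cur' j ∧ P' cur') :
    d.Sound P' cur' (d.process cur' l r t) :=
  fold_induction (fun _ => d.Sound P' cur') ((h.reset hcur).mono hP) fun _ _ _ hI =>
    fold_induction (fun _ => d.Sound P' cur') hI fun _ hv _ hI' => hI'.relax hrun hv

theorem sound_start (hB : 0 ≤ d.B) (a : ℕ → ℕ → ℕ) : d.Sound P cur (d.start a) := by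
  intro v _ hv
  obtain rfl : v = 0 := by
    by_contra h
    simp only [start, h, if_false] at hv
    linarith
  have hdone (j : ℕ) : ¬ d.Done 0 j := by simp [Done, digit_zero]
  constructor <;> simp [start, load, hdone, hB]

theorem Before.mono {s s' : ℕ} (h : d.Before s i v) (hs : s ≤ s') (hi : s = s' → i ≤ w) :
    d.Before s' w v := by
  unfold Before at *
  omega

theorem sound_sweepKey {s : ℕ} (h : ∃ cur, d.Sound (d.Before s 0) cur t) :
    ∃ cur, d.Sound (d.Before (s + 1) 0) cur (d.sweepKey s t) := by
  suffices key : ∃ cur, d.Sound (d.Before s d.m) cur (d.sweepKey s t) from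
    key.imp fun _ h => h.mono fun x hx => hx.mono s.le_succ (by omega)
  refine fold_induction (f := fun i t => if d.key i = s then d.process i (d.L i) (d.R i) t else t)
    (fun i t => ∃ cur, d.Sound (d.Before s i) cur t) h ?_
  rintro i hi t ⟨cur, hsound⟩
  have hmono (x : ℕ) (hx : d.Before s i x) : d.Before s (i + 1) x :=
    hx.mono le_rfl fun _ => i.le_succ
  split_ifs with hkey
  · refine ⟨i, hsound.process ?_ hmono fun j hl hr => ⟨⟨hi, hl, hr⟩, ?_⟩⟩ <;>
      unfold Before <;> omega
  · exact ⟨cur, hsound.mono hmono⟩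

theorem sound_solve (hB : 0 ≤ d.B) (a : ℕ → ℕ → ℕ) :
    d.Sound (· < d.m) d.m (d.solve a) := by
  obtain ⟨cur, hsound⟩ : ∃ cur, d.Sound (d.Before (2 * d.n + 1) 0) cur (d.sweep (d.start a)) :=
    fold_induction (fun s t => ∃ cur, d.Sound (d.Before s 0) cur t)
      ⟨0, sound_start hB a⟩ fun _ _ _ => sound_sweepKey
  refine hsound.process (fun h => lt_irrefl _ h.1) (fun i hi => hi.1) fun j _ hj => ?_
  omega

theorem pos_last (hc : c ≤ d.C) : d.pos c (d.numCodes - 1) = d.n := by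
  simp [pos, numCodes, digit_pow_sub_one d.n.succ_pos (Nat.lt_succ_of_le hc)]

theorem solve_sound (hcls : ∀ j < d.n, d.cls j ≤ d.C) (hB : 0 ≤ d.B) (a : ℕ → ℕ → ℕ)
    (hfin : (d.solve a).load (d.numCodes - 1) ≤ d.B) :
    (∀ j < d.n, d.CanRun ((d.solve a).row (d.numCodes - 1) j) j) ∧
      ∀ i, ∑ j ∈ Finset.range d.n with (d.solve a).row (d.numCodes - 1) j = i, d.p j ≤ d.B := by
  have h := sound_solve hB a _ (Nat.sub_lt d.numCodes_pos one_pos) hfin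
  have hdone (j : ℕ) (hj : j < d.n) : d.Done (d.numCodes - 1) j :=
    hj.trans_eq (pos_last (hcls j hj)).symm
  refine ⟨fun j hj => (h.feasible j hj (hdone j hj)).1, fun i => (h.load_le i).trans' ?_⟩
  refine (Finset.sum_congr (Finset.filter_congr fun j hj => ?_) fun _ _ => rfl).le
  simp [hdone j (Finset.mem_range.1 hj)]

end IntervalInstance

namespace IntervalInstance

variable {d : IntervalInstance} {cur l r c v : ℕ} {t : Table} {x : ℚ} {y : ℕ → ℕ}

/-- The processing time of the job `j` if it belongs to the class `c`. -/
def classTime (d : IntervalInstance) (c j : ℕ) : ℚ := if d.cls j = c then d.p j else 0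

/-- Some entry of the table for the positions `y` has load at most `x`. -/
def Reaches (d : IntervalInstance) (y : ℕ → ℕ) (x : ℚ) (t : Table) : Prop :=
  ∃ v < d.numCodes, (∀ c ≤ d.C, d.pos c v = y c) ∧ t.load v ≤ x

theorem classTime_nonneg (hp : ∀ j, 0 ≤ d.p j) (c j : ℕ) : 0 ≤ d.classTime c j := by
  unfold classTime
  split_ifs
  exacts [hp j, le_rfl]

theorem relax_load_le (u : ℕ) : (d.relax cur l r c v t).load u ≤ t.load u := by
  unfold relax
  split_ifs
  exacts [t.improve_load_le u, le_rfl, t.improve_load_le u, le_rfl]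

theorem fold_relax_load_le {q q' : ℕ} (h : q ≤ q') (u : ℕ) :
    (Nat.fold q' (fun v _ => d.relax cur l r c v) t).load u ≤
      (Nat.fold q (fun v _ => d.relax cur l r c v) t).load u := by
  induction q', h using Nat.le_induction with
  | base => exact le_rfl
  | succ q' _ ih => exact (relax_load_le u).trans ih

theorem relax_load_add_stride_le (hv : t.load v ≤ x) (hn : d.pos c v < d.n)
    (hlr : d.cls (d.pos c v) = c → l ≤ d.pos c v ∧ d.pos c v < r) (hx : x ≤ d.B)
    (hB : x + d.classTime c (d.pos c v) ≤ d.B) :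
    (d.relax cur l r c v t).load (v + d.stride c) ≤ x + d.classTime c (d.pos c v) := by
  unfold relax
  unfold classTime at hB ⊢
  rw [if_pos ⟨hv.trans hx, hn⟩]
  split_ifs at hB ⊢ with hc htake
  · exact Table.improve_load_self_le.trans (by gcongr)
  · exact absurd ⟨(hlr hc).1, (hlr hc).2, by linarith⟩ htake
  · exact Table.improve_load_self_le.trans (by linarith)

theorem fold_relax_load_add_mul_stride_le (hp : ∀ j, 0 ≤ d.p j) (hv : t.load v ≤ x) {e q : ℕ}
    (hn : d.pos c v + e ≤ d.n)
    (hlr : ∀ j, d.pos c v ≤ j → j < d.pos c v + e → d.cls j = c → l ≤ j ∧ j < r)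
    (hB : x + ∑ j ∈ Finset.Ico (d.pos c v) (d.pos c v + e), d.classTime c j ≤ d.B)
    (hq : v + e * d.stride c ≤ q) :
    (Nat.fold q (fun v _ => d.relax cur l r c v) t).load (v + e * d.stride c) ≤
      x + ∑ j ∈ Finset.Ico (d.pos c v) (d.pos c v + e), d.classTime c j := by
  induction e generalizing q with
  | zero => simpa using (fold_relax_load_le (Nat.zero_le q) v).trans hv
  | succ e ih =>
    have he : d.pos c v + e < d.n := hn
    have hpos : d.pos c (v + e * d.stride c) = d.pos c v + e :=
      digit_add_mul_pow_self (Nat.lt_succ_of_le he.le)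
    have hcode : v + (e + 1) * d.stride c = v + e * d.stride c + d.stride c := by ring
    have hstride : 0 < d.stride c := Nat.pow_pos d.n.succ_pos
    have hlast := classTime_nonneg hp c (d.pos c v + e)
    rw [← add_assoc, Finset.sum_Ico_succ_top (by omega), ← add_assoc] at hB ⊢
    have hload := ih (by omega) (fun j hj hj' => hlr j hj (by omega)) (by linarith) le_rfl
    have hrelax := relax_load_add_stride_le (d := d) (cur := cur) (c := c) hload (by omega)
      (by rw [hpos]; exact hlr _ (by omega) (by omega)) (by linarith) (by rwa [hpos])
    rw [hpos, ← hcode] at hrelax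
    exact (fold_relax_load_le (q := v + e * d.stride c + 1) (by omega) _).trans hrelax

theorem Reaches.phase (hp : ∀ j, 0 ≤ d.p j) (h : d.Reaches y x t) (hc : c ≤ d.C) {z : ℕ}
    (hyz : y c ≤ z) (hzn : z ≤ d.n) (hlr : ∀ j, y c ≤ j → j < z → d.cls j = c → l ≤ j ∧ j < r)
    (hB : x + ∑ j ∈ Finset.Ico (y c) z, d.classTime c j ≤ d.B) :
    d.Reaches (Function.update y c z) (x + ∑ j ∈ Finset.Ico (y c) z, d.classTime c j)
      (d.phase cur l r c t) := by
  obtain ⟨v, hv, hpos, hx⟩ := h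
  obtain ⟨e, rfl⟩ := Nat.exists_eq_add_of_le hyz
  rw [← hpos c hc] at hyz hzn hlr hB ⊢
  have hdigit : digit (d.n + 1) c v + e < d.n + 1 := Nat.lt_succ_of_le hzn
  have hlt : v + e * d.stride c < d.numCodes :=
    add_mul_pow_lt_pow hdigit (Nat.lt_succ_of_le hc) hv
  refine ⟨v + e * d.stride c, hlt, fun c' hc' => ?_,
    fold_relax_load_add_mul_stride_le hp hx hzn hlr hB hlt.le⟩
  rcases eq_or_ne c' c with rfl | hne
  · simpa using digit_add_mul_pow_self hdigit
  · simpa [hne, ← hpos c' hc'] using digit_add_mul_pow_of_ne hdigit hne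

theorem Reaches.process (hp : ∀ j, 0 ≤ d.p j) (h : d.Reaches y d.B t) {y' : ℕ → ℕ}
    (hy : ∀ c ≤ d.C, y c ≤ y' c) (hy' : ∀ c ≤ d.C, y' c ≤ d.n)
    (hlr : ∀ c ≤ d.C, ∀ j, y c ≤ j → j < y' c → d.cls j = c → l ≤ j ∧ j < r)
    (hB : ∑ c ∈ Finset.range (d.C + 1), ∑ j ∈ Finset.Ico (y c) (y' c), d.classTime c j ≤ d.B) :
    d.Reaches y' d.B (d.process cur l r t) := by
  suffices key : d.Reaches (fun c => if c < d.C + 1 then y' c else y c)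
      (∑ c ∈ Finset.range (d.C + 1), ∑ j ∈ Finset.Ico (y c) (y' c), d.classTime c j)
      (d.process cur l r t) by
    obtain ⟨v, hv, hpos, hx⟩ := key
    refine ⟨v, hv, fun c hc => (hpos c hc).trans (if_pos (Nat.lt_succ_of_le hc)), hx.trans hB⟩
  refine fold_induction (fun q => d.Reaches (fun c => if c < q then y' c else y c)
    (∑ c ∈ Finset.range q, ∑ j ∈ Finset.Ico (y c) (y' c), d.classTime c j)) ?_ ?_
  · obtain ⟨v, hv, hpos, hx⟩ := h
    exact ⟨v, hv, by simpa using hpos, by simp [reset_load hv, hx]⟩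
  · intro q hq s hs
    have hle := (Finset.sum_le_sum_of_subset_of_nonneg (Finset.range_subset_range.2 hq)
      fun c _ _ => Finset.sum_nonneg fun j _ => classTime_nonneg hp c j).trans hB
    rw [Finset.sum_range_succ] at hle ⊢
    have hqC := Nat.le_of_lt_succ hq
    have := hs.phase (cur := cur) (l := l) (r := r) hp hqC (z := y' q)
      (by simpa using hy q hqC) (hy' q hqC) (by simpa using hlr q hqC) (by simpa using hle)
    convert this using 1
    · ext c
      rcases lt_trichotomy c q with hc | rfl | hc
      · simp [hc, hc.trans q.lt_succ_self, hc.ne]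
      · simp
      · simp [hc.ne', hc.not_gt, hc.not_ge]
    · simp

end IntervalInstance

/-! ### Rearrangement of assignments -/

section Cuts

variable {K : Type*} [AddCommGroup K] {n i j a : ℕ} {u : ℕ → K} {b : ℕ → ℕ} {P P' : ℕ → Prop}

open Classical in
/-- The total weight of the jobs `j < n` that `b` assigns to machines in `P`. -/
noncomputable def weightOn (n : ℕ) (u : ℕ → K) (b : ℕ → ℕ) (P : ℕ → Prop) : K :=
  ∑ j ∈ Finset.range n with P (b j), u j

theorem weightOn_insert (hP' : ∀ y, P' y ↔ P y ∨ y = i) (hi : ¬ P i) :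
    weightOn n u b P' = weightOn n u b P + ∑ j ∈ Finset.range n with b j = i, u j := by
  classical
  simp only [weightOn, hP', Finset.filter_or]
  refine Finset.sum_union (Finset.disjoint_filter.2 fun j _ hj hji => hi ?_)
  rwa [hji] at hj

variable [LinearOrder K] {x x' ω : K}

open Classical in
/-- The first position with jobs of total weight at least `x` before it, or `n`. Giving the
machines consecutive jobs between such positions keeps their weights up to the weight of one
job. -/
noncomputable def cut (n : ℕ) (u : ℕ → K) (x : K) : ℕ :=
  Nat.find (p := fun a => a = n ∨ x ≤ ∑ j ∈ Finset.range a, u j) ⟨n, Or.inl rfl⟩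

theorem cut_le : cut n u x ≤ n := by
  classical exact Nat.find_min' _ (Or.inl rfl)

theorem sum_range_lt_of_lt_cut (h : a < cut n u x) : ∑ j ∈ Finset.range a, u j < x := by
  classical exact lt_of_not_ge fun h' => Nat.find_min _ h (Or.inr h')

theorem le_sum_range_cut (h : cut n u x < n) : x ≤ ∑ j ∈ Finset.range (cut n u x), u j := by
  classical
  exact (Nat.find_spec (p := fun a => a = n ∨ x ≤ ∑ j ∈ Finset.range a, u j)
    ⟨n, Or.inl rfl⟩).resolve_left h.ne

theorem cut_zero : cut n u 0 = 0 := by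
  by_contra h
  simpa using sum_range_lt_of_lt_cut (Nat.pos_of_ne_zero h)

theorem cut_mono (h : x ≤ x') : cut n u x ≤ cut n u x' := by
  by_contra! hlt
  exact ((le_sum_range_cut (hlt.trans_le cut_le)).trans_lt (sum_range_lt_of_lt_cut hlt)).not_ge h

variable [IsOrderedAddMonoid K]

theorem weightOn_mono (hu : ∀ j, 0 ≤ u j) (h : ∀ y, P y → P' y) :
    weightOn n u b P ≤ weightOn n u b P' := by
  classical
  exact Finset.sum_le_sum_of_subset_of_nonneg
    (Finset.monotone_filter_right _ fun j _ hj => h _ hj) fun j _ _ => hu j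

theorem weightOn_le_sum_range (hu : ∀ j, 0 ≤ u j) (h : ∀ j < n, P (b j) → j < a) :
    weightOn n u b P ≤ ∑ j ∈ Finset.range a, u j := by
  classical
  refine Finset.sum_le_sum_of_subset_of_nonneg (fun j hj => ?_) fun j _ _ => hu j
  rw [Finset.mem_filter, Finset.mem_range] at hj
  exact Finset.mem_range.2 (h j hj.1 hj.2)

theorem sum_range_le_weightOn (hu : ∀ j, 0 ≤ u j) (ha : a ≤ n) (h : ∀ j < a, P (b j)) :
    ∑ j ∈ Finset.range a, u j ≤ weightOn n u b P := by
  classical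
  refine Finset.sum_le_sum_of_subset_of_nonneg (fun j hj => ?_) fun j _ _ => hu j
  rw [Finset.mem_range] at hj
  exact Finset.mem_filter.2 ⟨Finset.mem_range.2 (hj.trans_le ha), h j hj⟩

theorem sum_range_mono (hu : ∀ j, 0 ≤ u j) {a' : ℕ} (h : a ≤ a') :
    ∑ j ∈ Finset.range a, u j ≤ ∑ j ∈ Finset.range a', u j :=
  Finset.sum_le_sum_of_subset_of_nonneg (Finset.range_subset_range.2 h) fun j _ _ => hu j

theorem lt_of_lt_cut_weightOn (hu : ∀ j, 0 ≤ u j) (h : ∀ j < n, P (b j) → j < a)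
    (hj : j < cut n u (weightOn n u b P)) : j < a := by
  by_contra! haj
  exact (sum_range_lt_of_lt_cut hj).not_ge
    ((weightOn_le_sum_range hu h).trans (sum_range_mono hu haj))

theorem le_of_cut_weightOn_le (hu : ∀ j, 0 ≤ u j) (h : ∀ j < n, ¬ P (b j) → a ≤ j)
    (hj : cut n u (weightOn n u b P) ≤ j) (hjn : j < n) (huj : 0 < u j) : a ≤ j := by
  by_contra! hja
  have hle : ∑ j ∈ Finset.range (j + 1), u j ≤ weightOn n u b P :=
    sum_range_le_weightOn hu hjn fun j' hj' => by
      by_contra hP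
      exact absurd (h j' (by omega) hP) (by omega)
  rw [Finset.sum_range_succ] at hle
  have hlt : ∑ j ∈ Finset.range j, u j < weightOn n u b P :=
    (lt_add_of_pos_right _ huj).trans_le hle
  exact hlt.not_ge ((le_sum_range_cut (hj.trans_lt hjn)).trans (sum_range_mono hu hj))

theorem sum_Ico_cut_le (hω : 0 ≤ ω) (h : x ≤ x')
    (hstep : ∀ j < n, ∑ j ∈ Finset.range j, u j < x' →
      ∑ j ∈ Finset.range (j + 1), u j ≤ x' + ω) :
    ∑ j ∈ Finset.Ico (cut n u x) (cut n u x'), u j ≤ x' - x + ω := by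
  rcases (cut_mono (n := n) (u := u) h).eq_or_lt with heq | hlt
  · rw [heq, Finset.Ico_self, Finset.sum_empty]
    exact add_nonneg (sub_nonneg.2 h) hω
  obtain ⟨j, hj⟩ := Nat.exists_eq_add_one_of_ne_zero hlt.ne_bot
  have hjcut : j < cut n u x' := by omega
  have hle := hstep j (hjcut.trans_le cut_le) (sum_range_lt_of_lt_cut hjcut)
  have hx := le_sum_range_cut (hlt.trans_le cut_le)
  rw [Finset.sum_Ico_eq_sub _ hlt.le, hj, sub_add_eq_add_sub]
  exact sub_le_sub hle hx

theorem sum_Ico_cut_le_of_le (hω : 0 ≤ ω) (h : x ≤ x') (hu : ∀ j < n, u j ≤ ω) :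
    ∑ j ∈ Finset.Ico (cut n u x) (cut n u x'), u j ≤ x' - x + ω :=
  sum_Ico_cut_le hω h fun j hj hlt => by
    rw [Finset.sum_range_succ]
    exact add_le_add hlt.le (hu j hj)

end Cuts

theorem sum_Ico_cut_le_of_int {n : ℕ} {u : ℕ → ℚ} {x x' : ℚ} (h : x ≤ x')
    (hu : ∀ j, u j ∈ (Int.castAddHom ℚ).range) (hu' : ∀ j, u j ≤ 1)
    (hx' : x' ∈ (Int.castAddHom ℚ).range) :
    ∑ j ∈ Finset.Ico (cut n u x) (cut n u x'), u j ≤ x' - x := by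
  have hstep (j : ℕ) (hlt : ∑ j ∈ Finset.range j, u j < x') :
      ∑ j ∈ Finset.range (j + 1), u j ≤ x' := by
    obtain ⟨z, hz⟩ := sum_mem (t := Finset.range j) fun j _ => hu j
    obtain ⟨z', rfl⟩ := hx'
    rw [← hz] at hlt
    have hle : (z : ℚ) + 1 ≤ z' := by exact_mod_cast Int.add_one_le_of_lt (Int.cast_lt.1 hlt)
    rw [Finset.sum_range_succ, ← hz]
    exact (add_le_add_right (hu' j) _).trans hle
  simpa using sum_Ico_cut_le le_rfl h fun j _ hlt => by simpa using hstep j hlt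

namespace IntervalInstance

variable {d : IntervalInstance} {b : ℕ → ℕ} {P P' : ℕ → Prop} {c i j s : ℕ} {t : Table}
  {lo : ℕ → ℚ} {ρ σ T : ℚ}

/-- The weight of the job `j` in the rearrangement of the class `c`: small jobs, which form the
class `0`, are weighted by their processing times, the others are counted. -/
def classWeight (d : IntervalInstance) (c j : ℕ) : ℚ :=
  if d.cls j = c then if c = 0 then d.p j else 1 else 0

/-- The position for the class `c` after the jobs on machines from `P` when the jobs of this class
in the assignment `b` are rearranged monotonically. -/
noncomputable def classCut (d : IntervalInstance) (b : ℕ → ℕ) (P : ℕ → Prop) (c : ℕ) : ℕ :=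
  cut d.n (d.classWeight c) (weightOn d.n (d.classWeight c) b P)

/-- Well-formedness of an instance. The intervals are sorted by both ends, and all jobs have a
positive time and one of the `C + 1` classes. -/
structure IsWellFormed (d : IntervalInstance) : Prop where
  time_nonneg : ∀ j, 0 ≤ d.p j
  time_pos : ∀ j < d.n, 0 < d.p j
  cls_le : ∀ j < d.n, d.cls j ≤ d.C
  left_le : ∀ i < d.m, d.L i ≤ d.n
  right_le : ∀ i < d.m, d.R i ≤ d.n
  sorted : ∀ i < d.m, ∀ i' < d.m, d.L i < d.R i → d.L i' < d.R i' → d.key i ≤ d.key i' →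
    d.L i ≤ d.L i' ∧ d.R i ≤ d.R i'

/-- The jobs of class `0` have times at most `σ`, and within every other class `c` the times agree
with `lo c` up to a factor `ρ`. -/
structure IsRounding (d : IntervalInstance) (lo : ℕ → ℚ) (ρ σ : ℚ) : Prop where
  one_le : 1 ≤ ρ
  nonneg : 0 ≤ σ
  lo_nonneg : ∀ c, 0 ≤ lo c
  time_le : ∀ j < d.n, d.cls j = 0 → d.p j ≤ σ
  lo_le_time : ∀ j < d.n, d.cls j ≠ 0 → lo (d.cls j) ≤ d.p j
  time_le_mul_lo : ∀ j < d.n, d.cls j ≠ 0 → d.p j ≤ ρ * lo (d.cls j)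

theorem classWeight_nonneg (hp : ∀ j, 0 ≤ d.p j) (c j : ℕ) : 0 ≤ d.classWeight c j := by
  unfold classWeight
  split_ifs
  exacts [hp j, zero_le_one, le_rfl]

theorem classWeight_pos (hd : d.IsWellFormed) (hj : j < d.n) : 0 < d.classWeight (d.cls j) j := by
  rw [classWeight, if_pos rfl]
  split_ifs
  exacts [hd.time_pos j hj, zero_lt_one]

theorem classWeight_zero : d.classWeight 0 = d.classTime 0 := by
  ext j
  simp [classWeight, classTime]

theorem classWeight_mem_range (hc : c ≠ 0) (j : ℕ) :
    d.classWeight c j ∈ (Int.castAddHom ℚ).range := by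
  rw [classWeight, if_neg hc]
  split_ifs
  exacts [⟨1, Int.cast_one⟩, ⟨0, Int.cast_zero⟩]

theorem lo_mul_classWeight_le (h : d.IsRounding lo ρ σ) (hc : c ≠ 0) (hj : j < d.n) :
    lo c * d.classWeight c j ≤ d.classTime c j := by
  unfold classWeight classTime
  split_ifs with hjc
  · subst hjc
    simpa using h.lo_le_time j hj hc
  · simp

theorem classTime_le_mul_lo (h : d.IsRounding lo ρ σ) (hc : c ≠ 0) (hj : j < d.n) :
    d.classTime c j ≤ ρ * lo c * d.classWeight c j := by
  unfold classWeight classTime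
  split_ifs with hjc
  · subst hjc
    simpa using h.time_le_mul_lo j hj hc
  · simp

theorem classTime_zero_le (h : d.IsRounding lo ρ σ) (hj : j < d.n) : d.classTime 0 j ≤ σ := by
  unfold classTime
  split_ifs with hj0
  exacts [h.time_le j hj hj0, h.nonneg]

theorem classCut_le (c : ℕ) : d.classCut b P c ≤ d.n := cut_le

section Rearrangement

variable (hp : ∀ j, 0 ≤ d.p j) (h : d.IsRounding lo ρ σ) (hP' : ∀ y, P' y ↔ P y ∨ y = i)
include hp hP'

theorem weightOn_classWeight_le (c : ℕ) :
    weightOn d.n (d.classWeight c) b P ≤ weightOn d.n (d.classWeight c) b P' :=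
  weightOn_mono (classWeight_nonneg hp c) fun y hy => (hP' y).2 (Or.inl hy)

theorem classCut_mono (c : ℕ) : d.classCut b P c ≤ d.classCut b P' c :=
  cut_mono (weightOn_classWeight_le hp hP' c)

variable (hi : ¬ P i)
include h hi

theorem classTime_zero_between_cuts :
    ∑ j ∈ Finset.Ico (d.classCut b P 0) (d.classCut b P' 0), d.classTime 0 j ≤
      ∑ j ∈ Finset.range d.n with b j = i, d.classTime 0 j + σ := by
  have hle := weightOn_classWeight_le (b := b) hp hP' 0
  unfold classCut
  rw [classWeight_zero] at hle ⊢
  simpa [weightOn_insert hP' hi] using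
    sum_Ico_cut_le_of_le h.nonneg hle fun j hj => classTime_zero_le h hj

theorem classTime_between_cuts (hc : c ≠ 0) :
    ∑ j ∈ Finset.Ico (d.classCut b P c) (d.classCut b P' c), d.classTime c j ≤
      ρ * ∑ j ∈ Finset.range d.n with b j = i, d.classTime c j := by
  have hcount : ∑ j ∈ Finset.Ico (d.classCut b P c) (d.classCut b P' c), d.classWeight c j ≤
      ∑ j ∈ Finset.range d.n with b j = i, d.classWeight c j := by
    have hone (j : ℕ) : d.classWeight c j ≤ 1 := by
      rw [classWeight, if_neg hc]
      split_ifs <;> norm_num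
    simpa [classCut, weightOn_insert hP' hi] using
      sum_Ico_cut_le_of_int (n := d.n) (weightOn_classWeight_le (b := b) hp hP' c)
        (classWeight_mem_range hc) hone (sum_mem fun j _ => classWeight_mem_range hc j)
  have hρ : 0 ≤ ρ := zero_le_one.trans h.one_le
  calc ∑ j ∈ Finset.Ico (d.classCut b P c) (d.classCut b P' c), d.classTime c j
      ≤ ∑ j ∈ Finset.Ico (d.classCut b P c) (d.classCut b P' c), ρ * lo c * d.classWeight c j :=
        Finset.sum_le_sum fun j hj =>
          classTime_le_mul_lo h hc ((Finset.mem_Ico.1 hj).2.trans_le (classCut_le c))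
    _ ≤ ρ * lo c * ∑ j ∈ Finset.range d.n with b j = i, d.classWeight c j := by
        rw [← Finset.mul_sum]
        exact mul_le_mul_of_nonneg_left hcount (mul_nonneg hρ (h.lo_nonneg c))
    _ ≤ ρ * ∑ j ∈ Finset.range d.n with b j = i, d.classTime c j := by
        rw [mul_assoc, Finset.mul_sum]
        refine mul_le_mul_of_nonneg_left (Finset.sum_le_sum fun j hj => ?_) hρ
        exact lo_mul_classWeight_le h hc (Finset.mem_range.1 (Finset.mem_filter.1 hj).1)

theorem load_between_cuts (hcls : ∀ j < d.n, d.cls j ≤ d.C)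
    (hT : ∑ j ∈ Finset.range d.n with b j = i, d.p j ≤ T) :
    ∑ c ∈ Finset.range (d.C + 1), ∑ j ∈ Finset.Ico (d.classCut b P c) (d.classCut b P' c),
      d.classTime c j ≤ ρ * T + σ := by
  have hclass (c : ℕ) : ∑ j ∈ Finset.Ico (d.classCut b P c) (d.classCut b P' c),
      d.classTime c j ≤ ρ * ∑ j ∈ Finset.range d.n with b j = i, d.classTime c j +
        if c = 0 then σ else 0 := by
    split_ifs with hc
    · subst hc
      refine (classTime_zero_between_cuts hp h hP' hi).trans (add_le_add_left ?_ σ)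
      exact le_mul_of_one_le_left (Finset.sum_nonneg fun j _ => classTime_nonneg hp 0 j) h.one_le
    · simpa using classTime_between_cuts hp h hP' hi hc
  have htotal : ∑ c ∈ Finset.range (d.C + 1), ∑ j ∈ Finset.range d.n with b j = i,
      d.classTime c j = ∑ j ∈ Finset.range d.n with b j = i, d.p j := by
    rw [Finset.sum_comm]
    refine Finset.sum_congr rfl fun j hj => ?_
    have := hcls j (Finset.mem_range.1 (Finset.mem_filter.1 hj).1)
    simp [classTime, Nat.lt_succ_of_le this]
  calc _ ≤ ∑ c ∈ Finset.range (d.C + 1), (ρ * ∑ j ∈ Finset.range d.n with b j = i,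
        d.classTime c j + if c = 0 then σ else 0) := Finset.sum_le_sum fun c _ => hclass c
    _ = ρ * ∑ j ∈ Finset.range d.n with b j = i, d.p j + σ := by
        rw [Finset.sum_add_distrib, ← Finset.mul_sum, htotal]
        simp
    _ ≤ ρ * T + σ := by
        have := zero_le_one.trans h.one_le
        gcongr

end Rearrangement

theorem before_succ_iff (hi : i < d.m) (hkey : d.key i = s) (y : ℕ) :
    d.Before s (i + 1) y ↔ d.Before s i y ∨ y = i := by
  unfold Before
  rcases eq_or_ne y i with rfl | hy <;> omega

theorem before_succ_of_ne (hkey : d.key i ≠ s) : d.Before s (i + 1) = d.Before s i := by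
  ext y
  unfold Before
  rcases eq_or_ne y i with rfl | hy <;> omega

theorem before_succ_zero (s : ℕ) : d.Before (s + 1) 0 = d.Before s d.m := by
  ext y
  unfold Before
  omega

theorem mem_Ico_of_between_cuts (hd : d.IsWellFormed) (hb : ∀ j < d.n, d.CanRun (b j) j)
    (hi : i < d.m) (hj : d.classCut b (d.Before (d.key i) i) (d.cls j) ≤ j)
    (hj' : j < d.classCut b (d.Before (d.key i) (i + 1)) (d.cls j)) : d.L i ≤ j ∧ j < d.R i := by
  have hnonneg := classWeight_nonneg hd.time_nonneg (d.cls j)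
  have hjn : j < d.n := hj'.trans_le cut_le
  have hnonempty (j : ℕ) (hj : j < d.n) : d.L (b j) < d.R (b j) :=
    (hb j hj).2.1.trans_lt (hb j hj).2.2
  obtain ⟨j₀, hj₀, rfl⟩ : ∃ j₀ < d.n, b j₀ = i := by
    by_contra! hempty
    refine (hj.trans_lt hj').ne ?_
    rw [classCut, classCut, weightOn_insert (before_succ_iff hi rfl) (by unfold Before; omega),
      Finset.filter_false_of_mem fun j hj => hempty j (Finset.mem_range.1 hj),
      Finset.sum_empty, add_zero]
  constructor
  · refine le_of_cut_weightOn_le hnonneg (fun j' hn hP => ?_) hj hjn (classWeight_pos hd hjn)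
    have := hd.sorted _ hi _ (hb j' hn).1 (hnonempty j₀ hj₀) (hnonempty j' hn)
      (by have := (hb j' hn).1; unfold Before at hP; omega)
    exact this.1.trans (hb j' hn).2.1
  · refine lt_of_lt_cut_weightOn hnonneg (fun j' hn hP => ?_) hj'
    have := hd.sorted _ (hb j' hn).1 _ hi (hnonempty j' hn) (hnonempty j₀ hj₀)
      (by unfold Before at hP; omega)
    exact (hb j' hn).2.2.trans_le this.2

theorem IsRounding.bound_nonneg (hr : d.IsRounding lo ρ σ) (hT0 : 0 ≤ T) (hB : ρ * T + σ ≤ d.B) :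
    0 ≤ d.B :=
  (add_nonneg (mul_nonneg (zero_le_one.trans hr.one_le) hT0) hr.nonneg).trans hB

section Completeness

variable (hd : d.IsWellFormed) (hr : d.IsRounding lo ρ σ) (hb : ∀ j < d.n, d.CanRun (b j) j)
  (hT : ∀ i, ∑ j ∈ Finset.range d.n with b j = i, d.p j ≤ T) (hB : ρ * T + σ ≤ d.B)
include hd hr hb hT hB

theorem Reaches.sweepKey (h : d.Reaches (d.classCut b (d.Before s 0)) d.B t) :
    d.Reaches (d.classCut b (d.Before (s + 1) 0)) d.B (d.sweepKey s t) := by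
  rw [before_succ_zero]
  refine fold_induction (f := fun i t => if d.key i = s then d.process i (d.L i) (d.R i) t else t)
    (fun i t => d.Reaches (d.classCut b (d.Before s i)) d.B t) h fun i hi t ht => ?_
  split_ifs with hkey
  · have hbefore := before_succ_iff hi hkey
    subst hkey
    refine ht.process hd.time_nonneg (fun c _ => classCut_mono hd.time_nonneg hbefore c)
      (fun c _ => classCut_le c) ?_ ?_
    · rintro _ - j hj hj' rfl
      exact mem_Ico_of_between_cuts hd hb hi hj hj'
    · exact (load_between_cuts hd.time_nonneg hr hbefore (by unfold Before; omega) hd.cls_le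
        (hT i)).trans hB
  · rwa [before_succ_of_ne hkey]

theorem reaches_sweep (hT0 : 0 ≤ T) (a : ℕ → ℕ → ℕ) :
    d.Reaches (d.classCut b (d.Before (2 * d.n + 1) 0)) d.B (d.sweep (d.start a)) := by
  have hB0 := hr.bound_nonneg hT0 hB
  refine fold_induction (fun s => d.Reaches (d.classCut b (d.Before s 0)) d.B)
    ⟨0, d.numCodes_pos, fun c _ => ?_, by simpa [start]⟩
    fun s _ t ht => ht.sweepKey hd hr hb hT hB
  have : weightOn d.n (d.classWeight c) b (d.Before 0 0) = 0 := by
    simp [weightOn, Before]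
  rw [classCut, this, cut_zero, pos, digit_zero]

theorem solve_complete (hT0 : 0 ≤ T) (a : ℕ → ℕ → ℕ) :
    (d.solve a).load (d.numCodes - 1) ≤ d.B := by
  have hall (c j : ℕ) (hj : d.classCut b (d.Before (2 * d.n + 1) 0) c ≤ j) (hjn : j < d.n) :
      d.cls j ≠ c := by
    rintro rfl
    refine j.lt_irrefl (le_of_cut_weightOn_le (classWeight_nonneg hd.time_nonneg _)
      (fun j' hj' hP => absurd ?_ hP) hj hjn (classWeight_pos hd hjn))
    have hrun := (hb j' hj').1
    have hL := hd.left_le _ hrun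
    have hR := hd.right_le _ hrun
    unfold Before key
    omega
  have hB0 := hr.bound_nonneg hT0 hB
  obtain ⟨v, hv, hpos, hload⟩ := (reaches_sweep hd hr hb hT hB hT0 a).process (cur := d.m) (l := 1)
    (r := 0) hd.time_nonneg (y' := fun _ => d.n) (fun c _ => classCut_le c) (fun _ _ => le_rfl)
    (fun c _ j hj hjn hjc => absurd hjc (hall c j hj hjn)) (by
      refine (Finset.sum_eq_zero fun c _ => Finset.sum_eq_zero fun j hj => ?_).trans_le hB0
      rw [Finset.mem_Ico] at hj
      exact if_neg (hall c j hj.1 hj.2))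
  have hlast : v = d.numCodes - 1 :=
    eq_pow_sub_one_of_digit_eq d.n.succ_pos hv fun c hc => hpos c (Nat.le_of_lt_succ hc)
  rwa [← hlast]

end Completeness

end IntervalInstance

end ConvexMakespan

namespace RAM

/-- Execute `c` if all the tests `bs` succeed and `d` otherwise. -/
def Cmd.condAll (bs : List BExp) (c d : Cmd) : Cmd := bs.foldr (fun b c => Cmd.cond b c d) c

theorem Runs.condAll {c d : Cmd} {s : State} {t t' : ℕ} {Q : State → Prop} {bs : List BExp}
    {p : Prop} (hp : (∀ b ∈ bs, b.Holds s) ↔ p) (h₁ : p → Runs c s t Q)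
    (h₂ : ¬ p → Runs d s t' Q) :
    Runs (Cmd.condAll bs c d) s ((bs.map BExp.cost).sum + max t t') Q := by
  induction bs generalizing p with
  | nil => exact (h₁ (hp.1 (by simp))).le (by simp)
  | cons b bs ih =>
    rw [List.forall_mem_cons] at hp
    refine Runs.le (Runs.cond (fun hb => ih (p := p) (by simpa [hb] using hp) h₁ h₂)
      fun hb => h₂ fun h => hb (hp.2 h).1) ?_
    simp only [List.map_cons, List.sum_cons]
    omega

end RAM

namespace ConvexMakespan

open RAM

/-! ### Memory layout

A loop with the counter variable `a` changes only the arrays `2, …, a`, and the data that the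
dynamic program does not change are stored in the arrays `0`, `1` and from `14` on. -/

local notation "sizeArr" => (0 : ℕ)
local notation "edgeArr" => (1 : ℕ)
local notation "outputArr" => (2 : ℕ)
local notation "rowArr" => (3 : ℕ)
local notation "jobCounter" => (4 : ℕ)
local notation "targetVar" => (5 : ℕ)
local notation "jobVar" => (6 : ℕ)
local notation "codeCounter" => (7 : ℕ)
local notation "machineVar" => (8 : ℕ)
local notation "leftVar" => (9 : ℕ)
local notation "rightVar" => (10 : ℕ)
local notation "machineCounter" => (11 : ℕ)
local notation "keyCounter" => (12 : ℕ)
local notation "doneVar" => (13 : ℕ)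
local notation "entryVar" => (15 : ℕ)
local notation "leftArr" => (20 : ℕ)
local notation "rightArr" => (21 : ℕ)
local notation "strideArr" => (22 : ℕ)
local notation "numCodesVar" => (23 : ℕ)
local notation "rowStartArr" => (24 : ℕ)
local notation "posArr" => (100 : ℕ)

local notation "timeArr" => (0 : ℕ)
local notation "loadArr" => (2 : ℕ)
local notation "guessVar" => (14 : ℕ)
local notation "maxVar" => (25 : ℕ)

/-- The largest size of the jobs of class `c`, relative to the guess of the optimum. -/
def classMax (k c : ℕ) : ℚ := (1 + 2 / k) ^ c / k

/-- The strict lower bound for the sizes of the jobs of class `c`, relative to the guess. -/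
def classMin (k c : ℕ) : ℚ := if c = 0 then 0 else classMax k (c - 1)

section Programs

variable (k C : ℕ)

/-- The number of machines. -/
def machinesE : NExp := NExp.var sizeArr

/-- The number of jobs. -/
def jobsE : NExp := NExp.get sizeArr (NExp.const 1)

/-- The load at the code `e`. -/
def loadE (e : NExp) : QExp := QExp.get loadArr e

/-- The guess of the optimum. -/
def guessE : QExp := QExp.get guessVar (NExp.const 0)

/-- The bound for the loads. -/
def boundE : QExp := QExp.scale (1 + 3 / k) guessE

/-- The processing time of the job of the current step. -/
def jobTimeE : QExp := QExp.get timeArr (NExp.var jobVar)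

/-- The address of the machine of the job `f` in the partial assignment at the code `e`. -/
def rowE (e f : NExp) : NExp := NExp.add (NExp.get rowStartArr e) f

/-- Copy the partial assignment at the current code to the target. -/
def copyRow : Cmd :=
  Cmd.forTo jobCounter jobsE (Cmd.setN rowArr (rowE (NExp.var targetVar) (NExp.var jobCounter))
    (NExp.get rowArr (rowE (NExp.var codeCounter) (NExp.var jobCounter))))

/-- If the load `e` improves the target, store it together with the current partial assignment and
continue with `c`. -/
def improveCmd (e : QExp) (c : Cmd) : Cmd :=
  Cmd.cond (BExp.leQ (loadE (NExp.var targetVar)) e) Cmd.skip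
    (Cmd.seq (Cmd.setQ loadArr (NExp.var targetVar) e) (Cmd.seq copyRow c))

/-- Leave the job of the current step to no machine. -/
def passJob : Cmd := improveCmd (loadE (NExp.var codeCounter)) Cmd.skip

/-- Assign the job of the current step to the current machine. -/
def takeJob : Cmd :=
  Cmd.condAll
    [BExp.leN (NExp.var leftVar) (NExp.var jobVar),
      BExp.leN (NExp.add (NExp.var jobVar) (NExp.const 1)) (NExp.var rightVar),
      BExp.leQ (QExp.add (loadE (NExp.var codeCounter)) jobTimeE) (boundE k)]
    (improveCmd (QExp.add (loadE (NExp.var codeCounter)) jobTimeE)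
      (Cmd.setN rowArr (rowE (NExp.var targetVar) (NExp.var jobVar)) (NExp.var machineVar)))
    Cmd.skip

/-- Assign the job of the current step if it has class `c`, and leave it otherwise. -/
def advanceCmd (c : ℕ) : Cmd :=
  Cmd.cond (BExp.leQ jobTimeE (QExp.scale (classMin k c) guessE)) passJob
    (Cmd.cond (BExp.leQ jobTimeE (QExp.scale (classMax k c) guessE)) (takeJob k) passJob)

/-- The program for `IntervalInstance.relax`. -/
def relaxCmd (c : ℕ) : Cmd :=
  Cmd.condAll
    [BExp.leQ (loadE (NExp.var codeCounter)) (boundE k),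
      BExp.leN (NExp.add (NExp.get (posArr + c) (NExp.var codeCounter)) (NExp.const 1)) jobsE]
    (Cmd.seq (Cmd.setN targetVar (NExp.const 0)
        (NExp.add (NExp.var codeCounter) (NExp.get strideArr (NExp.const c))))
      (Cmd.seq (Cmd.setN jobVar (NExp.const 0) (NExp.get (posArr + c) (NExp.var codeCounter)))
        (advanceCmd k c)))
    Cmd.skip

/-- The program for `IntervalInstance.phase`. -/
def phaseCmd (c : ℕ) : Cmd := Cmd.forTo codeCounter (NExp.var numCodesVar) (relaxCmd k c)

/-- The phases for the first `q` classes. -/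
def phasesCmd : ℕ → Cmd
  | 0 => Cmd.skip
  | q + 1 => Cmd.seq (phasesCmd q) (phaseCmd k q)

/-- The program for `IntervalInstance.reset`. -/
def resetCmd : Cmd :=
  Cmd.forTo codeCounter (NExp.var numCodesVar)
    (Cmd.cond (BExp.leQ (loadE (NExp.var codeCounter)) (boundE k))
      (Cmd.setQ loadArr (NExp.var codeCounter) (QExp.const 0)) Cmd.skip)

/-- The program for `IntervalInstance.process` with the machine `e` and the interval from `f` to
`g`. -/
def processCmd (e f g : NExp) : Cmd :=
  Cmd.seq (Cmd.setN machineVar (NExp.const 0) e)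
    (Cmd.seq (Cmd.setN leftVar (NExp.const 0) f)
      (Cmd.seq (Cmd.setN rightVar (NExp.const 0) g)
        (Cmd.seq (resetCmd k) (phasesCmd k (C + 1)))))

/-- The left end of the interval of the machine that is considered in the sweep. -/
def leftE : NExp := NExp.get leftArr (NExp.var machineCounter)

/-- The right end of the interval of the machine that is considered in the sweep. -/
def rightE : NExp := NExp.get rightArr (NExp.var machineCounter)

/-- The program for `IntervalInstance.sweepKey`. -/
def sweepKeyCmd : Cmd :=
  Cmd.forTo machineCounter machinesE
    (Cmd.condAll [BExp.leN (NExp.add leftE rightE) (NExp.var keyCounter),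
        BExp.leN (NExp.var keyCounter) (NExp.add leftE rightE)]
      (processCmd k C (NExp.var machineCounter) leftE rightE) Cmd.skip)

/-- The program for `IntervalInstance.sweep`. -/
def sweepCmd : Cmd :=
  Cmd.forTo keyCounter (NExp.add (NExp.add jobsE jobsE) (NExp.const 1)) (sweepKeyCmd k C)

/-- The program for `IntervalInstance.start`. -/
def startCmd : Cmd :=
  Cmd.seq (Cmd.forTo codeCounter (NExp.var numCodesVar)
    (Cmd.setQ loadArr (NExp.var codeCounter) (QExp.add (boundE k) (QExp.const 1))))
    (Cmd.setQ loadArr (NExp.const 0) (QExp.const 0))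

/-- The program for `IntervalInstance.solve`. -/
def solveCmd : Cmd :=
  Cmd.seq (startCmd k) (Cmd.seq (sweepCmd k C)
    (processCmd k C machinesE (NExp.const 1) (NExp.const 0)))

end Programs

/-- The arrays that a loop with the counter `a < b` leaves unchanged. -/
abbrev Outside (b a : ℕ) : Prop := a ≤ 1 ∨ b ≤ a

theorem agree_outside_mono {b b' : ℕ} {s s' : State} (h : Agree (Outside b) s s') (hb : b ≤ b') :
    Agree (Outside b') s s' :=
  h.mono fun _ ha => ha.imp_right hb.trans

/-- The memory `s` holds the data of the dynamic program `d` for the guess `T` of the optimum. -/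
structure Encodes (k : ℕ) (d : IntervalInstance) (T : ℚ) (s : State) : Prop where
  machines : s.idx sizeArr 0 = d.m
  jobs : s.idx sizeArr 1 = d.n
  time : s.val timeArr = d.p
  left : s.idx leftArr = d.L
  right : s.idx rightArr = d.R
  stride : ∀ c ≤ d.C, s.idx strideArr c = d.stride c
  numCodes : s.idx numCodesVar 0 = d.numCodes
  rowStart : ∀ v < d.numCodes, s.idx rowStartArr v = v * d.n
  pos : ∀ c ≤ d.C, ∀ v < d.numCodes, s.idx (posArr + c) v = d.pos c v
  guess : s.val guessVar 0 = T
  bound : d.B = (1 + 3 / k) * T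
  cls : ∀ j < d.n, ∀ c ≤ d.C, d.cls j = c ↔ classMin k c * T < d.p j ∧ d.p j ≤ classMax k c * T

/-- The memory `s` holds the table `t`. -/
def Holds (d : IntervalInstance) (s : State) (t : Table) : Prop :=
  ∀ v < d.numCodes, s.val loadArr v = t.load v ∧
    ∀ j < d.n, s.idx rowArr (v * d.n + j) = t.row v j

/-- The memory `s'` holds the table `t` and arises from `s` by changing only the arrays
`2, …, b - 1`. -/
def Yields (d : IntervalInstance) (b : ℕ) (s : State) (t : Table) (s' : State) : Prop :=
  Agree (Outside b) s s' ∧ Holds d s' t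

section Solve

variable {k : ℕ} {d : IntervalInstance} {T : ℚ} {s : State} {t : Table}

theorem Encodes.of_agree {s' : State} (h : Encodes k d T s) (ha : Agree (Outside 14) s s') :
    Encodes k d T s' where
  machines := by rw [ha.idx (by decide), h.machines]
  jobs := by rw [ha.idx (by decide), h.jobs]
  time := by rw [ha.val (by decide), h.time]
  left := by rw [ha.idx (by decide), h.left]
  right := by rw [ha.idx (by decide), h.right]
  stride := by rw [ha.idx (by decide)]; exact h.stride
  numCodes := by rw [ha.idx (by decide), h.numCodes]
  rowStart := by rw [ha.idx (by decide)]; exact h.rowStart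
  pos c hc := by rw [ha.idx (by omega)]; exact h.pos c hc
  guess := by rw [ha.val (by decide), h.guess]
  bound := h.bound
  cls := h.cls

theorem Encodes.eval_jobsE (h : Encodes k d T s) : jobsE.eval s = d.n := h.jobs

theorem Encodes.eval_machinesE (h : Encodes k d T s) : machinesE.eval s = d.m := h.machines

theorem Encodes.eval_boundE (h : Encodes k d T s) : (boundE k).eval s = d.B := by
  simp only [boundE, guessE, QExp.eval, NExp.eval, h.guess, h.bound]

theorem Encodes.eval_rowE {e f : NExp} {v j : ℕ} (h : Encodes k d T s) (hv : v < d.numCodes)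
    (he : e.eval s = v) (hf : f.eval s = j) : (rowE e f).eval s = v * d.n + j := by
  simp only [rowE, NExp.eval, he, hf, h.rowStart v hv]

theorem Holds.eval_loadE {e : NExp} {v : ℕ} (h : Holds d s t) (hv : v < d.numCodes)
    (he : e.eval s = v) : (loadE e).eval s = t.load v := by
  simp only [loadE, QExp.eval, he, (h v hv).1]

theorem Holds.setN (h : Holds d s t) {a i x : ℕ} (ha : a ≠ rowArr) : Holds d (s.setN a i x) t := by
  intro v hv
  simpa [ha.symm] using h v hv

theorem Holds.setLoad (h : Holds d s t) (v : ℕ) (x : ℚ) :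
    Holds d (s.setQ loadArr v x) ⟨Function.update t.load v x, t.row⟩ := by
  intro u hu
  simpa [Function.update_apply, (h u hu).1] using (h u hu).2

theorem eq_and_eq_of_mul_add_eq {n v w j j' : ℕ} (hj : j < n) (hj' : j' < n)
    (h : v * n + j = w * n + j') : v = w ∧ j = j' := by
  have hdiv : ∀ u i, i < n → (u * n + i) / n = u := fun u i hi => by
    rw [mul_comm, Nat.mul_add_div (by omega), Nat.div_eq_of_lt hi, add_zero]
  obtain rfl : v = w := by rw [← hdiv v j hj, h, hdiv w j' hj']
  exact ⟨rfl, by omega⟩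

theorem Holds.setRow (h : Holds d s t) {v j : ℕ} (hj : j < d.n) (x : ℕ) :
    Holds d (s.setN rowArr (v * d.n + j) x)
      ⟨t.load, Function.update t.row v (Function.update (t.row v) j x)⟩ := by
  refine fun u hu => ⟨(h u hu).1, fun i hi => ?_⟩
  rw [State.setN_idx]
  split_ifs with he
  · obtain ⟨rfl, rfl⟩ := eq_and_eq_of_mul_add_eq hi hj he.2
    simp
  · rw [(h u hu).2 i hi]
    by_cases huv : u = v
    · subst huv
      have hij : i ≠ j := fun e => he ⟨rfl, by rw [e]⟩
      simp [hij]
    · simp [huv]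

theorem Yields.trans {b b' : ℕ} {s₁ s₂ : State} (h : Yields d b s₁ t s₂)
    (ha : Agree (Outside b') s s₁) (hb : b ≤ b') : Yields d b' s t s₂ :=
  ⟨ha.trans (agree_outside_mono h.1 hb), h.2⟩

theorem runs_copyRow {v w : ℕ} (h : Encodes k d T s) (ht : Holds d s t)
    (hv : s.idx codeCounter 0 = v) (hw : s.idx targetVar 0 = w) (hvV : v < d.numCodes)
    (hwV : w < d.numCodes) (hne : v ≠ w) :
    Runs copyRow s (40 * (d.n + 1))
      (Yields d 5 s ⟨t.load, Function.update t.row w (t.row v)⟩) := by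
  let copied : ℕ → ℕ → ℕ := fun i j => if j < i then t.row v j else t.row w j
  refine Runs.mono (Runs.forTo (N := d.n) (t := 20) (Outside 5)
    (fun i s' => Holds d s' ⟨t.load, Function.update t.row w (copied i)⟩)
    (by simp) (fun i s' x hJ => hJ.setN (by simp)) ?_ ?_ ?_) ?_ ?_
  · exact fun s' ha => (h.of_agree (agree_outside_mono ha (by decide))).eval_jobsE
  · simpa [copied] using ht
  · intro i s' hi ha hi' hJ
    have h' := h.of_agree (agree_outside_mono ha (by decide))
    have hw' : s'.idx targetVar 0 = w := by rw [ha.idx (by decide), hw]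
    have hv' : s'.idx codeCounter 0 = v := by rw [ha.idx (by decide), hv]
    refine Runs.le (Runs.setN ?_) (by simp [NExp.cost, rowE])
    rw [h'.eval_rowE (e := NExp.var targetVar) (f := NExp.var jobCounter) hwV hw' hi']
    refine ⟨(Agree.refl _ _).setN (by decide), by simpa using hi', ?_⟩
    have hval : (NExp.get rowArr (rowE (NExp.var codeCounter) (NExp.var jobCounter))).eval s' =
        t.row v i := by
      rw [NExp.eval, h'.eval_rowE (e := NExp.var codeCounter) (f := NExp.var jobCounter) hvV hv'
        hi', (hJ v hvV).2 i hi]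
      simp only [Function.update_of_ne hne]
    have hcopied : copied (i + 1) = Function.update (copied i) i (t.row v i) := by
      funext j
      rcases lt_trichotomy j i with hj | rfl | hj
      · simp [copied, hj, hj.ne, hj.trans i.lt_succ_self]
      · simp [copied]
      · simp [copied, hj.ne', hj.not_gt, show ¬ j < i + 1 by omega]
    rw [hval, hcopied]
    simpa using hJ.setRow (v := w) hi (t.row v i)
  · simp [jobsE, NExp.cost]; omega
  · rintro s' ⟨ha, ht'⟩
    refine ⟨ha, fun u hu => ⟨(ht' u hu).1, fun j hj => ?_⟩⟩
    rw [(ht' u hu).2 j hj]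
    by_cases huw : u = w
    · subst huw
      simp [copied, hj]
    · simp [huw]

theorem runs_improveCmd {e : QExp} {c : Cmd} {v w : ℕ} {x : ℚ} {a : ℕ → ℕ}
    (h : Encodes k d T s) (ht : Holds d s t) (hv : s.idx codeCounter 0 = v)
    (hw : s.idx targetVar 0 = w) (hvV : v < d.numCodes) (hwV : w < d.numCodes) (hne : v ≠ w)
    (he : e.eval s = x) (hcost : e.cost ≤ 10)
    (hc : ∀ s', Yields d 5 s ⟨Function.update t.load w x, Function.update t.row w (t.row v)⟩ s' →
      Runs c s' 10 (Yields d 5 s' ⟨Function.update t.load w x, Function.update t.row w a⟩)) :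
    Runs (improveCmd e c) s (100 * (d.n + 1)) (Yields d 5 s (t.improve w x a)) := by
  unfold Table.improve
  refine Runs.le (Runs.cond (t := 1) (t' := 40 * (d.n + 1) + 30) (fun hb => ?_) fun hb => ?_) ?_
  · simp only [BExp.Holds, he, ht.eval_loadE (e := NExp.var targetVar) hwV hw] at hb
    rw [if_neg hb.not_gt]
    exact Runs.skip ⟨Agree.refl _ _, ht⟩
  · simp only [BExp.Holds, he, ht.eval_loadE (e := NExp.var targetVar) hwV hw] at hb
    rw [if_pos (not_le.1 hb)]
    refine Runs.le (Runs.seq (t' := 40 * (d.n + 1) + 10) (Runs.setQ ?_))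
      (by simp only [NExp.cost]; omega)
    rw [he, show (NExp.var targetVar).eval s = w from hw]
    have ha : Agree (Outside 5) s (s.setQ loadArr w x) := (Agree.refl _ _).setQ (by decide)
    refine Runs.seq ((runs_copyRow (h.of_agree (agree_outside_mono ha (by decide)))
      (ht.setLoad w x) hv hw hvV hwV hne).mono le_rfl fun s' hs' => ?_)
    exact (hc s' (hs'.trans ha le_rfl)).mono le_rfl fun s'' hs'' =>
      hs''.trans (ha.trans hs'.1) le_rfl
  · simp only [BExp.cost, NExp.cost, loadE, QExp.cost]; omega

theorem runs_passJob {v w : ℕ} (h : Encodes k d T s) (ht : Holds d s t)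
    (hv : s.idx codeCounter 0 = v) (hw : s.idx targetVar 0 = w) (hvV : v < d.numCodes)
    (hwV : w < d.numCodes) (hne : v ≠ w) :
    Runs passJob s (100 * (d.n + 1)) (Yields d 5 s (t.improve w (t.load v) (t.row v))) :=
  runs_improveCmd h ht hv hw hvV hwV hne (ht.eval_loadE (e := NExp.var codeCounter) hvV hv)
    (by simp [loadE, QExp.cost, NExp.cost])
    fun s' hs' => (Runs.skip ⟨Agree.refl _ _, hs'.2⟩).le (by simp)

theorem runs_takeJob {v w j : ℕ} (h : Encodes k d T s) (ht : Holds d s t)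
    (hv : s.idx codeCounter 0 = v) (hw : s.idx targetVar 0 = w) (hj : s.idx jobVar 0 = j)
    (hvV : v < d.numCodes) (hwV : w < d.numCodes) (hne : v ≠ w) (hjn : j < d.n) :
    Runs (takeJob k) s (200 * (d.n + 1)) (Yields d 5 s
      (if s.idx leftVar 0 ≤ j ∧ j < s.idx rightVar 0 ∧ t.load v + d.p j ≤ d.B then
        t.improve w (t.load v + d.p j) (Function.update (t.row v) j (s.idx machineVar 0))
      else t)) := by
  have hload : (QExp.add (loadE (NExp.var codeCounter)) jobTimeE).eval s = t.load v + d.p j := by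
    rw [QExp.eval, ht.eval_loadE (e := NExp.var codeCounter) hvV hv]
    simp only [jobTimeE, QExp.eval, NExp.eval, hj, h.time]
  refine Runs.le (Runs.condAll (t := 100 * (d.n + 1)) (t' := 1)
    (p := s.idx leftVar 0 ≤ j ∧ j < s.idx rightVar 0 ∧ t.load v + d.p j ≤ d.B) ?_
    (fun hb => ?_) fun hb => ?_) ?_
  · simp only [List.forall_mem_cons, List.not_mem_nil, false_imp_iff, implies_true, and_true,
      BExp.Holds, hload, h.eval_boundE, NExp.eval, hj, Nat.add_one_le_iff]
  · rw [if_pos hb]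
    refine runs_improveCmd h ht hv hw hvV hwV hne hload
      (by simp [loadE, jobTimeE, QExp.cost, NExp.cost]) fun s' hs' => ?_
    have h' := h.of_agree (agree_outside_mono hs'.1 (by decide))
    have hw' : s'.idx targetVar 0 = w := by rw [hs'.1.idx (by decide), hw]
    have hj' : s'.idx jobVar 0 = j := by rw [hs'.1.idx (by decide), hj]
    refine Runs.le (Runs.setN ?_) (by simp [NExp.cost, rowE])
    rw [h'.eval_rowE (e := NExp.var targetVar) (f := NExp.var jobVar) hwV hw' hj']
    refine ⟨(Agree.refl _ _).setN (by decide), ?_⟩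
    simpa [NExp.eval, hs'.1.idx (a := machineVar) (by decide)] using
      hs'.2.setRow (v := w) hjn (s.idx machineVar 0)
  · rw [if_neg hb]
    exact Runs.skip ⟨Agree.refl _ _, ht⟩
  · simp only [List.map_cons, List.map_nil, List.sum_cons, List.sum_nil, BExp.cost, NExp.cost,
      QExp.cost, boundE, guessE, jobTimeE, loadE]
    omega

theorem runs_advanceCmd {c v w j : ℕ} (h : Encodes k d T s) (ht : Holds d s t)
    (hv : s.idx codeCounter 0 = v) (hw : s.idx targetVar 0 = w) (hj : s.idx jobVar 0 = j)
    (hvV : v < d.numCodes) (hwV : w < d.numCodes) (hne : v ≠ w) (hjn : j < d.n) (hc : c ≤ d.C) :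
    Runs (advanceCmd k c) s (240 * (d.n + 1)) (Yields d 5 s
      (if d.cls j = c then
        if s.idx leftVar 0 ≤ j ∧ j < s.idx rightVar 0 ∧ t.load v + d.p j ≤ d.B then
          t.improve w (t.load v + d.p j) (Function.update (t.row v) j (s.idx machineVar 0))
        else t
      else t.improve w (t.load v) (t.row v))) := by
  have hcls := h.cls j hjn c hc
  have hpass := runs_passJob h ht hv hw hvV hwV hne
  have htest : ∀ q : ℚ, (BExp.leQ jobTimeE (QExp.scale q guessE)).Holds s ↔ d.p j ≤ q * T :=
    fun q => by simp only [BExp.Holds, jobTimeE, guessE, QExp.eval, NExp.eval, hj, h.time, h.guess]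
  refine Runs.le (Runs.cond (t := 100 * (d.n + 1)) (fun h₁ => ?_) fun h₁ =>
    Runs.cond (t := 200 * (d.n + 1)) (t' := 100 * (d.n + 1)) (fun h₂ => ?_) fun h₂ => ?_) ?_
  · rw [if_neg fun e => ((hcls.1 e).1.trans_le ((htest _).1 h₁)).false]
    exact hpass
  · rw [if_pos (hcls.2 ⟨not_le.1 fun h => h₁ ((htest _).2 h), (htest _).1 h₂⟩)]
    exact runs_takeJob h ht hv hw hj hvV hwV hne hjn
  · rw [if_neg fun e => h₂ ((htest _).2 (hcls.1 e).2)]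
    exact hpass
  · simp only [BExp.cost, NExp.cost, guessE, jobTimeE, QExp.cost]; omega

theorem runs_relaxCmd {c v : ℕ} (h : Encodes k d T s) (ht : Holds d s t)
    (hv : s.idx codeCounter 0 = v) (hvV : v < d.numCodes) (hc : c ≤ d.C) :
    Runs (relaxCmd k c) s (300 * (d.n + 1)) (Yields d 7 s
      (d.relax (s.idx machineVar 0) (s.idx leftVar 0) (s.idx rightVar 0) c v t)) := by
  have hload := ht.eval_loadE (e := NExp.var codeCounter) hvV hv
  unfold IntervalInstance.relax
  refine Runs.le (Runs.condAll (t := 240 * (d.n + 1) + 20) (t' := 1)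
    (p := t.load v ≤ d.B ∧ d.pos c v < d.n) ?_ (fun hb => ?_) fun hb => ?_) ?_
  · simp only [List.forall_mem_cons, List.not_mem_nil, false_imp_iff, implies_true, and_true,
      BExp.Holds, hload, h.eval_boundE, NExp.eval, h.eval_jobsE, hv, h.pos c hc v hvV,
      Nat.add_one_le_iff]
  · rw [if_pos hb]
    refine Runs.le (Runs.seq (t' := 240 * (d.n + 1) + 10) (Runs.setN ?_))
      (by simp only [NExp.cost]; omega)
    refine Runs.le (Runs.seq (t' := 240 * (d.n + 1)) (Runs.setN ?_))
      (by simp only [NExp.cost]; omega)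
    simp only [NExp.eval, State.setN_idx, hv, h.stride c hc, h.pos c hc v hvV,
      show ¬ (codeCounter = targetVar) by decide, show ¬ (posArr + c = targetVar) by omega,
      false_and, if_false]
    set s₁ := (s.setN targetVar 0 (v + d.stride c)).setN jobVar 0 (d.pos c v) with hs₁
    have ha : Agree (Outside 7) s s₁ := ((Agree.refl _ _).setN (by decide)).setN (by decide)
    have hstride : 0 < d.stride c := by positivity
    have := runs_advanceCmd (v := v) (w := v + d.stride c) (j := d.pos c v)
      (h.of_agree (agree_outside_mono ha (by decide)))
      ((ht.setN (by decide)).setN (by decide)) (by simpa [hs₁] using hv) (by simp [hs₁])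
      (by simp [hs₁]) hvV (d.add_stride_lt hb.2 hc hvV) (by omega) hb.2 hc
    rw [ha.idx (a := leftVar) (by decide), ha.idx (a := rightVar) (by decide),
      ha.idx (a := machineVar) (by decide)] at this
    exact this.mono le_rfl fun s' hs' => hs'.trans ha (by decide)
  · rw [if_neg hb]
    exact Runs.skip ⟨Agree.refl _ _, ht⟩
  · simp only [List.map_cons, List.map_nil, List.sum_cons, List.sum_nil, BExp.cost, NExp.cost,
      QExp.cost, boundE, guessE, jobsE, loadE]
    omega

theorem runs_forTo_fold {a N τ : ℕ} {e : NExp} {c : Cmd} (f : ℕ → Table → Table) (ha : 3 < a)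
    (he : ∀ s', Agree (Outside (a + 1)) s s' → e.eval s' = N) (ht : Holds d s t)
    (hc : ∀ i s' t', i < N → Agree (Outside (a + 1)) s s' → s'.idx a 0 = i → Holds d s' t' →
      Runs c s' τ (Yields d a s' (f i t'))) :
    Runs (Cmd.forTo a e c) s ((N + 1) * (τ + e.cost + 11))
      (Yields d (a + 1) s (Nat.fold N (fun i _ => f i) t)) := by
  refine Runs.forTo (Outside (a + 1)) (fun i s' => Holds d s' (Nat.fold i (fun i _ => f i) t))
    (by omega) (fun i s' x hJ => hJ.setN (by omega)) he ht fun i s' hi hs' hi' hJ => ?_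
  refine (hc i s' _ hi hs' hi' hJ).mono le_rfl fun s'' hs'' => ?_
  refine ⟨agree_outside_mono hs''.1 a.le_succ, by rw [hs''.1.idx (Or.inr le_rfl), hi'], ?_⟩
  simpa only [Nat.fold_succ] using hs''.2

/-- The number of cells of the table of assignments, up to a constant factor. -/
def IntervalInstance.cells (d : IntervalInstance) : ℕ := d.numCodes * (d.n + 1)

theorem IntervalInstance.cells_pos (d : IntervalInstance) : 0 < d.cells :=
  Nat.mul_pos d.numCodes_pos d.n.succ_pos

theorem IntervalInstance.loop_le_cells (d : IntervalInstance) {x y : ℕ} (h : x ≤ y * (d.n + 1)) :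
    (d.numCodes + 1) * x ≤ 2 * y * d.cells := by
  have hV : d.numCodes + 1 ≤ 2 * d.numCodes := by have := d.numCodes_pos; omega
  calc (d.numCodes + 1) * x ≤ (2 * d.numCodes) * (y * (d.n + 1)) := Nat.mul_le_mul hV h
    _ = 2 * y * d.cells := by unfold IntervalInstance.cells; ring

theorem Encodes.eval_numCodesVar {b : ℕ} (h : Encodes k d T s) (hb : b ≤ 14) (s' : State)
    (ha : Agree (Outside b) s s') : (NExp.var numCodesVar).eval s' = d.numCodes :=
  (h.of_agree (agree_outside_mono ha hb)).numCodes

theorem runs_phaseCmd {c : ℕ} (h : Encodes k d T s) (ht : Holds d s t) (hc : c ≤ d.C) :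
    Runs (phaseCmd k c) s (700 * d.cells) (Yields d 8 s
      (d.phase (s.idx machineVar 0) (s.idx leftVar 0) (s.idx rightVar 0) c t)) := by
  refine Runs.le (runs_forTo_fold (τ := 300 * (d.n + 1)) _ (by decide)
    (h.eval_numCodesVar (by decide)) ht fun i s' t' hi ha hi' ht' => ?_) ?_
  · have := runs_relaxCmd (h.of_agree (agree_outside_mono ha (by decide))) ht' hi' hi hc
    rwa [ha.idx (a := machineVar) (by decide), ha.idx (a := leftVar) (by decide),
      ha.idx (a := rightVar) (by decide)] at this
  · exact (d.loop_le_cells (y := 350) (by simp only [NExp.cost]; omega)).trans (by omega)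

theorem runs_phasesCmd (h : Encodes k d T s) (ht : Holds d s t) (q : ℕ) (hq : q ≤ d.C + 1) :
    Runs (phasesCmd k q) s (q * (700 * d.cells) + 1) (Yields d 8 s (Nat.fold q (fun c _ =>
      d.phase (s.idx machineVar 0) (s.idx leftVar 0) (s.idx rightVar 0) c) t)) := by
  induction q with
  | zero => exact Runs.le (Runs.skip ⟨Agree.refl _ _, ht⟩) (by omega)
  | succ q ih =>
    refine Runs.le (Runs.seq (t' := 700 * d.cells) ((ih (by omega)).mono le_rfl ?_))
      (le_of_eq (by ring))
    rintro s' ⟨ha, ht'⟩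
    have := runs_phaseCmd (h.of_agree (agree_outside_mono ha (by decide))) ht' (c := q) (by omega)
    rw [ha.idx (a := machineVar) (by decide), ha.idx (a := leftVar) (by decide),
      ha.idx (a := rightVar) (by decide)] at this
    exact this.mono le_rfl fun s'' hs'' => hs''.trans ha le_rfl

theorem runs_resetCmd (h : Encodes k d T s) (ht : Holds d s t) :
    Runs (resetCmd k) s (200 * d.cells) (Yields d 8 s (d.reset t)) := by
  refine Runs.le (runs_forTo_fold (τ := 40) _ (by decide) (h.eval_numCodesVar (by decide)) ht
    fun v s' t' hv ha hv' ht' => ?_) ?_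
  · have hB := (h.of_agree (agree_outside_mono ha (by decide))).eval_boundE
    have hload := ht'.eval_loadE (e := NExp.var codeCounter) hv hv'
    unfold IntervalInstance.resetAt
    refine Runs.le (Runs.cond (t' := 1) (fun hb => Runs.setQ ?_) fun hb => ?_) ?_
    · rw [BExp.Holds, hB, hload] at hb
      rw [if_pos hb, show (NExp.var codeCounter).eval s' = v from hv']
      exact ⟨(Agree.refl _ _).setQ (by decide), ht'.setLoad v 0⟩
    · rw [BExp.Holds, hB, hload] at hb
      rw [if_neg hb]
      exact Runs.skip ⟨Agree.refl _ _, ht'⟩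
    · simp only [BExp.cost, NExp.cost, boundE, guessE, loadE, QExp.cost]; omega
  · exact (d.loop_le_cells (y := 100) (by simp only [NExp.cost]; omega)).trans (by omega)

theorem runs_processCmd {e f g : NExp} {cur l r : ℕ} (h : Encodes k d T s) (ht : Holds d s t)
    (he : e.eval s = cur) (hf : f.eval (s.setN machineVar 0 cur) = l)
    (hg : g.eval ((s.setN machineVar 0 cur).setN leftVar 0 l) = r)
    (hcost : e.cost + f.cost + g.cost ≤ 30) :
    Runs (processCmd k d.C e f g) s ((d.C + 2) * (1000 * d.cells))
      (Yields d 11 s (d.process cur l r t)) := by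
  refine Runs.le (Runs.seq (Runs.setN (Runs.seq (Runs.setN (Runs.seq (Runs.setN
    (Runs.seq (t := 200 * d.cells) (t' := (d.C + 1) * (700 * d.cells) + 1) ?_))))))) ?_
  · rw [he]
    simp only [NExp.eval]
    rw [hf, hg]
    set s₁ := ((s.setN machineVar 0 cur).setN leftVar 0 l).setN rightVar 0 r with hs₁
    have ha : Agree (Outside 11) s s₁ :=
      (((Agree.refl _ _).setN (by decide)).setN (by decide)).setN (by decide)
    have h₁ : Encodes k d T s₁ := h.of_agree (agree_outside_mono ha (by decide))
    refine (runs_resetCmd h₁ (((ht.setN (by decide)).setN (by decide)).setN (by decide))).mono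
      le_rfl ?_
    rintro s₂ ⟨ha₂, ht₂⟩
    have := runs_phasesCmd (h₁.of_agree (agree_outside_mono ha₂ (by decide))) ht₂ (d.C + 1) le_rfl
    rw [ha₂.idx (a := machineVar) (by decide), ha₂.idx (a := leftVar) (by decide),
      ha₂.idx (a := rightVar) (by decide)] at this
    refine this.mono le_rfl fun s₃ hs₃ => ?_
    simpa only [IntervalInstance.process, hs₁, State.setN_idx, and_true, and_false, if_true,
      if_false, Nat.reduceEqDiff] using (hs₃.trans ha₂ le_rfl).trans ha (by decide)
  · have := d.cells_pos
    simp only [NExp.cost]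
    nlinarith

theorem runs_sweepKeyCmd {κ : ℕ} (h : Encodes k d T s) (ht : Holds d s t)
    (hκ : s.idx keyCounter 0 = κ) :
    Runs (sweepKeyCmd k d.C) s ((d.m + 1) * ((d.C + 2) * (1100 * d.cells)))
      (Yields d 12 s (d.sweepKey κ t)) := by
  refine Runs.le (runs_forTo_fold (τ := (d.C + 2) * (1000 * d.cells) + 50)
    (fun i t => if d.key i = κ then d.process i (d.L i) (d.R i) t else t) (by decide)
    (fun s' ha => (h.of_agree (agree_outside_mono ha (by decide))).eval_machinesE) ht
    fun i s' t' _ ha hi' ht' => ?_) ?_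
  · have h' := h.of_agree (agree_outside_mono ha (by decide))
    have hκ' : s'.idx keyCounter 0 = κ := by rw [ha.idx (by decide), hκ]
    refine Runs.le (Runs.condAll (t := (d.C + 2) * (1000 * d.cells)) (t' := 1)
      (p := d.key i = κ) ?_ (fun hb => ?_) fun hb => ?_) ?_
    · simp only [List.forall_mem_cons, List.not_mem_nil, false_imp_iff, implies_true, and_true,
        BExp.Holds, NExp.eval, leftE, rightE, hi', hκ', h'.left, h'.right]
      exact le_antisymm_iff.symm
    · rw [if_pos hb]
      exact runs_processCmd h' ht' hi' (by simp [leftE, NExp.eval, hi', h'.left])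
        (by simp [rightE, NExp.eval, hi', h'.right]) (by simp [NExp.cost, leftE, rightE])
    · rw [if_neg hb]
      exact Runs.skip ⟨Agree.refl _ _, ht'⟩
    · simp only [List.map_cons, List.map_nil, List.sum_cons, List.sum_nil, BExp.cost, NExp.cost,
        leftE, rightE]
      omega
  · refine Nat.mul_le_mul_left _ ?_
    have := d.cells_pos
    simp only [NExp.cost, machinesE]
    nlinarith

theorem runs_sweepCmd (h : Encodes k d T s) (ht : Holds d s t) :
    Runs (sweepCmd k d.C) s ((d.n + 1) * ((d.m + 1) * ((d.C + 2) * (2400 * d.cells))))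
      (Yields d 13 s (d.sweep t)) := by
  refine Runs.le (runs_forTo_fold _ (by decide) (fun s' ha => ?_) ht
    fun i s' t' _ ha hi' ht' =>
      runs_sweepKeyCmd (h.of_agree (agree_outside_mono ha (by decide))) ht' hi') ?_
  · simp only [NExp.eval, (h.of_agree (agree_outside_mono ha (by decide))).eval_jobsE]
    ring
  · have : 0 < (d.m + 1) * ((d.C + 2) * d.cells) := by have := d.cells_pos; positivity
    simp only [NExp.cost, jobsE, Nat.mul_left_comm _ 1100, Nat.mul_left_comm _ 2400]
    nlinarith

theorem runs_startCmd (h : Encodes k d T s) :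
    Runs (startCmd k) s (200 * d.cells)
      (Yields d 13 s (d.start fun v j => s.idx rowArr (v * d.n + j))) := by
  refine Runs.le (Runs.seq (t' := 10) (Runs.mono (Runs.forTo (N := d.numCodes) (t := 20)
    (Outside 8) (fun i s' => s'.idx rowArr = s.idx rowArr ∧ ∀ v < i, s'.val loadArr v = d.B + 1)
    (by decide) ?_ (h.eval_numCodesVar (by decide)) ⟨rfl, by simp⟩ ?_) le_rfl ?_)) ?_
  · rintro i s' x ⟨hrow, hload⟩
    exact ⟨by funext j; simp [hrow], hload⟩
  · rintro i s' - ha hi' ⟨hrow, hload⟩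
    have hB := (h.of_agree (agree_outside_mono ha (by decide))).eval_boundE
    refine Runs.le (Runs.setQ ?_) (by simp only [NExp.cost, QExp.cost, boundE, guessE]; omega)
    refine ⟨(Agree.refl _ _).setQ (by decide), by simpa using hi', hrow, fun v hv => ?_⟩
    simp only [NExp.eval, QExp.eval, hi', State.setQ_val, hB]
    by_cases hvi : v = i
    · simp [hvi]
    · simp [hvi, hload v (by omega)]
  · rintro s' ⟨ha, hrow, hload⟩
    refine Runs.le (Runs.setQ ?_) (by simp [NExp.cost, QExp.cost])
    refine ⟨(agree_outside_mono ha (by decide)).setQ (by decide), fun v hv => ⟨?_, fun j _ => ?_⟩⟩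
    · simp [NExp.eval, QExp.eval, IntervalInstance.start, hload v hv]
    · simp [IntervalInstance.start, hrow]
  · have := d.loop_le_cells (x := 20 + (NExp.var numCodesVar).cost + 11) (y := 50)
      (by simp only [NExp.cost]; omega)
    have := d.cells_pos
    omega

theorem runs_solveCmd (h : Encodes k d T s) :
    Runs (solveCmd k d.C) s ((d.n + 1) * ((d.m + 1) * ((d.C + 2) * (4000 * d.cells))))
      (Yields d 13 s (d.solve fun v j => s.idx rowArr (v * d.n + j))) := by
  refine Runs.le (Runs.seq (t' := (d.n + 1) * ((d.m + 1) * ((d.C + 2) * (2400 * d.cells))) +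
    (d.C + 2) * (1000 * d.cells)) ((runs_startCmd h).mono le_rfl fun s₁ hs₁ => Runs.seq
      ((runs_sweepCmd (h.of_agree (agree_outside_mono hs₁.1 (by decide))) hs₁.2).mono le_rfl
        fun s₂ hs₂ => ?_))) ?_
  · have ha₂ := (hs₂.trans hs₁.1 le_rfl).1
    have h₂ := h.of_agree (agree_outside_mono ha₂ (by decide))
    exact (runs_processCmd h₂ hs₂.2 h₂.eval_machinesE rfl rfl
      (by simp [NExp.cost, machinesE])).mono le_rfl fun s₃ hs₃ => hs₃.trans ha₂ (by decide)
  · have : d.cells ≤ (d.C + 2) * d.cells := Nat.le_mul_of_pos_left _ (by omega)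
    have : (d.C + 2) * d.cells ≤ (d.n + 1) * ((d.m + 1) * ((d.C + 2) * d.cells)) :=
      (Nat.le_mul_of_pos_left _ (by omega)).trans (Nat.le_mul_of_pos_left _ (by omega))
    simp only [Nat.mul_left_comm _ 1000, Nat.mul_left_comm _ 2400, Nat.mul_left_comm _ 4000]
    omega

end Solve

/-! ### Preprocessing -/

section Programs

variable (C : ℕ)

/-- The largest processing time of the jobs read so far. -/
def maxE : QExp := QExp.get maxVar (NExp.const 0)

/-- Compute the largest processing time. -/
def maxCmd : Cmd :=
  Cmd.forTo jobCounter jobsE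
    (Cmd.cond (BExp.leQ (QExp.get timeArr (NExp.var jobCounter)) maxE) Cmd.skip
      (Cmd.setQ maxVar (NExp.const 0) (QExp.get timeArr (NExp.var jobCounter))))

/-- Extend the interval of the current machine by the entry of the adjacency matrix that is
considered. As long as the interval is empty, its left end is moved along. -/
def extendEndsCmd : Cmd :=
  Cmd.cond (BExp.leN (NExp.const 1) (NExp.get edgeArr (NExp.var entryVar)))
    (Cmd.setN rightArr (NExp.var machineCounter) (NExp.add (NExp.var jobCounter) (NExp.const 1)))
    (Cmd.cond (BExp.leN rightE (NExp.const 0))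
      (Cmd.setN leftArr (NExp.var machineCounter)
        (NExp.add (NExp.var jobCounter) (NExp.const 1)))
      Cmd.skip)

/-- Compute the interval of the current machine. -/
def endsCmd : Cmd :=
  Cmd.forTo jobCounter jobsE (Cmd.seq extendEndsCmd
    (Cmd.setN entryVar (NExp.const 0) (NExp.add (NExp.var entryVar) (NExp.const 1))))

/-- Compute the intervals of all machines. -/
def intervalsCmd : Cmd := Cmd.forTo machineCounter machinesE endsCmd

/-- Compute the powers of `n + 1` up to the exponent `q`. -/
def stridesCmd : ℕ → Cmd
  | 0 => Cmd.setN strideArr (NExp.const 0) (NExp.const 1)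
  | q + 1 => Cmd.seq (stridesCmd q) (Cmd.seq
      (Cmd.setN strideArr (NExp.const (q + 1)) (NExp.const 0))
      (Cmd.forTo jobCounter (NExp.add jobsE (NExp.const 1))
        (Cmd.setN strideArr (NExp.const (q + 1)) (NExp.add
          (NExp.get strideArr (NExp.const (q + 1))) (NExp.get strideArr (NExp.const q))))))

/-- The digit of the current code at place `c`. -/
def positionE (c : ℕ) : NExp := NExp.get (posArr + c) (NExp.var codeCounter)

/-- Compute from the digit at `c` of the current code `v` the digit at `c` of `v + (n + 1) ^ c`. -/
def positionCmd (c : ℕ) : Cmd :=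
  Cmd.cond (BExp.leN (NExp.add (positionE c) (NExp.const 1)) jobsE)
    (Cmd.setN (posArr + c) (NExp.add (NExp.var codeCounter) (NExp.get strideArr (NExp.const c)))
      (NExp.add (positionE c) (NExp.const 1)))
    (Cmd.setN (posArr + c) (NExp.add (NExp.var codeCounter) (NExp.get strideArr (NExp.const c)))
      (NExp.const 0))

/-- The programs `positionCmd` for all places below `q`. -/
def positionsCmd : ℕ → Cmd
  | 0 => Cmd.skip
  | q + 1 => Cmd.seq (positionsCmd q) (positionCmd q)

/-- Compute the digits of all codes and the places where the rows of the table of assignments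
begin. -/
def tablesCmd : Cmd :=
  Cmd.forTo codeCounter (NExp.var numCodesVar)
    (Cmd.seq (Cmd.setN rowStartArr (NExp.add (NExp.var codeCounter) (NExp.const 1))
        (NExp.add (NExp.get rowStartArr (NExp.var codeCounter)) jobsE))
      (positionsCmd (C + 1)))

/-- Compute all data on codes. -/
def codesCmd : Cmd :=
  Cmd.seq (stridesCmd (C + 1))
    (Cmd.seq (Cmd.setN numCodesVar (NExp.const 0) (NExp.get strideArr (NExp.const (C + 1))))
      (tablesCmd C))

/-- The computations that do not depend on the guess of the optimum. -/
def prepareCmd : Cmd := Cmd.seq maxCmd (Cmd.seq intervalsCmd (codesCmd C))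

end Programs

section Prepare

variable {m n C : ℕ} {s : State}

theorem runs_maxCmd (hn : s.idx sizeArr 1 = n) (h0 : s.val maxVar 0 = 0) :
    Runs maxCmd s (50 * (n + 1)) (fun s' => Agree (· ∉ [jobCounter, maxVar]) s s' ∧
      (∀ j < n, s.val timeArr j ≤ s'.val maxVar 0) ∧
      (s'.val maxVar 0 = 0 ∨ ∃ j < n, s'.val maxVar 0 = s.val timeArr j)) := by
  refine Runs.le (Runs.forTo (N := n) (t := 20) (· ∉ [jobCounter, maxVar])
    (fun i s' => (∀ j < i, s.val timeArr j ≤ s'.val maxVar 0) ∧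
      (s'.val maxVar 0 = 0 ∨ ∃ j < n, s'.val maxVar 0 = s.val timeArr j))
    (by simp) (fun _ _ _ hJ => hJ) (fun s' ha => ?_) ⟨by simp, Or.inl h0⟩ ?_)
    (by simp only [jobsE, NExp.cost]; omega)
  · simp only [jobsE, NExp.eval, ha.idx (a := sizeArr) (by decide), hn]
  · rintro i s' hi ha hi' ⟨hle, heq⟩
    have htime : s'.val timeArr = s.val timeArr := ha.val (by decide)
    refine Runs.le (Runs.cond (fun hb => Runs.skip ?_) (fun hb => Runs.setQ ?_))
      (by simp only [BExp.cost, maxE, NExp.cost, QExp.cost]; omega)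
    all_goals simp only [BExp.Holds, maxE, QExp.eval, NExp.eval, hi', htime] at hb
    · exact ⟨Agree.refl _ _, hi', Nat.forall_lt_succ_right.2 ⟨hle, hb⟩, heq⟩
    · refine ⟨(Agree.refl _ _).setQ (by simp), hi', ?_, Or.inr ⟨i, hi, ?_⟩⟩
      · simp only [QExp.eval, NExp.eval, hi', htime, State.setQ_val, and_self, if_true]
        exact Nat.forall_lt_succ_right.2
          ⟨fun j hj => (hle j hj).trans (not_le.1 hb).le, le_rfl⟩
      · simp only [QExp.eval, NExp.eval, hi', htime, State.setQ_val, and_self, if_true]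

/-- The elements of `E` below `q` lie in the interval from `l` to `r` (exclusively), and `l` and
`r - 1` are such elements; if there are none, this is expressed by `r = 0` and `l = q`. -/
structure Ends (E : ℕ → Prop) (q l r : ℕ) : Prop where
  mem : ∀ j < q, E j → l ≤ j ∧ j < r
  left_eq : r = 0 → l = q
  attained : 0 < r → l < r ∧ r ≤ q ∧ E l ∧ E (r - 1)

section Ends

variable {E : ℕ → Prop} {q l r : ℕ}

theorem Ends.left_le (h : Ends E q l r) : l ≤ q := by
  rcases Nat.eq_zero_or_pos r with hr | hr
  · exact (h.left_eq hr).le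
  · have := h.attained hr; omega

theorem Ends.zero : Ends E 0 0 0 :=
  ⟨fun j hj => absurd hj j.not_lt_zero, fun _ => rfl, fun h => absurd h (lt_irrefl 0)⟩

theorem Ends.succ_of_mem (h : Ends E q l r) (hq : E q) : Ends E (q + 1) l (q + 1) where
  mem := Nat.forall_lt_succ_right.2
    ⟨fun j hj hE => ⟨(h.mem j hj hE).1, by omega⟩, fun _ => ⟨h.left_le, q.lt_succ_self⟩⟩
  left_eq hr := by omega
  attained _ := by
    refine ⟨Nat.lt_succ_of_le h.left_le, le_rfl, ?_, hq⟩
    rcases Nat.eq_zero_or_pos r with hr | hr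
    · rwa [h.left_eq hr]
    · exact (h.attained hr).2.2.1

theorem Ends.succ_of_not_mem (h : Ends E q l r) (hq : ¬ E q) :
    Ends E (q + 1) (if r = 0 then q + 1 else l) r where
  mem := by
    refine Nat.forall_lt_succ_right.2 ⟨fun j hj hE => ?_, fun hE => absurd hE hq⟩
    have := h.mem j hj hE
    rwa [if_neg (by omega)]
  left_eq hr := if_pos hr
  attained hr := by
    obtain ⟨hlr, hrq, hl, hr'⟩ := h.attained hr
    rw [if_neg hr.ne']
    exact ⟨hlr, by omega, hl, hr'⟩

end Ends

theorem runs_extendEndsCmd {E : ℕ → Prop} {i j : ℕ} (hi : s.idx machineCounter 0 = i)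
    (hj : s.idx jobCounter 0 = j) (hE : E j ↔ 1 ≤ s.idx edgeArr (s.idx entryVar 0))
    (h : Ends E j (s.idx leftArr i) (s.idx rightArr i)) :
    Runs extendEndsCmd s 40 (fun s' => Agree (· ∉ [leftArr, rightArr]) s s' ∧
      Ends E (j + 1) (s'.idx leftArr i) (s'.idx rightArr i) ∧
      ∀ i', i' ≠ i → s'.idx leftArr i' = s.idx leftArr i' ∧
        s'.idx rightArr i' = s.idx rightArr i') := by
  refine Runs.le (Runs.cond (fun hb => Runs.setN ?_) (fun hb => Runs.cond
    (fun hr => Runs.setN ?_) (fun hr => Runs.skip ?_)))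
    (by simp only [BExp.cost, NExp.cost, rightE]; omega)
  all_goals simp only [BExp.Holds, NExp.eval, ← hE] at hb
  · refine ⟨(Agree.refl _ _).setN (by decide), ?_, ?_⟩
    · simpa [NExp.eval, hi, hj] using h.succ_of_mem hb
    · simp +contextual [NExp.eval, hi]
  · simp only [BExp.Holds, rightE, NExp.eval, hi, Nat.le_zero] at hr
    refine ⟨(Agree.refl _ _).setN (by decide), ?_, ?_⟩
    · simpa [NExp.eval, hi, hj, hr] using h.succ_of_not_mem hb
    · simp +contextual [NExp.eval, hi]
  · simp only [BExp.Holds, rightE, NExp.eval, hi, Nat.le_zero] at hr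
    refine ⟨Agree.refl _ _, ?_, fun _ _ => ⟨rfl, rfl⟩⟩
    simpa only [if_neg hr] using h.succ_of_not_mem hb

theorem runs_endsCmd {E : ℕ → Prop} {i : ℕ} (hn : s.idx sizeArr 1 = n)
    (hi : s.idx machineCounter 0 = i) (hp : s.idx entryVar 0 = i * n)
    (hE : ∀ j < n, E j ↔ 1 ≤ s.idx edgeArr (i * n + j)) (hl : s.idx leftArr i = 0)
    (hr : s.idx rightArr i = 0) :
    Runs endsCmd s (80 * (n + 1)) (fun s' =>
      Agree (· ∉ [jobCounter, entryVar, leftArr, rightArr]) s s' ∧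
      s'.idx entryVar 0 = (i + 1) * n ∧ Ends E n (s'.idx leftArr i) (s'.idx rightArr i) ∧
      ∀ i', i' ≠ i → s'.idx leftArr i' = s.idx leftArr i' ∧
        s'.idx rightArr i' = s.idx rightArr i') := by
  refine Runs.mono (Runs.forTo (N := n) (t := 50)
    (· ∉ [jobCounter, entryVar, leftArr, rightArr])
    (fun j s' => s'.idx entryVar 0 = i * n + j ∧ Ends E j (s'.idx leftArr i) (s'.idx rightArr i) ∧
      ∀ i', i' ≠ i → s'.idx leftArr i' = s.idx leftArr i' ∧ s'.idx rightArr i' = s.idx rightArr i')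
    (by decide) (fun j s' x hJ => by simpa using hJ) (fun s' ha => ?_) ?_ ?_)
    (by simp only [jobsE, NExp.cost]; omega) ?_
  · simp only [jobsE, NExp.eval, ha.idx (a := sizeArr) (by decide), hn]
  · exact ⟨hp, by rw [hl, hr]; exact Ends.zero, fun _ _ => ⟨rfl, rfl⟩⟩
  · rintro j s₁ hj ha hj' ⟨hp₁, hends₁, hne₁⟩
    have hi₁ : s₁.idx machineCounter 0 = i := by rw [ha.idx (by decide), hi]
    have hE₁ : E j ↔ 1 ≤ s₁.idx edgeArr (s₁.idx entryVar 0) := by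
      rw [hp₁, ha.idx (a := edgeArr) (by decide)]; exact hE j hj
    refine Runs.le (Runs.seq (t' := 10)
      ((runs_extendEndsCmd hi₁ hj' hE₁ hends₁).mono le_rfl ?_)) (by omega)
    rintro s₂ ⟨ha₂, hends₂, hne₂⟩
    refine Runs.le (Runs.setN ⟨(ha₂.mono (by simp +contextual)).setN (by decide), ?_, ?_, ?_, ?_⟩)
      (by simp only [NExp.cost]; omega)
    · simpa [ha₂.idx (a := jobCounter) (by decide)] using hj'
    · simp [NExp.eval, ha₂.idx (a := entryVar) (by decide), hp₁, add_assoc]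
    · simpa using hends₂
    · intro i' hii'
      simpa [(hne₁ i' hii').1, (hne₁ i' hii').2] using hne₂ i' hii'
  · rintro s' ⟨ha, hp', hends, hne⟩
    exact ⟨ha, by rw [hp']; ring, hends, hne⟩

theorem runs_intervalsCmd {E : ℕ → ℕ → Prop} (hm : s.idx sizeArr 0 = m) (hn : s.idx sizeArr 1 = n)
    (hp : s.idx entryVar 0 = 0) (hE : ∀ i < m, ∀ j < n, E i j ↔ 1 ≤ s.idx edgeArr (i * n + j))
    (hl : ∀ i, s.idx leftArr i = 0) (hr : ∀ i, s.idx rightArr i = 0) :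
    Runs intervalsCmd s ((m + 1) * (100 * (n + 1))) (fun s' =>
      Agree (· ∉ [jobCounter, machineCounter, entryVar, leftArr, rightArr]) s s' ∧
      ∀ i < m, Ends (E i) n (s'.idx leftArr i) (s'.idx rightArr i)) := by
  refine Runs.mono (Runs.forTo (N := m) (t := 80 * (n + 1))
    (· ∉ [jobCounter, machineCounter, entryVar, leftArr, rightArr])
    (fun i s' => s'.idx entryVar 0 = i * n ∧
      (∀ i' < i, Ends (E i') n (s'.idx leftArr i') (s'.idx rightArr i')) ∧
      ∀ i', i ≤ i' → s'.idx leftArr i' = 0 ∧ s'.idx rightArr i' = 0)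
    (by decide) (fun i s' x hJ => by simpa using hJ) (fun s' ha => ?_) (by simp [hp, hl, hr]) ?_)
    (Nat.mul_le_mul_left _ (by simp only [machinesE, NExp.cost]; omega))
    (fun s' hs' => ⟨hs'.1, hs'.2.2.1⟩)
  · simp only [machinesE, NExp.eval, ha.idx (a := sizeArr) (by decide), hm]
  · rintro i s₁ hi ha hi' ⟨hp₁, hends₁, hzero₁⟩
    have hn₁ : s₁.idx sizeArr 1 = n := by rw [ha.idx (by decide), hn]
    have hE₁ : ∀ j < n, E i j ↔ 1 ≤ s₁.idx edgeArr (i * n + j) := by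
      rw [ha.idx (by decide)]; exact hE i hi
    refine (runs_endsCmd hn₁ hi' hp₁ hE₁ (hzero₁ i le_rfl).1 (hzero₁ i le_rfl).2).mono le_rfl ?_
    rintro s₂ ⟨ha₂, hp₂, hends₂, hne₂⟩
    refine ⟨ha₂.mono (by simp +contextual), by rw [ha₂.idx (by decide), hi'], hp₂,
      Nat.forall_lt_succ_right.2 ⟨fun i' hi' => ?_, hends₂⟩, fun i' hi' => ?_⟩
    · rw [(hne₂ i' hi'.ne).1, (hne₂ i' hi'.ne).2]
      exact hends₁ i' hi'
    · rw [(hne₂ i' (by omega)).1, (hne₂ i' (by omega)).2]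
      exact hzero₁ i' (by omega)

theorem runs_stridesCmd (hn : s.idx sizeArr 1 = n) (q : ℕ) :
    Runs (stridesCmd q) s ((q + 1) * (100 * (n + 1))) (fun s' =>
      Agree (· ∉ [jobCounter, strideArr]) s s' ∧ ∀ c ≤ q, s'.idx strideArr c = (n + 1) ^ c) := by
  induction q with
  | zero =>
    refine Runs.le (Runs.setN ⟨(Agree.refl _ _).setN (by decide), ?_⟩)
      (by simp only [NExp.cost]; omega)
    simp [NExp.eval]
  | succ q ih =>
    refine Runs.le (Runs.seq (t' := 100 * (n + 1)) (ih.mono le_rfl ?_)) (le_of_eq (by ring))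
    rintro s₁ ⟨ha₁, hstride₁⟩
    refine Runs.le (Runs.seq (t' := (n + 2) * 40) (Runs.setN ?_))
      (by simp only [NExp.cost]; omega)
    have ha₂ : Agree (· ∉ [jobCounter, strideArr]) s (s₁.setN strideArr (q + 1) 0) :=
      ha₁.setN (by decide)
    refine Runs.mono (Runs.forTo (N := n + 1) (t := 15) (· ∉ [jobCounter, strideArr])
      (fun i s' => s'.idx strideArr (q + 1) = i * (n + 1) ^ q ∧
        ∀ c ≤ q, s'.idx strideArr c = (n + 1) ^ c)
      (by decide) (fun i s' x hJ => by simpa using hJ) (fun s' ha => ?_) ?_ ?_)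
      (by simp only [jobsE, NExp.cost]; omega) ?_
    · simp only [jobsE, NExp.eval, (ha₂.trans ha).idx (a := sizeArr) (by decide), hn]
    · refine ⟨by simp [NExp.eval], fun c hc => ?_⟩
      simpa [NExp.eval, show c ≠ q + 1 by omega] using hstride₁ c hc
    · rintro i s' - - hi' ⟨hnext, hstride⟩
      refine Runs.le (Runs.setN ⟨(Agree.refl _ _).setN (by decide), by simpa using hi', ?_,
        fun c hc => ?_⟩) (by simp [NExp.cost])
      · simp [NExp.eval, hnext, hstride q le_rfl]; ring
      · simpa [NExp.eval, show c ≠ q + 1 by omega] using hstride c hc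
    · rintro s' ⟨ha, hnext, hstride⟩
      refine ⟨ha₂.trans ha, fun c hc => ?_⟩
      rcases Nat.le_succ_iff.1 hc with hc | rfl
      · exact hstride c hc
      · rw [hnext, pow_succ']

theorem runs_positionCmd {c v : ℕ} (hn : s.idx sizeArr 1 = n) (hv : s.idx codeCounter 0 = v)
    (hstride : s.idx strideArr c = (n + 1) ^ c)
    (hdigit : s.idx (posArr + c) v = digit (n + 1) c v) :
    Runs (positionCmd c) s 50
      (· = s.setN (posArr + c) (v + (n + 1) ^ c) (digit (n + 1) c (v + (n + 1) ^ c))) := by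
  have hlt : digit (n + 1) c v < n + 1 := digit_lt n.succ_pos
  refine Runs.le (Runs.cond (fun hb => Runs.setN ?_) fun hb => Runs.setN ?_)
    (by simp only [BExp.cost, NExp.cost, positionE, jobsE]; omega)
  all_goals
    simp only [BExp.Holds, NExp.eval, positionE, jobsE, hv, hdigit, hn] at hb
    simp only [NExp.eval, positionE, hv, hstride, hdigit]
  · rw [digit_add_pow_self (by omega)]
  · rw [digit_add_pow_of_add_one_eq (Nat.succ_pos n) (by rw [Nat.succ_eq_add_one]; omega)]

theorem runs_positionsCmd {v : ℕ} (hn : s.idx sizeArr 1 = n) (hv : s.idx codeCounter 0 = v)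
    (hstride : ∀ c ≤ C, s.idx strideArr c = (n + 1) ^ c)
    (hdigit : ∀ c ≤ C, ∀ u < v + (n + 1) ^ c, s.idx (posArr + c) u = digit (n + 1) c u)
    (q : ℕ) (hq : q ≤ C + 1) :
    Runs (positionsCmd q) s (q * 50 + 1) (fun s' => Agree (· < posArr) s s' ∧
      ∀ c ≤ C, ∀ u, (u < v + (n + 1) ^ c ∨ c < q ∧ u = v + (n + 1) ^ c) →
        s'.idx (posArr + c) u = digit (n + 1) c u) := by
  induction q with
  | zero => exact Runs.skip ⟨Agree.refl _ _, fun c hc u hu => hdigit c hc u (by omega)⟩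
  | succ q ih =>
    refine Runs.le (Runs.seq (t' := 50) ((ih (by omega)).mono le_rfl ?_)) (by omega)
    rintro s₁ ⟨ha, hdigit₁⟩
    have hv' : v < v + (n + 1) ^ q := Nat.lt_add_of_pos_right (by positivity)
    refine (runs_positionCmd (by rw [ha.idx (by decide), hn]) (by rw [ha.idx (by decide), hv])
      (by rw [ha.idx (by decide), hstride q (by omega)])
      (hdigit₁ q (by omega) v (Or.inl hv'))).mono le_rfl ?_
    rintro _ rfl
    refine ⟨ha.setN (by simp), fun c hc u hu => ?_⟩
    rw [State.setN_idx]
    split_ifs with hcu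
    · obtain rfl : c = q := by omega
      rw [hcu.2]
    · have hne : c = q → u ≠ v + (n + 1) ^ c := by rintro rfl h; exact hcu ⟨rfl, h⟩
      exact hdigit₁ c hc u (by omega)

theorem runs_tablesCmd {V : ℕ} (hn : s.idx sizeArr 1 = n) (hV : s.idx numCodesVar 0 = V)
    (hstride : ∀ c ≤ C, s.idx strideArr c = (n + 1) ^ c) (hrow : s.idx rowStartArr 0 = 0)
    (hpos : ∀ c ≤ C, ∀ u, s.idx (posArr + c) u = 0) :
    Runs (tablesCmd C) s ((V + 1) * (C * 50 + 100)) (fun s' =>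
      Agree (fun a => a ∉ [codeCounter, rowStartArr] ∧ a < posArr) s s' ∧
      (∀ v ≤ V, s'.idx rowStartArr v = v * n) ∧
      ∀ c ≤ C, ∀ v < V, s'.idx (posArr + c) v = digit (n + 1) c v) := by
  refine Runs.mono (Runs.forTo (N := V) (t := C * 50 + 80)
    (fun a => a ∉ [codeCounter, rowStartArr] ∧ a < posArr)
    (fun i s' => (∀ v ≤ i, s'.idx rowStartArr v = v * n) ∧
      ∀ c ≤ C, ∀ u < i + (n + 1) ^ c, s'.idx (posArr + c) u = digit (n + 1) c u)
    (by decide) (fun i s' x hJ => ?_) (fun s' ha => ?_) ⟨fun v hv => ?_, fun c hc u hu => ?_⟩ ?_)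
    (Nat.mul_le_mul_left _ (by simp only [NExp.cost]; omega))
    (fun s' hs' => ⟨hs'.1, hs'.2.1, fun c hc v hv => hs'.2.2 c hc v (by omega)⟩)
  · simpa [show ∀ c, posArr + c ≠ codeCounter by omega] using hJ
  · simp only [NExp.eval, ha.idx (a := numCodesVar) (by decide), hV]
  · rw [Nat.le_zero.1 hv, hrow, zero_mul]
  · rw [hpos c hc, digit_of_lt_pow (by omega)]
  · rintro i s₁ - ha hi' ⟨hrow₁, hdigit₁⟩
    have hn₁ : s₁.idx sizeArr 1 = n := by rw [ha.idx (by decide), hn]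
    refine Runs.le (Runs.seq (t' := (C + 1) * 50 + 1) (Runs.setN ?_))
      (by simp only [NExp.cost, jobsE]; omega)
    simp only [NExp.eval, jobsE, hi', hn₁, hrow₁ i le_rfl]
    have ha₂ : Agree (· ∉ [rowStartArr]) s₁ (s₁.setN rowStartArr (i + 1) (i * n + n)) :=
      (Agree.refl _ _).setN (by decide)
    refine (runs_positionsCmd (by rw [ha₂.idx (by decide), hn₁])
      (by rw [ha₂.idx (by decide), hi']) (fun c hc => ?_) (fun c hc u hu => ?_) (C + 1)
      le_rfl).mono le_rfl ?_
    · rw [ha₂.idx (by decide), ha.idx (by decide), hstride c hc]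
    · rw [ha₂.idx (by simp; omega), hdigit₁ c hc u hu]
    · rintro s₃ ⟨ha₃, hdigit₃⟩
      refine ⟨(ha₂.mono (by simp +contextual)).trans (ha₃.mono (by simp +contextual)), ?_,
        fun v hv => ?_, fun c hc u hu => hdigit₃ c hc u (by omega)⟩
      · rw [ha₃.idx (by decide), ha₂.idx (by decide), hi']
      · rw [ha₃.idx (by decide), State.setN_idx]
        split_ifs with hvi
        · rw [hvi.2]; ring
        · exact hrow₁ v (by omega)

theorem runs_codesCmd (hn : s.idx sizeArr 1 = n) (hrow : s.idx rowStartArr 0 = 0)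
    (hpos : ∀ c ≤ C, ∀ u, s.idx (posArr + c) u = 0) :
    Runs (codesCmd C) s (((C + 2) * (100 * (n + 1))) +
      (10 + ((n + 1) ^ (C + 1) + 1) * (C * 50 + 100))) (fun s' =>
      Agree (fun a => a ∉ [jobCounter, codeCounter, strideArr, numCodesVar, rowStartArr] ∧
        a < posArr) s s' ∧
      (∀ c ≤ C, s'.idx strideArr c = (n + 1) ^ c) ∧ s'.idx numCodesVar 0 = (n + 1) ^ (C + 1) ∧
      (∀ v ≤ (n + 1) ^ (C + 1), s'.idx rowStartArr v = v * n) ∧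
      ∀ c ≤ C, ∀ v < (n + 1) ^ (C + 1), s'.idx (posArr + c) v = digit (n + 1) c v) := by
  refine Runs.seq ((runs_stridesCmd hn (C + 1)).mono le_rfl ?_)
  rintro s₁ ⟨ha₁, hstride₁⟩
  refine Runs.seq (Runs.le (Runs.setN ?_) (by simp [NExp.cost]))
  simp only [NExp.eval, hstride₁ (C + 1) le_rfl]
  set s₂ := s₁.setN numCodesVar 0 ((n + 1) ^ (C + 1)) with hs₂
  have ha₂ : Agree (· ∉ [jobCounter, strideArr, numCodesVar]) s s₂ :=
    (ha₁.mono (by simp +contextual)).setN (by decide)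
  have hV₂ : s₂.idx numCodesVar 0 = (n + 1) ^ (C + 1) := by simp [hs₂]
  have hstride₂ : ∀ c ≤ C, s₂.idx strideArr c = (n + 1) ^ c := fun c hc => by
    simpa [hs₂] using hstride₁ c (by omega)
  refine (runs_tablesCmd (by rw [ha₂.idx (by decide), hn]) hV₂ hstride₂
    (by rw [ha₂.idx (by decide), hrow]) fun c hc u => ?_).mono le_rfl ?_
  · rw [ha₂.idx (by simp; omega), hpos c hc]
  · rintro s₃ ⟨ha₃, hrow₃, hdigit₃⟩
    refine ⟨(ha₂.mono (by simp +contextual)).trans (ha₃.mono (by simp +contextual)),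
      fun c hc => ?_, ?_, hrow₃, hdigit₃⟩
    · rw [ha₃.idx (by decide), hstride₂ c hc]
    · rw [ha₃.idx (by decide), hV₂]

/-- The memory `s` holds the sizes, the processing times `p` and the results of the preprocessing
for the adjacency relation `E` between the machines and the jobs. -/
structure Ready (m n C : ℕ) (p : ℕ → ℚ) (E : ℕ → ℕ → Prop) (s : State) : Prop where
  machines : s.idx sizeArr 0 = m
  jobs : s.idx sizeArr 1 = n
  time : s.val timeArr = p
  ends : ∀ i < m, Ends (E i) n (s.idx leftArr i) (s.idx rightArr i)
  stride : ∀ c ≤ C, s.idx strideArr c = (n + 1) ^ c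
  numCodes : s.idx numCodesVar 0 = (n + 1) ^ (C + 1)
  rowStart : ∀ v ≤ (n + 1) ^ (C + 1), s.idx rowStartArr v = v * n
  pos : ∀ c ≤ C, ∀ v < (n + 1) ^ (C + 1), s.idx (posArr + c) v = digit (n + 1) c v
  le_max : ∀ j < n, p j ≤ s.val maxVar 0
  max_eq : s.val maxVar 0 = 0 ∨ ∃ j < n, s.val maxVar 0 = p j

theorem prepareCost_le (m n C : ℕ) :
    50 * (n + 1) + ((m + 1) * (100 * (n + 1)) + (((C + 2) * (100 * (n + 1))) +
      (10 + ((n + 1) ^ (C + 1) + 1) * (C * 50 + 100)))) ≤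
      (m + 1) * (1000 * (C + 2) * ((n + 1) ^ (C + 1) * (n + 1))) := by
  have hpow : 1 ≤ (n + 1) ^ (C + 1) := Nat.one_le_pow _ _ (by omega)
  generalize (n + 1) ^ (C + 1) = V at *
  have hn : n + 1 ≤ V * (n + 1) := Nat.le_mul_of_pos_left _ hpow
  have hV : V ≤ V * (n + 1) := Nat.le_mul_of_pos_right _ (by omega)
  generalize V * (n + 1) = X at *
  have hX : X ≤ (C + 2) * X := Nat.le_mul_of_pos_left _ (by omega)
  have hCX : (C + 2) * X ≤ (m + 1) * ((C + 2) * X) := Nat.le_mul_of_pos_left _ (by omega)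
  have hmn : (m + 1) * (n + 1) ≤ (m + 1) * ((C + 2) * X) := Nat.mul_le_mul_left _ (hn.trans hX)
  have hCn : (C + 2) * (n + 1) ≤ (C + 2) * X := Nat.mul_le_mul_left _ hn
  have hCV : (C + 2) * (V + 1) ≤ (C + 2) * (2 * X) := Nat.mul_le_mul_left _ (by omega)
  nlinarith

theorem runs_prepareCmd {E : ℕ → ℕ → Prop} (hm : s.idx sizeArr 0 = m) (hn : s.idx sizeArr 1 = n)
    (hE : ∀ i < m, ∀ j < n, E i j ↔ 1 ≤ s.idx edgeArr (i * n + j))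
    (hidx : ∀ a, 2 ≤ a → ∀ i, s.idx a i = 0) (hmax : s.val maxVar 0 = 0) :
    Runs (prepareCmd C) s ((m + 1) * (1000 * (C + 2) * ((n + 1) ^ (C + 1) * (n + 1))))
      (Ready m n C (s.val timeArr) E) := by
  refine Runs.le (Runs.seq ((runs_maxCmd hn hmax).mono le_rfl ?_)) (prepareCost_le m n C)
  rintro s₁ ⟨ha₁, hle, heq⟩
  refine Runs.seq ((runs_intervalsCmd (E := E) (by rw [ha₁.idx (by decide), hm])
    (by rw [ha₁.idx (by decide), hn]) ?_ ?_ ?_ ?_).mono le_rfl ?_)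
  · rw [ha₁.idx (by decide), hidx _ (by decide)]
  · rwa [ha₁.idx (by decide)]
  · rw [ha₁.idx (by decide)]; exact hidx _ (by decide)
  · rw [ha₁.idx (by decide)]; exact hidx _ (by decide)
  rintro s₂ ⟨ha₂, hends⟩
  have ha₁₂ : Agree (· ∉ [jobCounter, machineCounter, entryVar, leftArr, rightArr, maxVar]) s s₂ :=
    (ha₁.mono (by simp +contextual)).trans (ha₂.mono (by simp +contextual))
  refine (runs_codesCmd (by rw [ha₁₂.idx (by decide), hn])
    (by rw [ha₁₂.idx (by decide), hidx _ (by decide)]) fun c _ u => ?_).mono le_rfl ?_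
  · rw [ha₁₂.idx (by simp; omega), hidx _ (by omega)]
  rintro s₃ ⟨ha₃, hstride, hcodes, hrow, hdigit⟩
  have hmax₃ : s₃.val maxVar = s₁.val maxVar := by rw [ha₃.val (by decide), ha₂.val (by decide)]
  exact
    { machines := by rw [ha₃.idx (by decide), ha₁₂.idx (by decide), hm]
      jobs := by rw [ha₃.idx (by decide), ha₁₂.idx (by decide), hn]
      time := by rw [ha₃.val (by decide), ha₁₂.val (by decide)]
      ends := by rw [ha₃.idx (by decide), ha₃.idx (by decide)]; exact hends
      stride := hstride
      numCodes := hcodes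
      rowStart := hrow
      pos := hdigit
      le_max := by rwa [hmax₃]
      max_eq := by rwa [hmax₃] }

end Prepare

section SizeClasses

variable {k c C : ℕ} {T x : ℚ}

/-- The class of a job of size `x` for the guess `T`. It is `0` also if `x` is above the bounds of
all classes. -/
noncomputable def classOf (k : ℕ) (T x : ℚ) : ℕ := sInf {c : ℕ | x ≤ classMax k c * T}

theorem classMax_pos (hk : 0 < k) (c : ℕ) : 0 < classMax k c := by
  have : (0 : ℚ) < k := by exact_mod_cast hk
  unfold classMax
  positivity

theorem classMax_succ (k c : ℕ) : classMax k (c + 1) = (1 + 2 / k) * classMax k c := by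
  unfold classMax
  ring

theorem classMax_mono (hk : 0 < k) : Monotone (classMax k) := by
  refine monotone_nat_of_le_succ fun c => ?_
  rw [classMax_succ]
  exact le_mul_of_one_le_left (classMax_pos hk c).le (le_add_of_nonneg_right (by positivity))

theorem classMin_nonneg (hk : 0 < k) (c : ℕ) : 0 ≤ classMin k c := by
  unfold classMin
  split_ifs
  exacts [le_rfl, (classMax_pos hk _).le]

theorem one_le_classMax (hk : 0 < k) (hC : (k : ℚ) ≤ (1 + 2 / k) ^ C) : 1 ≤ classMax k C := by
  unfold classMax
  rwa [one_le_div (by exact_mod_cast hk)]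

theorem le_classMax_classOf (h : x ≤ classMax k c * T) : x ≤ classMax k (classOf k T x) * T :=
  Nat.sInf_mem (s := {c : ℕ | x ≤ classMax k c * T}) ⟨c, h⟩

theorem classOf_le (h : x ≤ classMax k c * T) : classOf k T x ≤ c :=
  Nat.sInf_le h

theorem classMin_classOf_lt (hx : 0 < x) : classMin k (classOf k T x) * T < x := by
  unfold classMin
  split_ifs with hc
  · rwa [zero_mul]
  · exact not_le.1 (Nat.notMem_of_lt_sInf (s := {c : ℕ | x ≤ classMax k c * T})
      (Nat.sub_one_lt hc))

theorem le_mul_classMin_classOf (h : x ≤ classMax k c * T) (h0 : classOf k T x ≠ 0) :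
    x ≤ (1 + 2 / k) * (classMin k (classOf k T x) * T) := by
  rw [← mul_assoc, classMin, if_neg h0, ← classMax_succ, Nat.sub_one_add_one h0]
  exact le_classMax_classOf h

theorem classOf_eq_iff (hk : 0 < k) (hT : 0 ≤ T) (hx : 0 < x) (hC : x ≤ classMax k C * T) :
    classOf k T x = c ↔ classMin k c * T < x ∧ x ≤ classMax k c * T := by
  refine ⟨?_, fun ⟨hmin, hmax⟩ => (classOf_le hmax).antisymm (not_lt.1 fun hlt => ?_)⟩
  · rintro rfl
    exact ⟨classMin_classOf_lt hx, le_classMax_classOf hC⟩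
  · rw [classMin, if_neg (by omega)] at hmin
    exact (hmin.trans_le (le_classMax_classOf hC)).not_ge
      (mul_le_mul_of_nonneg_right (classMax_mono hk (by omega)) hT)

end SizeClasses

/-- The assignment `b` is feasible and has loads at most `M`; the machines and the jobs are numbered
by natural numbers. -/
def FeasibleWithin (m n : ℕ) (p : ℕ → ℚ) (E : ℕ → ℕ → Prop) (M : ℚ) (b : ℕ → ℕ) : Prop :=
  (∀ j < n, b j < m ∧ E (b j) j) ∧ ∀ i, ∑ j ∈ Finset.range n with b j = i, p j ≤ M

/-- The guess `T` exceeds the optimum at most by the factor `1 + 1 / k`. -/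
def IsGuess (k m n : ℕ) (p : ℕ → ℚ) (E : ℕ → ℕ → Prop) (T : ℚ) : Prop :=
  ∀ M b, FeasibleWithin m n p E M b → T ≤ (1 + 1 / k) * M

/-- The result of the search: the loads of `a` are within `1 + 3 / k` times a guess that is not much
above the optimum. -/
def Solved (k m n : ℕ) (p : ℕ → ℚ) (E : ℕ → ℕ → Prop) (a : ℕ → ℕ) : Prop :=
  ∃ T, IsGuess k m n p E T ∧ FeasibleWithin m n p E ((1 + 3 / k) * T) a

/-- An instance on an inclusion-free convex graph, with machines and jobs numbered by natural
numbers. -/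
structure NatInstance (m n : ℕ) (p : ℕ → ℚ) (E : ℕ → ℕ → Prop) : Prop where
  time_pos : ∀ j < n, 0 < p j
  time_eq_zero : ∀ j, n ≤ j → p j = 0
  jobs_pos : 0 < n
  lt_of_adj : ∀ i j, E i j → j < n
  executable : ∀ j < n, ∃ i < m, E i j
  convex : ∀ i < m, ∀ a b c, a ≤ b → b ≤ c → E i a → E i c → E i b
  enclosed : ∀ i < m, ∀ i' < m, (∀ j, E i j → E i' j) → ∀ a b c, a ≤ b → b ≤ c →
    E i' a → E i' c → ¬ E i a → ¬ E i c → ¬ E i b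

/-- The instance of the dynamic program for the guess `T`, with the intervals stored in `s`. -/
noncomputable def guessInstance (k m n C : ℕ) (p : ℕ → ℚ) (s : State) (T : ℚ) :
    IntervalInstance where
  m := m
  n := n
  C := C
  p := p
  cls j := classOf k T (p j)
  B := (1 + 3 / k) * T
  L := s.idx leftArr
  R := s.idx rightArr

section Instances

variable {k m n C : ℕ} {p : ℕ → ℚ} {E : ℕ → ℕ → Prop} {s : State} {T M : ℚ}

theorem FeasibleWithin.congr {a b : ℕ → ℕ} (h : FeasibleWithin m n p E M b)
    (hab : ∀ j < n, a j = b j) : FeasibleWithin m n p E M a := by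
  refine ⟨fun j hj => by rw [hab j hj]; exact h.1 j hj, fun i => ?_⟩
  rw [Finset.filter_congr fun j hj => by rw [hab j (Finset.mem_range.1 hj)]]
  exact h.2 i

theorem Solved.congr {a b : ℕ → ℕ} (h : Solved k m n p E b) (hab : ∀ j < n, a j = b j) :
    Solved k m n p E a :=
  let ⟨T, hT, hb⟩ := h
  ⟨T, hT, hb.congr hab⟩

namespace NatInstance

variable {i i' l r l' r' : ℕ}

theorem time_nonneg (h : NatInstance m n p E) (j : ℕ) : 0 ≤ p j := by
  rcases lt_or_ge j n with hj | hj
  · exact (h.time_pos j hj).le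
  · exact (h.time_eq_zero j hj).ge

theorem time_le (h : NatInstance m n p E) {b : ℕ → ℕ} (hb : FeasibleWithin m n p E M b) {j : ℕ}
    (hj : j < n) : p j ≤ M := by
  refine le_trans ?_ (hb.2 (b j))
  exact Finset.single_le_sum (f := p) (fun j _ => h.time_nonneg j) (by simpa using hj)

theorem adj_iff (h : NatInstance m n p E) (hi : i < m) (he : Ends (E i) n l r) (j : ℕ) :
    E i j ↔ l ≤ j ∧ j < r := by
  refine ⟨fun hj => he.mem j (h.lt_of_adj i j hj) hj, fun ⟨hl, _⟩ => ?_⟩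
  obtain ⟨-, -, hEl, hEr⟩ := he.attained (by omega)
  exact h.convex i hi l j (r - 1) hl (by omega) hEl hEr

theorem le_and_le_of_add_le (h : NatInstance m n p E) (hi : i < m) (hi' : i' < m)
    (he : Ends (E i) n l r) (he' : Ends (E i') n l' r') (hlr : l < r) (hlr' : l' < r')
    (hsum : l + r ≤ l' + r') : l ≤ l' ∧ r ≤ r' := by
  have hE := h.adj_iff hi he
  have hE' := h.adj_iff hi' he'
  constructor <;> by_contra hlt
  · have := h.enclosed i hi i' hi' (fun j hj => by rw [hE] at hj; rw [hE']; omega)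
      l' l (r' - 1) (by omega) (by omega)
    simp only [hE, hE'] at this
    omega
  · have := h.enclosed i' hi' i hi (fun j hj => by rw [hE'] at hj; rw [hE]; omega)
      l l' (r - 1) (by omega) (by omega)
    simp only [hE, hE'] at this
    omega

end NatInstance

namespace Ready

theorem of_agree {s' : State} (h : Ready m n C p E s) (ha : Agree (Outside entryVar) s s') :
    Ready m n C p E s' where
  machines := by rw [ha.idx (by decide), h.machines]
  jobs := by rw [ha.idx (by decide), h.jobs]
  time := by rw [ha.val (by decide), h.time]
  ends := by rw [ha.idx (by decide), ha.idx (by decide)]; exact h.ends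
  stride := by rw [ha.idx (by decide)]; exact h.stride
  numCodes := by rw [ha.idx (by decide), h.numCodes]
  rowStart := by rw [ha.idx (by decide)]; exact h.rowStart
  pos c hc := by rw [ha.idx (by omega)]; exact h.pos c hc
  le_max := by rw [ha.val (by decide)]; exact h.le_max
  max_eq := by rw [ha.val (by decide)]; exact h.max_eq

theorem max_pos (h : Ready m n C p E s) (hI : NatInstance m n p E) : 0 < s.val maxVar 0 :=
  (hI.time_pos 0 hI.jobs_pos).trans_le (h.le_max 0 hI.jobs_pos)

theorem max_le (h : Ready m n C p E s) (hI : NatInstance m n p E) {b : ℕ → ℕ}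
    (hb : FeasibleWithin m n p E M b) : s.val maxVar 0 ≤ M := by
  obtain hmax | ⟨j, hj, hmax⟩ := h.max_eq
  · exact absurd hmax (h.max_pos hI).ne'
  · exact hmax ▸ hI.time_le hb hj

theorem exists_feasibleWithin (h : Ready m n C p E s) (hI : NatInstance m n p E) :
    ∃ b, FeasibleWithin m n p E (n * s.val maxVar 0) b := by
  choose! b hb using hI.executable
  refine ⟨b, hb, fun i => ?_⟩
  calc ∑ j ∈ Finset.range n with b j = i, p j
      ≤ ∑ j ∈ Finset.range n, p j :=
        Finset.sum_le_sum_of_subset_of_nonneg (Finset.filter_subset _ _)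
          fun j _ _ => hI.time_nonneg j
    _ ≤ ∑ _j ∈ Finset.range n, s.val maxVar 0 :=
        Finset.sum_le_sum fun j hj => h.le_max j (Finset.mem_range.1 hj)
    _ = n * s.val maxVar 0 := by simp

section Guess

variable (h : Ready m n C p E s) (hI : NatInstance m n p E) (hk : 0 < k)
  (hC : (k : ℚ) ≤ (1 + 2 / k) ^ C) (hT : s.val maxVar 0 ≤ T)

include h hI hT

theorem guess_nonneg : 0 ≤ T := (h.max_pos hI).le.trans hT

include hk hC

theorem time_le_classMax {j : ℕ} (hj : j < n) : p j ≤ classMax k C * T :=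
  ((h.le_max j hj).trans hT).trans
    (le_mul_of_one_le_left (h.guess_nonneg hI hT) (one_le_classMax hk hC))

theorem encodes (hguess : s.val guessVar 0 = T) :
    Encodes k (guessInstance k m n C p s T) T s where
  machines := h.machines
  jobs := h.jobs
  time := h.time
  left := rfl
  right := rfl
  stride := h.stride
  numCodes := h.numCodes
  rowStart v hv := h.rowStart v (le_of_lt hv)
  pos := h.pos
  guess := hguess
  bound := rfl
  cls j hj _ _ := classOf_eq_iff hk (h.guess_nonneg hI hT) (hI.time_pos j hj)
    (h.time_le_classMax hI hk hC hT hj)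

theorem isWellFormed : (guessInstance k m n C p s T).IsWellFormed where
  time_nonneg := hI.time_nonneg
  time_pos := hI.time_pos
  cls_le _ hj := classOf_le (h.time_le_classMax hI hk hC hT hj)
  left_le i hi := (h.ends i hi).left_le
  right_le i hi := (Nat.eq_zero_or_pos _).elim (fun h0 => h0.trans_le (Nat.zero_le _))
    fun h0 => ((h.ends i hi).attained h0).2.1
  sorted i hi i' hi' := hI.le_and_le_of_add_le hi hi' (h.ends i hi) (h.ends i' hi')

theorem isRounding : (guessInstance k m n C p s T).IsRounding (fun c => classMin k c * T)
    (1 + 2 / k) (T / k) where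
  one_le := le_add_of_nonneg_right (by positivity)
  nonneg := div_nonneg (h.guess_nonneg hI hT) k.cast_nonneg
  lo_nonneg c := mul_nonneg (classMin_nonneg hk c) (h.guess_nonneg hI hT)
  time_le j hj hcls := by
    have := le_classMax_classOf (h.time_le_classMax hI hk hC hT hj)
    rwa [show classOf k T (p j) = 0 from hcls, classMax, pow_zero, one_div_mul_eq_div] at this
  lo_le_time j hj _ := (classMin_classOf_lt (hI.time_pos j hj)).le
  time_le_mul_lo j hj hcls := le_mul_classMin_classOf (h.time_le_classMax hI hk hC hT hj) hcls

theorem feasibleWithin_of_load_le {a : ℕ → ℕ → ℕ}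
    (hload : ((guessInstance k m n C p s T).solve a).load ((n + 1) ^ (C + 1) - 1) ≤
      (1 + 3 / k) * T) :
    FeasibleWithin m n p E ((1 + 3 / k) * T)
      (((guessInstance k m n C p s T).solve a).row ((n + 1) ^ (C + 1) - 1)) := by
  obtain ⟨hrun, hsum⟩ := IntervalInstance.solve_sound (h.isWellFormed hI hk hC hT).cls_le
    (mul_nonneg (by positivity) (h.guess_nonneg hI hT)) a hload
  refine ⟨fun j hj => ⟨(hrun j hj).1, ?_⟩, hsum⟩
  exact (hI.adj_iff (hrun j hj).1 (h.ends _ (hrun j hj).1) j).2 (hrun j hj).2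

theorem load_le {b : ℕ → ℕ} (hb : FeasibleWithin m n p E T b) (a : ℕ → ℕ → ℕ) :
    ((guessInstance k m n C p s T).solve a).load ((n + 1) ^ (C + 1) - 1) ≤ (1 + 3 / k) * T :=
  IntervalInstance.solve_complete (h.isWellFormed hI hk hC hT) (h.isRounding hI hk hC hT)
    (fun j hj => ⟨(hb.1 j hj).1,
      (hI.adj_iff (hb.1 j hj).1 (h.ends _ (hb.1 j hj).1) j).1 (hb.1 j hj).2⟩)
    hb.2 (le_of_eq (by change _ = (1 + 3 / (k : ℚ)) * T; ring)) (h.guess_nonneg hI hT) a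

end Guess

end Ready

end Instances

/-! ### Search for the optimum -/

section Programs

variable (k C : ℕ)

/-- The last code. -/
def lastE : NExp := NExp.sub (NExp.var numCodesVar) (NExp.const 1)

/-- Run the dynamic program for the current guess, and increase the guess if it fails. -/
def attemptCmd : Cmd :=
  Cmd.seq (solveCmd k C) (Cmd.cond (BExp.leQ (loadE lastE) (boundE k))
    (Cmd.setN doneVar (NExp.const 0) (NExp.const 1))
    (Cmd.setQ guessVar (NExp.const 0) (QExp.add guessE (QExp.scale (1 / k) maxE))))

/-- Increase the guess, starting from the largest processing time, until the dynamic program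
succeeds. -/
def searchCmd : Cmd :=
  Cmd.seq (Cmd.setQ guessVar (NExp.const 0) maxE)
    (Cmd.seq (Cmd.setN doneVar (NExp.const 0) (NExp.const 0))
      (Cmd.loop (BExp.leN (NExp.var doneVar) (NExp.const 0)) (attemptCmd k C)))

/-- Copy the assignment at the last code to the array of the output. -/
def outputCmd : Cmd :=
  Cmd.forTo jobCounter jobsE (Cmd.setN outputArr (NExp.var jobCounter)
    (NExp.get rowArr (rowE lastE (NExp.var jobCounter))))

/-- The approximation algorithm. -/
def mainCmd : Cmd := Cmd.seq (prepareCmd C) (Cmd.seq (searchCmd k C) outputCmd)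

end Programs

section Main

variable {k m n C : ℕ} {p : ℕ → ℚ} {E : ℕ → ℕ → Prop} {s : State} {T : ℚ}

/-- The assignment that the dynamic program stores at the last code. -/
def lastRow (n C : ℕ) (s : State) (j : ℕ) : ℕ := s.idx rowArr (((n + 1) ^ (C + 1) - 1) * n + j)

/-- The search has succeeded, or it continues with the guess `T`. -/
def Searching (k m n C : ℕ) (p : ℕ → ℚ) (E : ℕ → ℕ → Prop) (T : ℚ) (s : State) : Prop :=
  s.idx doneVar 0 = 1 ∧ Solved k m n p E (lastRow n C s) ∨
    s.idx doneVar 0 = 0 ∧ s.val guessVar 0 = T ∧ IsGuess k m n p E T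

/-- The unit of the time bounds for the search, up to a constant the time of one attempt. -/
def attemptCost (m n C : ℕ) : ℕ :=
  (n + 1) * ((m + 1) * ((C + 2) * ((n + 1) ^ (C + 1) * (n + 1))))

theorem attemptCost_pos (m n C : ℕ) : 0 < attemptCost m n C := by
  unfold attemptCost
  positivity

theorem Encodes.eval_lastE {d : IntervalInstance} (h : Encodes k d T s) :
    lastE.eval s = d.numCodes - 1 := by
  simp only [lastE, NExp.eval, h.numCodes]

section Search

variable (h : Ready m n C p E s) (hI : NatInstance m n p E) (hk : 0 < k)
  (hC : (k : ℚ) ≤ (1 + 2 / k) ^ C)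

include h hI

theorem Ready.isGuess_max : IsGuess k m n p E (s.val maxVar 0) := fun M b hb => by
  have hmax := h.max_le hI hb
  exact hmax.trans (le_mul_of_one_le_left ((h.max_pos hI).le.trans hmax)
    (le_add_of_nonneg_right (by positivity)))

include hk

theorem Ready.lt_of_isGuess {g : ℕ} (hG : IsGuess k m n p E ((1 + g / k) * s.val maxVar 0)) :
    g < (k + 1) * n := by
  have hk' : (0 : ℚ) < k := by exact_mod_cast hk
  obtain ⟨b, hb⟩ := h.exists_feasibleWithin hI
  have hle := hG _ b hb
  rw [← mul_assoc] at hle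
  have hle' := mul_le_mul_of_nonneg_left (le_of_mul_le_mul_right hle (h.max_pos hI)) hk'.le
  field_simp at hle'
  have : k + g ≤ (k + 1) * n := by exact_mod_cast hle'
  omega

include hC

theorem Ready.isGuess_add_max (hT : s.val maxVar 0 ≤ T) {a : ℕ → ℕ → ℕ}
    (hload : (1 + 3 / k) * T <
      ((guessInstance k m n C p s T).solve a).load ((n + 1) ^ (C + 1) - 1)) :
    IsGuess k m n p E (T + 1 / k * s.val maxVar 0) := fun M b hb => by
  have hTM : T ≤ M := by
    by_contra! hMT
    exact hload.not_ge (h.load_le hI hk hC hT ⟨hb.1, fun i => (hb.2 i).trans hMT.le⟩ a)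
  calc T + 1 / k * s.val maxVar 0 ≤ M + 1 / k * M := by gcongr; exact h.max_le hI hb
    _ = (1 + 1 / k) * M := by ring

theorem runs_attemptCmd (hT : s.val maxVar 0 ≤ T) (hguess : s.val guessVar 0 = T)
    (hdone : s.idx doneVar 0 = 0) (hG : IsGuess k m n p E T) :
    Runs (attemptCmd k C) s (4100 * attemptCost m n C) (fun s' =>
      Agree (Outside entryVar) s s' ∧
        Searching k m n C p E (T + 1 / k * s.val maxVar 0) s') := by
  have henc := h.encodes hI hk hC hT hguess
  have hlast := Nat.sub_lt (guessInstance k m n C p s T).numCodes_pos one_pos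
  refine Runs.le (Runs.seq (t' := 60) ((runs_solveCmd henc).mono le_rfl ?_)) ?_
  · rintro s₁ ⟨ha, hs₁⟩
    have henc₁ := henc.of_agree (agree_outside_mono ha (by decide))
    have hload := hs₁.eval_loadE hlast henc₁.eval_lastE
    have hmax₁ : s₁.val maxVar 0 = s.val maxVar 0 := by rw [ha.val (by decide)]
    refine Runs.le (Runs.cond (fun hb => Runs.setN ?_) (fun hb => Runs.setQ ?_)) ?_
    · simp only [BExp.Holds, henc₁.eval_boundE, hload] at hb
      refine ⟨(agree_outside_mono ha (by decide)).setN (by decide),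
        Or.inl ⟨by simp [NExp.eval], T, hG, ?_⟩⟩
      refine (h.feasibleWithin_of_load_le hI hk hC hT hb).congr fun j hj => ?_
      refine Eq.trans ?_ ((hs₁ _ hlast).2 j hj)
      simp only [lastRow, State.setN_idx, show ¬ rowArr = doneVar by decide, false_and, if_false]
      rfl
    · simp only [BExp.Holds, henc₁.eval_boundE, hload, not_le] at hb
      refine ⟨(agree_outside_mono ha (by decide)).setQ (by decide),
        Or.inr ⟨?_, ?_, h.isGuess_add_max hI hk hC hT hb⟩⟩
      · rw [State.setQ_idx, ha.idx (by decide), hdone]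
      · simp [guessE, maxE, QExp.eval, NExp.eval, henc₁.guess, hmax₁]
    · simp only [BExp.cost, NExp.cost, QExp.cost, loadE, lastE, boundE, guessE, maxE]; omega
  · have hpos := attemptCost_pos m n C
    have hcost : (n + 1) * ((m + 1) * ((C + 2) * (4000 * ((n + 1) ^ (C + 1) * (n + 1))))) =
        4000 * attemptCost m n C := by unfold attemptCost; ring
    change (n + 1) * ((m + 1) * ((C + 2) * (4000 * ((n + 1) ^ (C + 1) * (n + 1))))) + 60 ≤ _
    omega

theorem runs_searchLoop {s' : State} (ha : Agree (Outside entryVar) s s')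
    (hs' : Searching k m n C p E (s.val maxVar 0) s') :
    Runs (Cmd.loop (BExp.leN (NExp.var doneVar) (NExp.const 0)) (attemptCmd k C)) s'
      ((k + 1) * n * (4 + 4100 * attemptCost m n C) + 4)
      (fun s' => Ready m n C p E s' ∧ Solved k m n p E (lastRow n C s')) := by
  let guess (g : ℕ) : ℚ := (1 + g / k) * s.val maxVar 0
  have hguess (g : ℕ) : guess (g + 1) = guess g + 1 / k * s.val maxVar 0 := by
    simp only [guess]; push_cast; ring
  refine Runs.loop (fun g s' => Agree (Outside entryVar) s s' ∧ Searching k m n C p E (guess g) s')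
    ?_ ?_ ?_ ⟨ha, by simpa [guess] using hs'⟩ <;>
    rintro g s₁ ⟨ha₁, hs₁⟩ hb <;> simp only [BExp.Holds, NExp.eval] at hb
  · exact h.lt_of_isGuess hI hk (hs₁.resolve_left (by omega)).2.2
  · obtain ⟨hdone, hval, hG⟩ := hs₁.resolve_left (by omega)
    have hmax : s₁.val maxVar = s.val maxVar := ha₁.val (by decide)
    have hle : s₁.val maxVar 0 ≤ guess g := by
      rw [hmax]
      exact le_mul_of_one_le_left (h.max_pos hI).le (le_add_of_nonneg_right (by positivity))
    refine (runs_attemptCmd (h.of_agree ha₁) hI hk hC hle hval hdone hG).mono le_rfl ?_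
    rintro s₂ ⟨ha₂, hs₂⟩
    exact ⟨ha₁.trans ha₂, by rwa [hguess, ← hmax]⟩
  · exact ⟨h.of_agree ha₁, (hs₁.resolve_right fun hs₁ => hb hs₁.1.le).2⟩

theorem runs_searchCmd :
    Runs (searchCmd k C) s ((k + 2) * (n + 1) * (4200 * attemptCost m n C))
      (fun s' => Ready m n C p E s' ∧ Solved k m n p E (lastRow n C s')) := by
  have hpos := attemptCost_pos m n C
  refine Runs.le (Runs.seq (Runs.setQ (Runs.seq (Runs.setN (runs_searchLoop h hI hk hC
    (((Agree.refl _ _).setQ (by decide)).setN (by decide))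
    (Or.inr ⟨by simp [NExp.eval], by simp [NExp.eval, QExp.eval, maxE], h.isGuess_max hI⟩)))))) ?_
  simp only [NExp.cost, QExp.cost, maxE]
  calc _ = (k + 1) * n * (4 + 4100 * attemptCost m n C) + 11 := by ring
    _ ≤ (k + 1) * n * (4200 * attemptCost m n C) + (n + k + 2) * (4200 * attemptCost m n C) := by
      gcongr ?_ + ?_
      · exact Nat.mul_le_mul_left _ (by omega)
      · nlinarith
    _ = _ := by ring

end Search

theorem runs_outputCmd (h : Ready m n C p E s) :
    Runs outputCmd s (50 * (n + 1)) (fun s' => ∀ j < n, s'.idx outputArr j = lastRow n C s j) := by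
  refine Runs.mono (Runs.forTo (N := n) (t := 20) (· ∉ [outputArr, jobCounter])
    (fun i s' => ∀ j < i, s'.idx outputArr j = lastRow n C s j)
    (by decide) (fun i s' x hJ => by simpa using hJ) ?_ (by simp) ?_) ?_ fun s' hs' => hs'.2
  · exact fun s' ha => by rw [jobsE, NExp.eval, ha.idx (by decide)]; exact h.jobs
  · rintro i s₁ - ha hi' hJ
    refine Runs.le (Runs.setN ?_) (by simp [NExp.cost, lastE, rowE])
    refine ⟨(Agree.refl _ _).setN (by decide), by simpa using hi', fun j hj => ?_⟩
    have hval : (NExp.get rowArr (rowE lastE (NExp.var jobCounter))).eval s₁ = lastRow n C s i := by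
      simp only [rowE, lastE, lastRow, NExp.eval, hi', ha.idx (a := rowArr) (by decide),
        ha.idx (a := rowStartArr) (by decide), ha.idx (a := numCodesVar) (by decide), h.numCodes,
        h.rowStart _ (Nat.sub_le _ 1)]
    rw [hval, State.setN_idx]
    split_ifs with hji
    · rw [hji.2]
      exact congrArg _ hi'.symm
    · exact hJ j ((Nat.le_of_lt_succ hj).lt_of_ne fun hji' => hji ⟨rfl, hji'.trans hi'.symm⟩)
  · simp only [jobsE, NExp.cost]; omega

theorem mainCost_le (k m n C : ℕ) :
    (m + 1) * (1000 * (C + 2) * ((n + 1) ^ (C + 1) * (n + 1))) +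
      ((k + 2) * (n + 1) * (4200 * attemptCost m n C) + 50 * (n + 1)) ≤
      (k + 2) * (C + 2) * 6000 * ((m + 1) * (n + 1) ^ (C + 4)) := by
  have hpow : 1 ≤ (n + 1) ^ (C + 1) := Nat.one_le_pow _ _ n.succ_pos
  have hsucc : 1 ≤ n + 1 := n.succ_pos
  set X := (n + 1) ^ (C + 1) with hX
  set unit := (k + 2) * (C + 2) * ((m + 1) * (X * (n + 1) * (n + 1) * (n + 1))) with hunit
  have hprepare : (m + 1) * (1000 * (C + 2) * (X * (n + 1))) ≤ 1000 * unit := by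
    calc _ = 1000 * (1 * (C + 2) * ((m + 1) * (X * (n + 1) * 1 * 1))) := by ring
      _ ≤ _ := by rw [hunit]; gcongr; omega
  have hsearch : (k + 2) * (n + 1) * (4200 * attemptCost m n C) = 4200 * unit := by
    rw [attemptCost, hunit]; ring
  have houtput : 50 * (n + 1) ≤ 50 * unit := by
    calc _ = 50 * (1 * 1 * (1 * (1 * (n + 1) * 1 * 1))) := by ring
      _ ≤ _ := by rw [hunit]; gcongr <;> omega
  have hmain : (k + 2) * (C + 2) * 6000 * ((m + 1) * (n + 1) ^ (C + 4)) = 6000 * unit := by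
    rw [hunit, hX]; ring
  omega

theorem runs_mainCmd (hI : NatInstance m n p E) (hk : 0 < k) (hC : (k : ℚ) ≤ (1 + 2 / k) ^ C)
    (hm : s.idx sizeArr 0 = m) (hn : s.idx sizeArr 1 = n) (hp : s.val timeArr = p)
    (hE : ∀ i < m, ∀ j < n, E i j ↔ 1 ≤ s.idx edgeArr (i * n + j))
    (hidx : ∀ a, 2 ≤ a → ∀ i, s.idx a i = 0) (hmax : s.val maxVar 0 = 0) :
    Runs (mainCmd k C) s ((k + 2) * (C + 2) * 6000 * ((m + 1) * (n + 1) ^ (C + 4)))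
      (fun s' => Solved k m n p E (s'.idx outputArr)) := by
  refine Runs.le (Runs.seq ((runs_prepareCmd hm hn hE hidx hmax).mono le_rfl fun s₁ hs₁ => ?_))
    (mainCost_le k m n C)
  rw [hp] at hs₁
  exact Runs.seq ((runs_searchCmd hs₁ hI hk hC).mono le_rfl fun s₂ hs₂ =>
    (runs_outputCmd hs₂.1).mono le_rfl fun s₃ hs₃ => hs₂.2.congr hs₃)

end Main

end ConvexMakespan

namespace ConvexMakespan

open RAM MinMax

variable {m n : ℕ} {E : Fin m → Fin n → Bool} {p : Fin n → ℚ}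

/-- The adjacency of machines and jobs that are numbered by natural numbers. -/
def natRel (E : Fin m → Fin n → Bool) (i j : ℕ) : Prop :=
  ∃ (hi : i < m) (hj : j < n), E ⟨i, hi⟩ ⟨j, hj⟩ = true

theorem input_val (j : Fin n) : (input E p).val 0 j = p j := by
  simp [input]

theorem natInstance_of_isInstance (h : IsInstance E p) :
    NatInstance m n ((input E p).val 0) (natRel E) where
  time_pos j hj := (h.time_pos ⟨j, hj⟩).trans_eq (input_val ⟨j, hj⟩).symm
  time_eq_zero j hj := by simp [input, not_lt.2 hj]
  jobs_pos := h.jobs_pos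
  lt_of_adj _ _ hE := hE.2.1
  executable j hj :=
    let ⟨i, hi⟩ := h.executable ⟨j, hj⟩
    ⟨i, i.2, i.2, hj, hi⟩
  convex := by
    rintro i hi a b c hab hbc ⟨_, ha, hEa⟩ ⟨_, hc, hEc⟩
    have hb : b < n := hbc.trans_lt hc
    exact ⟨hi, hb, (h.adjacency ⟨i, hi⟩).out (x := ⟨a, ha⟩) (y := ⟨c, hc⟩) hEa hEc
      (show (⟨b, hb⟩ : Fin n) ∈ Set.Icc _ _ from ⟨hab, hbc⟩)⟩
  enclosed := by
    rintro i hi i' hi' hsub a b c hab hbc ⟨_, ha, hEa⟩ ⟨_, hc, hEc⟩ hna hnc ⟨_, hb, hEb⟩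
    have hnbhd : nbhd E ⟨i, hi⟩ ⊆ nbhd E ⟨i', hi'⟩ := fun j hj => (hsub j ⟨hi, j.2, hj⟩).2.2
    exact ((h.enclosure _ _ hnbhd).out (x := ⟨a, ha⟩) (y := ⟨c, hc⟩)
      ⟨hEa, fun hE => hna ⟨hi, ha, hE⟩⟩ ⟨hEc, fun hE => hnc ⟨hi, hc, hE⟩⟩
      (show (⟨b, hb⟩ : Fin n) ∈ Set.Icc _ _ from ⟨hab, hbc⟩)).2 hEb

theorem natRel_iff_input {i j : ℕ} (hi : i < m) (hj : j < n) :
    natRel E i j ↔ 1 ≤ (input E p).idx 1 (i * n + j) := by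
  have hcell : (∃ i' : Fin m, ∃ j' : Fin n, i * n + j = i' * n + j' ∧ E i' j' = true) ↔
      natRel E i j := by
    constructor
    · rintro ⟨i', j', he, hE⟩
      obtain ⟨rfl, rfl⟩ := eq_and_eq_of_mul_add_eq hj j'.2 he
      exact ⟨hi, hj, hE⟩
    · rintro ⟨_, _, hE⟩
      exact ⟨⟨i, hi⟩, ⟨j, hj⟩, rfl, hE⟩
  by_cases h : natRel E i j <;> simp [input, hcell, h]

theorem cast_load {a : Fin n → Fin m} {a' : ℕ → ℕ} (h : ∀ j : Fin n, a' j = a j) (i : Fin m) :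
    ((∑ j ∈ Finset.range n with a' j = i, (input E p).val 0 j : ℚ) : ℝ) =
      ∑ j with a j = i, (p j : ℝ) := by
  rw [Finset.sum_filter, Finset.sum_filter,
    ← Fin.sum_univ_eq_sum_range (fun j => if a' j = i then (input E p).val 0 j else 0),
    Rat.cast_sum]
  refine Finset.sum_congr rfl fun j _ => ?_
  simp only [h j, input_val, Fin.val_inj]
  split_ifs <;> simp

theorem exists_feasibleWithin_le_makespan (h : IsInstance E p) {b : Fin n → Fin m}
    (hb : IsFeasible E b) :
    ∃ (M : ℚ) (b' : ℕ → ℕ), FeasibleWithin m n ((input E p).val 0) (natRel E) M b' ∧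
      (M : ℝ) ≤ makespan p b := by
  have : Nonempty (Fin m) := ⟨b ⟨0, h.jobs_pos⟩⟩
  let b' (j : ℕ) : ℕ := if hj : j < n then b ⟨j, hj⟩ else 0
  have hb' (j : Fin n) : b' j = b j := by simp [b']
  have hadj (j : ℕ) (hj : j < n) : b' j < m ∧ natRel E (b' j) j := by
    rw [hb' ⟨j, hj⟩]
    exact ⟨(b _).2, (b _).2, hj, hb ⟨j, hj⟩⟩
  let load (i : ℕ) : ℚ := ∑ j ∈ Finset.range n with b' j = i, (input E p).val 0 j
  have hload (i : ℕ) : 0 ≤ load i :=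
    Finset.sum_nonneg fun j _ => (natInstance_of_isInstance h).time_nonneg j
  obtain ⟨i₀, hi₀⟩ := Finite.exists_max fun i : Fin m => load i
  refine ⟨load i₀, b', ⟨hadj, fun i => ?_⟩, ?_⟩
  · by_cases hi : i < m
    · exact hi₀ ⟨i, hi⟩
    · rw [Finset.filter_false_of_mem, Finset.sum_empty]
      · exact hload i₀
      · rintro j hj rfl
        exact hi (hadj j (Finset.mem_range.1 hj)).1
  · rw [cast_load hb' i₀]
    exact le_ciSup (f := fun i => ∑ j with b j = i, (p j : ℝ)) (Set.finite_range _).bddAbove i₀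

theorem Solved.makespan_le {k : ℕ} (h : IsInstance E p) {a : Fin n → Fin m}
    {a' : ℕ → ℕ} (hs : Solved k m n ((input E p).val 0) (natRel E) a')
    (ha : ∀ j : Fin n, a' j = a j) {b : Fin n → Fin m} (hb : IsFeasible E b) :
    makespan p a ≤ (1 + 4 / k + 3 / (k : ℝ) ^ 2) * makespan p b := by
  have : Nonempty (Fin m) := ⟨a ⟨0, h.jobs_pos⟩⟩
  obtain ⟨T, hT, -, hload⟩ := hs
  obtain ⟨M, b', hM, hMb⟩ := exists_feasibleWithin_le_makespan h hb
  have hTM : (T : ℝ) ≤ (1 + 1 / k) * M := by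
    simpa using (Rat.cast_le (K := ℝ)).2 (hT M b' hM)
  refine ciSup_le fun i => ?_
  rw [← cast_load (E := E) ha]
  calc ((∑ j ∈ Finset.range n with a' j = i, (input E p).val 0 j : ℚ) : ℝ)
      ≤ (1 + 3 / k) * T := by
        simpa only [Rat.cast_mul, Rat.cast_add, Rat.cast_div, Rat.cast_one, Rat.cast_natCast,
          Rat.cast_ofNat] using (Rat.cast_le (K := ℝ)).2 (hload i)
    _ ≤ (1 + 3 / k) * ((1 + 1 / k) * makespan p b) := by
        gcongr
        exact hTM.trans (by gcongr)
    _ = (1 + 4 / k + 3 / (k : ℝ) ^ 2) * makespan p b := by ring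

theorem mainTime_le {k C : ℕ} (hC : 1 ≤ C) (hm : 0 < m) (hn : 0 < n) :
    (k + 2) * (C + 2) * 6000 * ((m + 1) * (n + 1) ^ (C + 4)) ≤
      ((k + 2) * (C + 2) * 6000 * (2 * 2 ^ (C + 4))) * ((m + n) * m * n ^ (2 * (C + 1))) := by
  have hpow : (n + 1) ^ (C + 4) ≤ 2 ^ (C + 4) * n ^ (2 * (C + 1) + 1) :=
    calc (n + 1) ^ (C + 4) ≤ (2 * n) ^ (C + 4) := Nat.pow_le_pow_left (by omega) _
      _ = 2 ^ (C + 4) * n ^ (C + 4) := mul_pow _ _ _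
      _ ≤ _ := Nat.mul_le_mul_left _ (Nat.pow_le_pow_right hn (by omega))
  calc (k + 2) * (C + 2) * 6000 * ((m + 1) * (n + 1) ^ (C + 4))
      ≤ (k + 2) * (C + 2) * 6000 * ((2 * m) * (2 ^ (C + 4) * n ^ (2 * (C + 1) + 1))) := by
        gcongr
        omega
    _ = ((k + 2) * (C + 2) * 6000 * (2 * 2 ^ (C + 4))) * (n * m * n ^ (2 * (C + 1))) := by
        rw [pow_succ n]; ring
    _ ≤ _ := by gcongr; omega

theorem isApproxAlgorithm_mainCmd {k C : ℕ} (hk : 0 < k) (hC : (k : ℚ) ≤ (1 + 2 / k) ^ C)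
    (hC1 : 1 ≤ C) :
    IsApproxAlgorithm (mainCmd k C) (1 + 4 / (k : ℝ) + 3 / (k : ℝ) ^ 2)
      (fun m n => ((k + 2) * (C + 2) * 6000 * (2 * 2 ^ (C + 4))) *
        ((m + n) * m * n ^ (2 * (C + 1)))) := by
  intro m n E p h
  obtain ⟨i₀, -⟩ := h.executable ⟨0, h.jobs_pos⟩
  obtain ⟨t, s, he, ht, hs⟩ := runs_mainCmd (s := input E p) (natInstance_of_isInstance h) hk hC
    (by simp [input]) (by simp [input]) rfl (fun i hi j hj => natRel_iff_input hi hj)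
    (fun a ha i => by simp [input, show a ≠ 0 by omega, show a ≠ 1 by omega]) (by simp [input])
  obtain ⟨-, -, hfeas, -⟩ := id hs
  let a : Fin n → Fin m := fun j => ⟨s.idx 2 j, (hfeas j j.2).1⟩
  exact ⟨t, s, a, he, ht.trans (mainTime_le hC1 i₀.pos h.jobs_pos), fun j => rfl,
    fun j => (hfeas j j.2).2.2.2, fun b hb => hs.makespan_le h (fun j => rfl) hb⟩

/-- The number of size classes of large jobs: the least `C` with `k ≤ (1 + 2 / k) ^ C`. -/
noncomputable def numClasses (k : ℕ) : ℕ := ⌈Real.log k / Real.log (1 + 2 / k)⌉₊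

theorem two_div_add_two_le_log {x : ℝ} (hx : 0 < x) : 2 / (x + 2) ≤ Real.log (1 + 2 / x) :=
  calc 2 / (x + 2) = 1 - (1 + 2 / x)⁻¹ := by field_simp; ring
    _ ≤ Real.log (1 + 2 / x) := Real.one_sub_inv_le_log_of_pos (by positivity)

theorem log_one_add_two_div_pos {x : ℝ} (hx : 0 < x) : 0 < Real.log (1 + 2 / x) :=
  lt_of_lt_of_le (by positivity) (two_div_add_two_le_log hx)

theorem log_le_div_exp_one {x : ℝ} (hx : 0 < x) : Real.log x ≤ x / Real.exp 1 := by
  simpa [Real.exp_sub, Real.exp_log hx] using Real.add_one_le_exp (Real.log x - 1)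

theorem log_le_rpow {x : ℝ} (hx : 0 < x) : Real.log x ≤ 25 / 27 * x ^ (0.4 : ℝ) := by
  have hlog : Real.log x = 5 / 2 * Real.log (x ^ (0.4 : ℝ)) := by
    rw [Real.log_rpow hx]; ring
  have hexp : x ^ (0.4 : ℝ) / Real.exp 1 ≤ x ^ (0.4 : ℝ) / (27 / 10) := by
    gcongr
    linarith [Real.exp_one_gt_d9]
  linarith [log_le_div_exp_one (Real.rpow_pos_of_pos hx 0.4)]

theorem le_pow_numClasses {k : ℕ} (hk : 0 < k) : (k : ℚ) ≤ (1 + 2 / k) ^ numClasses k := by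
  have hk' : (0 : ℝ) < k := by exact_mod_cast hk
  have hceil : Real.log k / Real.log (1 + 2 / k) ≤ numClasses k := Nat.le_ceil _
  rw [div_le_iff₀ (log_one_add_two_div_pos hk'), ← Real.log_pow,
    Real.log_le_log_iff hk' (by positivity)] at hceil
  refine (Rat.cast_le (K := ℝ)).1 ?_
  simpa using hceil

theorem one_le_numClasses {k : ℕ} (hk : 1 < k) : 1 ≤ numClasses k :=
  Nat.one_le_ceil_iff.2 (div_pos (Real.log_pos (by exact_mod_cast hk))
    (log_one_add_two_div_pos (by exact_mod_cast hk.pos)))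

theorem numClasses_le_ceil {k : ℕ} (hk : 0 < k) :
    numClasses k ≤ ⌈Real.log k / Real.log (1 + 1 / k)⌉₊ := by
  have hk' : (0 : ℝ) < 1 / k := by positivity
  refine Nat.ceil_mono (div_le_div_of_nonneg_left (Real.log_natCast_nonneg k)
    (Real.log_pos (by linarith)) (Real.log_le_log (by linarith) ?_))
  gcongr
  norm_num

theorem numClasses_le_rpow {k : ℕ} (hk : 4 ≤ k) : (numClasses k : ℝ) ≤ (k : ℝ) ^ (1.4 : ℝ) := by
  have hk4 : (4 : ℝ) ≤ k := by exact_mod_cast hk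
  have hk' : (0 : ℝ) < k := by linarith
  have hpow : 1 ≤ (k : ℝ) ^ (0.4 : ℝ) := Real.one_le_rpow (by linarith) (by norm_num)
  have hratio : Real.log k / Real.log (1 + 2 / k) ≤ 25 / 27 * k ^ (0.4 : ℝ) / (2 / (k + 2)) := by
    gcongr
    exacts [log_le_rpow hk', two_div_add_two_le_log hk']
  calc (numClasses k : ℝ) ≤ Real.log k / Real.log (1 + 2 / k) + 1 :=
        (Nat.ceil_lt_add_one (div_nonneg (Real.log_natCast_nonneg k)
          (log_one_add_two_div_pos hk').le)).le
    _ ≤ 25 / 27 * k ^ (0.4 : ℝ) / (2 / (k + 2)) + k ^ (0.4 : ℝ) := add_le_add hratio hpow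
    _ = (25 / 54 * (k + 2) + 1) * k ^ (0.4 : ℝ) := by field_simp; ring
    _ ≤ k * k ^ (0.4 : ℝ) := by gcongr; linarith
    _ = (k : ℝ) ^ (1.4 : ℝ) := by
        rw [show (1.4 : ℝ) = 1 + 0.4 by norm_num, Real.rpow_add hk', Real.rpow_one]

theorem makespan_nonneg (hp : ∀ j, 0 ≤ p j) (a : Fin n → Fin m) : 0 ≤ makespan p a :=
  Real.iSup_nonneg fun _ => Finset.sum_nonneg fun j _ => by exact_mod_cast hp j

theorem isApproxAlgorithm_mono {P : Cmd} {ρ ρ' : ℝ} {T T' : ℕ → ℕ → ℕ}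
    (h : IsApproxAlgorithm P ρ T) (hρ : ρ ≤ ρ') (hT : ∀ m n, T m n ≤ T' m n) :
    IsApproxAlgorithm P ρ' T' := fun m n E p hI =>
  let ⟨t, s, a, he, ht, hout, hfeas, ha⟩ := h m n E p hI
  ⟨t, s, a, he, ht.trans (hT m n), hout, hfeas, fun b hb => (ha b hb).trans
    (mul_le_mul_of_nonneg_right hρ (makespan_nonneg (fun j => (hI.time_pos j).le) b))⟩

theorem four_div_add_three_div_sq_le {ε : ℝ} (hε : 0 < ε) {k : ℕ} (hk : 1 ≤ k) (hkε : 7 / ε ≤ k) :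
    4 / (k : ℝ) + 3 / (k : ℝ) ^ 2 ≤ ε := by
  have hk' : (1 : ℝ) ≤ k := by exact_mod_cast hk
  calc 4 / (k : ℝ) + 3 / (k : ℝ) ^ 2 ≤ 4 / k + 3 / k := by
        gcongr
        exact le_self_pow₀ hk' two_ne_zero
    _ = 7 / k := by ring
    _ ≤ ε := (div_le_comm₀ hε (by positivity)).1 hkε

theorem add_mul_mul_pow_le (m n d : ℕ) : (m + n) * m * n ^ d ≤ (m + n) ^ (d + 2) :=
  calc (m + n) * m * n ^ d ≤ (m + n) * (m + n) * (m + n) ^ d := by gcongr <;> omega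
    _ = (m + n) ^ (d + 2) := by ring

end ConvexMakespan

open ConvexMakespan

theorem theorem2 :
    (∀ k : ℕ, 4 ≤ k →
      ∃ C : ℕ, (C : ℝ) ≤ (k : ℝ) ^ (1.4 : ℝ) ∧
        C ≤ ⌈Real.log k / Real.log (1 + 1 / k)⌉₊ ∧
        ∃ (P : RAM.Cmd) (K : ℕ),
          MinMax.IsApproxAlgorithm P (1 + 4 / (k : ℝ) + 3 / (k : ℝ) ^ 2)
            (fun m n => K * ((m + n) * m * n ^ (2 * (C + 1))))) ∧
    (∀ ε : ℝ, 0 < ε →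
      ∃ (P : RAM.Cmd) (K d : ℕ),
        MinMax.IsApproxAlgorithm P (1 + ε) (fun m n => K * (m + n) ^ d)) := by
  refine ⟨fun k hk => ⟨numClasses k, numClasses_le_rpow hk, numClasses_le_ceil (by omega), _, _,
    isApproxAlgorithm_mainCmd (by omega) (le_pow_numClasses (by omega))
      (one_le_numClasses (by omega))⟩, fun ε hε => ?_⟩
  obtain ⟨k, hk⟩ := exists_nat_ge (max 2 (7 / ε))
  have hk2 : 2 ≤ k := by exact_mod_cast (le_max_left _ _).trans hk
  refine ⟨_, _, _, isApproxAlgorithm_mono (isApproxAlgorithm_mainCmd (by omega)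
    (le_pow_numClasses (by omega)) (one_le_numClasses hk2)) ?_
    fun m n => Nat.mul_le_mul_left _ (add_mul_mul_pow_le m n _)⟩
  have := four_div_add_three_div_sq_le hε (by omega) ((le_max_right _ _).trans hk)
  linarith
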